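/- Let $n\ge 2$ and $A>0$. Write points of $\mathbb{R}^{n+1}$ as $(x,y)\in\mathbb{R}\times\mathbb{R}^n$ and put $O=(0,0)$. **Initial domain and vector field.** Let $b_0>0$ and let $u_0$ be continuous and even on $[-b_0,b_0]$, positive and smooth on $(0,b_0)$, with $u_0(0)=u_0(\pm b_0)=0$, such that $\{|y|=u_0(x),\,|x|\le b_0\}\setminus\{O\}$ is a smooth hypersurface. Let $U=\{|y|<u_0(x),\ |x|\le b_0\}$. Let $\varepsilon_0,\varepsilon_1>0$, $Z=\{(x,0):|x|\le\varepsilon_0\}$, and let $X$ be a vector field, smooth on $\mathbb{R}^{n+1}\setminus Z$, such that $\langle X,\mathbf n\rangle>0$ on $\partial U$ off the $x$-axis ($\mathbf n$ the inward unit normal), $X(x,y)=(0,-y/|y|)$ for $y\neq0$, $|(x,y)|<\varepsilon_0$, and $X\equiv(\mp1,0)$ on the ball of radius $\varepsilon_1$ around $(\pm b_0,0)$. Let $\sigma(P,s)$ be the flow of $X$ starting at $P$, extended continuously to the time at which a flow line first reaches $Z$ (and undefined beyond that time). **Reference hypersurface.** Let $\Sigma$ be a compact connected smooth hypersurface with $X(P)\notin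 T_P\Sigma$ for all $P\in\Sigma$, and let $\rho>0$, $0<d<c$ be such that $\Sigma=\partial U$ in $\{|y|\ge2\rho\}$ and $\Sigma\cap\{|y|\le\rho\}=\Delta_c\cup\Delta_{-c}\cup B_d$, where $\Delta_{\pm c}=\{(\pm c,y):|y|\le\rho\}$ and $B_d=\{|x|\le d,\ |y|=\rho\}$. Let $\delta>0$ be such that for $|s|<\delta$: the points $(\pm(c-s),y)$, $|y|\le\rho$, lie in the ball of radius $\varepsilon_1$ around $(\pm b_0,0)$; the points $(x,(\rho-s)y/\rho)$ with $(x,y)\in B_d$, $s\le\rho$, lie in the ball of radius $\varepsilon_0$ around $O$; and $\sigma(P,s)$ is defined and not in $Z$ for all $P\in\Sigma$ if moreover $s<\rho$. **$\alpha$-domains.** For $\alpha>0$, an open set of the form $\{|y|<h(x)\}$ is an $\alpha$-domain if $\{h>0\}$ is a bounded open non-empty interval on which $h$ is smooth, and its boundary meets each cylinder $\{|y|=s\}$, $0<s\le\alpha$, transversally and exactly twice (in two $(n-1)$-spheres, one for each of exactly two values of $x$), at points with $h(x)>0$. **Claim.** Let $T>0$ and $\alpha:(0,T]\to(0,\infty)$.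 For $j=1,2$ let $\Gamma_j(t)$, $0\le t\le T$, be sets and $u_j:\Sigma\times[0,T]\to(-\delta,\delta)$ continuous, such that for each $t\in[0,T]$ the set $\Gamma_j(t)$ lies in the image of $\sigma$ on $\Sigma\times(-\delta,\delta)$ and $\sigma^{-1}(\Gamma_j(t))=\{(P,u_j(P,t)):P\in\Sigma\}$ there. Assume that $u_j$ is smooth on $\Sigma\times(0,T]$ and on $(\Sigma\setminus(\Delta_c\cup\Delta_{-c}\cup B_d))\times[0,T]$, and that $\rho-u_j$ is bounded below by a positive constant on the latter set. For $0<t\le T$ let $\Gamma_j(t)=\partial D_j(t)$ with $D_j(t)$ a bounded open $\alpha(t)$-domain. If 1. for $0<t<T$, $\Gamma_j(t)$ is a smooth family of smooth hypersurfaces evolving by $V=-\kappa+A$, where $V$ is the outer normal velocity and $\kappa$ the mean curvature, i.e. the divergence of the outer unit normal of $D_j(t)$ (so $\kappa=n$ on the unit sphere), $j=1,2$; 2. $\Gamma_1(0)=\Gamma_2(0)$; 3. $\int_0^T\alpha(t)^{-2}\,dt<\infty$, then $\Gamma_1(t)=\Gamma_2(t)$ for all $0<t\le T$. -/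

import Mathlib

open Set Filter Topology
open scoped ContDiff

noncomputable section

/-- The ambient space `ℝⁿ⁺¹ = ℝ × ℝⁿ` with its Euclidean structure; a point is written `(x, y)`,
with `x = P.fst` and `y = P.snd`, and `r = ‖y‖` is the distance to the `x`-axis. -/
abbrev Amb (n : ℕ) : Type := WithLp 2 (ℝ × EuclideanSpace ℝ (Fin n))

/-- The point `(x, y)`. -/
def pt {n : ℕ} (x : ℝ) (y : EuclideanSpace ℝ (Fin n)) : Amb n := WithLp.toLp 2 (x, y)

/-! ### Hypersurfaces -/

/-- `S` is a smooth embedded hypersurface (without boundary): locally it is the zero set of a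
smooth function whose differential does not vanish on it. -/
def IsSmoothHypersurface {n : ℕ} (S : Set (Amb n)) : Prop :=
  ∀ P ∈ S, ∃ N : Set (Amb n), IsOpen N ∧ P ∈ N ∧ ∃ f : Amb n → ℝ, ContDiffOn ℝ ∞ f N ∧
    fderiv ℝ f P ≠ 0 ∧ ∀ Q ∈ N, (Q ∈ S ↔ f Q = 0)

/-- The tangent space `T_P S` of an embedded submanifold `S`: the vectors annihilated by the
differentials at `P` of all smooth functions that vanish on `S` near `P`. -/
def tangentVectors {n : ℕ} (S : Set (Amb n)) (P : Amb n) : Set (Amb n) :=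
  {v | ∀ f : Amb n → ℝ, ContDiffAt ℝ ∞ f P → (∀ᶠ Q in 𝓝[S] P, f Q = 0) → fderiv ℝ f P v = 0}

/-! ### Normal velocity, mean curvature, and the evolution law `V = -κ + A`

A moving hypersurface is described near one of its points by a function `ψ` of `(P, t)`, with
`ψ = 0` on the hypersurface and `ψ > 0` in the enclosed domain. -/

/-- Divergence of a vector field. -/
def divergence {n : ℕ} (W : Amb n → Amb n) (P : Amb n) : ℝ :=
  LinearMap.trace ℝ (Amb n) (fderiv ℝ W P : Amb n →ₗ[ℝ] Amb n)

/-- Outer unit normal of `∂{g > 0}`. -/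
def outerNormal {n : ℕ} (g : Amb n → ℝ) (P : Amb n) : Amb n :=
  -(‖gradient g P‖⁻¹ • gradient g P)

/-- Mean curvature of `∂{g > 0}`: the divergence of the outer unit normal (a unit sphere bounding
the unit ball of `ℝⁿ⁺¹` has mean curvature `n`). -/
def meanCurvature {n : ℕ} (g : Amb n → ℝ) (P : Amb n) : ℝ :=
  divergence (outerNormal g) P

/-- Outer normal velocity at time `t` of the moving hypersurface `∂{ψ(·, t) > 0}`. -/
def normalVelocity {n : ℕ} (ψ : Amb n → ℝ → ℝ) (P : Amb n) (t : ℝ) : ℝ :=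
  deriv (fun τ => ψ P τ) t / ‖gradient (fun Q => ψ Q t) P‖

/-- The boundaries `Γ t` of the domains `D t` form, for `0 < t < T`, a smooth family of smooth
hypersurfaces that evolves by `V = -κ + A`. -/
def EvolvesByForcedMCF {n : ℕ} (A T : ℝ) (Γ D : ℝ → Set (Amb n)) : Prop :=
  ∀ t ∈ Ioo 0 T, ∀ P ∈ Γ t, ∃ N : Set (Amb n × ℝ), IsOpen N ∧ (P, t) ∈ N ∧
    ∃ ψ : Amb n → ℝ → ℝ, ContDiffOn ℝ ∞ (Function.uncurry ψ) N ∧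
      gradient (fun Q => ψ Q t) P ≠ 0 ∧
      (∀ q ∈ N, (q.1 ∈ Γ q.2 ↔ ψ q.1 q.2 = 0) ∧ (q.1 ∈ D q.2 ↔ 0 < ψ q.1 q.2)) ∧
      normalVelocity ψ P t = -meanCurvature (fun Q => ψ Q t) P + A

/-! ### `α`-domains -/

/-- `U` is an `α`-domain: `U = {r < h(x)}` is open, `{h > 0}` is a bounded open interval on which
`h` is smooth, and `∂U` meets every cylinder `{r = s}`, `0 < s ≤ α`, exactly twice (counted in the
half-plane of the variables `x, r`), transversally. At a point of `∂U` with `h x > 0` a normal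
is `(h'(x), -y/r)`, so that transversality to the cylinder means `h'(x) ≠ 0`. -/
def IsAlphaDomain {n : ℕ} (α : ℝ) (U : Set (Amb n)) : Prop :=
  IsOpen U ∧ ∃ h : ℝ → ℝ, U = {P | ‖P.snd‖ < h P.fst} ∧
    (∃ a₁ a₂ : ℝ, a₁ < a₂ ∧ {x | 0 < h x} = Ioo a₁ a₂) ∧
    ContDiffOn ℝ ∞ h {x | 0 < h x} ∧
    ∀ s ∈ Ioc 0 α,
      {x : ℝ | ∃ y : EuclideanSpace ℝ (Fin n), ‖y‖ = s ∧ pt x y ∈ frontier U}.ncard = 2 ∧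
      ∀ x : ℝ, ∀ y : EuclideanSpace ℝ (Fin n), ‖y‖ = s → pt x y ∈ frontier U →
        0 < h x ∧ deriv h x ≠ 0

/-! ### The singular initial hypersurface and the transverse vector field -/

/-- `U = {|y| < u₀(x), -b₀ ≤ x ≤ b₀}`. -/
def initialDomain (n : ℕ) (b₀ : ℝ) (u₀ : ℝ → ℝ) : Set (Amb n) :=
  {P | P.fst ∈ Icc (-b₀) b₀ ∧ ‖P.snd‖ < u₀ P.fst}

/-- `Γ₀ = {|y| = u₀(x), -b₀ ≤ x ≤ b₀}`. -/
def initialHypersurface (n : ℕ) (b₀ : ℝ) (u₀ : ℝ → ℝ) : Set (Amb n) :=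
  {P | P.fst ∈ Icc (-b₀) b₀ ∧ ‖P.snd‖ = u₀ P.fst}

/-- The even profile `u₀` vanishes exactly at `0` and `± b₀`, and `Γ₀` is smooth away from the
origin. -/
structure IsInitialProfile (n : ℕ) (b₀ : ℝ) (u₀ : ℝ → ℝ) : Prop where
  b₀_pos : 0 < b₀
  even : ∀ x ∈ Icc (-b₀) b₀, u₀ (-x) = u₀ x
  continuousOn : ContinuousOn u₀ (Icc (-b₀) b₀)
  pos : ∀ x ∈ Ioo 0 b₀, 0 < u₀ x
  zero : u₀ 0 = 0
  zero_end : u₀ b₀ = 0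
  smooth : ContDiffOn ℝ ∞ u₀ (Ioo 0 b₀)
  hypersurface : IsSmoothHypersurface (initialHypersurface n b₀ u₀ \ {0})

/-- The inward unit normal of `U` at the boundary point `(x, y)`, `y ≠ 0`. -/
def profileInwardNormal {n : ℕ} (u₀ : ℝ → ℝ) (x : ℝ) (y : EuclideanSpace ℝ (Fin n)) : Amb n :=
  ‖pt (deriv u₀ x) (-(‖y‖⁻¹ • y))‖⁻¹ • pt (deriv u₀ x) (-(‖y‖⁻¹ • y))

/-- The segment `{(x, 0) : |x| ≤ ε}` of the `x`-axis, where `(0, -y/|y|)` has no meaning. -/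
def axisSegment (n : ℕ) (ε : ℝ) : Set (Amb n) :=
  {P | P.snd = 0 ∧ |P.fst| ≤ ε}

/-- The vector field `X`: smooth off the axis near the origin, pointing into `U` along `∂U` off the
axis, equal to `(0, -y/|y|)` near the origin and to `(∓1, 0)` near the end points `(± b₀, 0)`. -/
structure IsTransverseField {n : ℕ} (b₀ : ℝ) (u₀ : ℝ → ℝ) (ε₀ ε₁ : ℝ) (X : Amb n → Amb n) :
    Prop where
  ε₀_pos : 0 < ε₀
  ε₁_pos : 0 < ε₁
  smooth : ContDiffOn ℝ ∞ X (axisSegment n ε₀)ᶜ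
  inward : ∀ (x : ℝ) (y : EuclideanSpace ℝ (Fin n)), y ≠ 0 →
    pt x y ∈ frontier (initialDomain n b₀ u₀) →
      0 < inner ℝ (X (pt x y)) (profileInwardNormal u₀ x y)
  near_origin : ∀ (x : ℝ) (y : EuclideanSpace ℝ (Fin n)), y ≠ 0 →
    pt x y ∈ Metric.ball (0 : Amb n) ε₀ → X (pt x y) = pt 0 (-(‖y‖⁻¹ • y))
  near_right : ∀ P ∈ Metric.ball (pt b₀ 0 : Amb n) ε₁, X P = pt (-1) 0
  near_left : ∀ P ∈ Metric.ball (pt (-b₀) 0 : Amb n) ε₁, X P = pt 1 0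

/-- `σ(P, s) = Q` for the flow `σ` of `X`: an integral curve of `X` leads from `P` to `Q` in time
`s` (backwards if `s < 0`) and does not meet the singular set `Z` of `X` on the way. The end point
`Q` itself may lie on `Z`, where `σ` is then the continuous extension of the flow. -/
def FlowsTo {n : ℕ} (X : Amb n → Amb n) (Z : Set (Amb n)) (P : Amb n) (s : ℝ) (Q : Amb n) : Prop :=
  ∃ γ : ℝ → Amb n, γ 0 = P ∧ γ s = Q ∧ ContinuousOn γ (uIcc 0 s) ∧
    ∀ τ ∈ Ioo (min 0 s) (max 0 s), γ τ ∉ Z ∧ HasDerivAt γ (X (γ τ)) τ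

/-! ### The reference hypersurface -/

/-- The disc `{(c, y) : |y| ≤ ρ}`. -/
def flatDisc (n : ℕ) (c ρ : ℝ) : Set (Amb n) := {P | P.fst = c ∧ ‖P.snd‖ ≤ ρ}

/-- The pipe `{(x, y) : -d ≤ x ≤ d, |y| = ρ}`. -/
def pipe (n : ℕ) (d ρ : ℝ) : Set (Amb n) := {P | P.fst ∈ Icc (-d) d ∧ ‖P.snd‖ = ρ}

/-- The flat and cylindrical part `Δ_c ∪ Δ_{-c} ∪ B_d` of the reference hypersurface. -/
def flatPart (n : ℕ) (c d ρ : ℝ) : Set (Amb n) := flatDisc n c ρ ∪ flatDisc n (-c) ρ ∪ pipe n d ρ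

/-- `S` is a reference hypersurface for `∂U`, transverse to `X`, and `δ` bounds the times for which
the flow `σ` of `X` is used on it. The last four fields say that the parameters are small enough:
for `|s| < δ` one has `σ(P, s) = (± (c - s), y)` on the discs and
`σ(P, s) = (x, (ρ - s) y/|y|)`, `s ≤ ρ`, on the pipe, these points staying in the balls on which
`X` is explicit, and the flow starting on `S` exists for `|s| < δ` as long as `s < ρ`. -/
structure IsReferenceHypersurface {n : ℕ} (b₀ : ℝ) (u₀ : ℝ → ℝ) (ε₀ ε₁ : ℝ) (X : Amb n → Amb n)
    (S : Set (Amb n)) (ρ c d δ : ℝ) : Prop where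
  ρ_pos : 0 < ρ
  d_pos : 0 < d
  d_lt_c : d < c
  δ_pos : 0 < δ
  compact : IsCompact S
  connected : IsConnected S
  hypersurface : IsSmoothHypersurface S
  transverse : ∀ P ∈ S, X P ∉ tangentVectors S P
  outer_part : ∀ P : Amb n, 2 * ρ ≤ ‖P.snd‖ → (P ∈ S ↔ P ∈ frontier (initialDomain n b₀ u₀))
  inner_part : ∀ P : Amb n, ‖P.snd‖ ≤ ρ → (P ∈ S ↔ P ∈ flatPart n c d ρ)
  right_disc : ∀ P ∈ flatDisc n c ρ, ∀ s ∈ Ioo (-δ) δ,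
    pt (c - s) P.snd ∈ Metric.ball (pt b₀ 0 : Amb n) ε₁
  left_disc : ∀ P ∈ flatDisc n (-c) ρ, ∀ s ∈ Ioo (-δ) δ,
    pt (-c + s) P.snd ∈ Metric.ball (pt (-b₀) 0 : Amb n) ε₁
  pipe_part : ∀ P ∈ pipe n d ρ, ∀ s ∈ Ioo (-δ) δ, s ≤ ρ →
    pt P.fst (((ρ - s) / ρ) • P.snd) ∈ Metric.ball (0 : Amb n) ε₀
  flow : ∀ P ∈ S, ∀ s ∈ Ioo (-δ) δ, s < ρ →
    ∃ Q ∉ axisSegment n ε₀, FlowsTo X (axisSegment n ε₀) P s Q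

/-- `σ⁻¹(G)` is the graph of `v : S → (-δ, δ)`, and `G` lies in the image of `σ`. -/
def IsFlowGraph {n : ℕ} (X : Amb n → Amb n) (Z S : Set (Amb n)) (δ : ℝ) (G : Set (Amb n))
    (v : Amb n → ℝ) : Prop :=
  (∀ P ∈ S, v P ∈ Ioo (-δ) δ ∧ ∃ Q ∈ G, FlowsTo X Z P (v P) Q) ∧
  (∀ P ∈ S, ∀ s ∈ Ioo (-δ) δ, ∀ Q ∈ G, FlowsTo X Z P s Q → s = v P) ∧
  (∀ Q ∈ G, ∃ P ∈ S, FlowsTo X Z P (v P) Q)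

/-- A family `Γ t`, `0 ≤ t ≤ T`, written as the graph of `u(·, t)` over the reference hypersurface
`S`, with the regularity of `u`, and bounding `α(t)`-domains `D t` for `0 < t ≤ T`. -/
structure IsAdmissibleFamily {n : ℕ} (ε₀ : ℝ) (X : Amb n → Amb n) (S : Set (Amb n))
    (ρ c d δ T : ℝ) (α : ℝ → ℝ) (Γ D : ℝ → Set (Amb n)) (u : Amb n → ℝ → ℝ) : Prop where
  graph : ∀ t ∈ Icc 0 T, IsFlowGraph X (axisSegment n ε₀) S δ (Γ t) (fun P => u P t)
  continuousOn : ContinuousOn (Function.uncurry u) (S ×ˢ Icc 0 T)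
  smooth : ContDiffOn ℝ ∞ (Function.uncurry u) (S ×ˢ Ioc 0 T)
  smooth_initial : ContDiffOn ℝ ∞ (Function.uncurry u) ((S \ flatPart n c d ρ) ×ˢ Icc 0 T)
  bounded_below : ∃ m > 0, ∀ P ∈ S \ flatPart n c d ρ, ∀ t ∈ Icc 0 T, m ≤ ρ - u P t
  bounded : ∀ t ∈ Ioc 0 T, Bornology.IsBounded (D t)
  boundary : ∀ t ∈ Ioc 0 T, frontier (D t) = Γ t
  alphaDomain : ∀ t ∈ Ioc 0 T, IsAlphaDomain (α t) (D t)

end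

/-!
The two hypersurfaces are graphs of `u₁(·, t)` and `u₂(·, t)` along the orbits of `X` over the
compact reference hypersurface `S`, and the claim is that `w = u₁ - u₂` vanishes. This follows from
a maximum principle for `w`, which is singular only in that its coefficients blow up like `α⁻²`.

*Flow coordinates.* The flow of a smooth vector field depends smoothly on its data: the map
`γ ↦ X ∘ γ` on continuous paths is smooth (`contDiff_compositionOperator`), and the implicit function
theorem applies to the integral equation (`Reaches.exists_smooth_flow_hasDerivAt`). As `X` is
transverse to `S`, a point near a hypersurface is determined by a point `π` of `S` and a time `τ`
(`IsReferenceHypersurface.exists_flowBox`), and `τ - u(π, t)` is a defining function of `Γ t`.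

*Law of motion.* For a function `g` that is positive in `D t` and vanishes on `Γ t`, the equation
`V = -κ + A` involves only `levelSetOp A (∇g) (D∇g)`, the sum of the trace of the Hessian over the
tangent space and `A |∇g|`. The operator is monotone in the Hessian, and it is multiplied by `λ` when
`g` is replaced by another defining function with gradient `λ ∇g` on `Γ t`
(`levelSetOp_of_vanishing`). If `g` grows at unit speed along `X`, this gives
`∂ₜu = -levelSetOp A (∇g) (D∇g)` (`IsAdmissibleFamily.hasDerivAt_time`). The sign is fixed by the
fact that `X` points into `D t` everywhere, as it does so at the tip of a cap and `S` is connected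
(`IsAdmissibleFamily.entersAlong`).

*Maximum principle.* At a maximum `P` of `w(·, t)` with value `M > 0`, let `Q₁` and `Q₂` be the points
of the two hypersurfaces over `P`. A defining function `f` of the second hypersurface, lowered by `M`,
touches one of the first from below at `Q₁`. Hence `∂ₜw` is at most the difference of the values of
the level set operator of `f` at `Q₂` and at `Q₁` (`deriv_sub_deriv_le_of_isMax`). There are three
cases. Over the discs `X` is constant and the difference is zero (`hasGrowthBound_of_const`). Away
from the flat part of `S` everything is smooth up to the initial time and the difference is `O(M)`
(`hasGrowthBound_of_notMem_flatPart`). Over the pipe `f = k(x) - |y|`, and the difference is that of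
the curvatures of the cross sections of the neck, which is `O(M / (r₁ r₂))` with the radii `r₁`, `r₂`
of the two necks (`hasGrowthBound_of_mem_pipe`). A cylinder of radius at most `α` meets the boundary
of an `α`-domain only twice; one of radius at most `ρ` already meets both caps, so that
`rⱼ ≥ min α ρ` (`IsAdmissibleFamily.lt_norm_snd`).

*Conclusion.* `max |w|` is Lipschitz in time on compact subintervals of `(0, T)`, and at almost every
time its logarithmic derivative is at most `C (1 + α⁻²)`, which is integrable. So the maximum cannot
leave the value zero (`pos_of_deriv_le_mul`).
-/

/-! ### Composition operators on spaces of continuous maps -/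

section Nemytskii

universe u

variable {K : Type*} [TopologicalSpace K] [CompactSpace K]
  {E F : Type*} [NormedAddCommGroup E] [NormedSpace ℝ E]
  [NormedAddCommGroup F] [NormedSpace ℝ F]

/-- Pointwise application of a continuous family of operators to a continuous family of vectors,
as a continuous bilinear map of the two families. -/
noncomputable def pointwiseApply (K : Type*) [TopologicalSpace K] [CompactSpace K]
    (E F : Type*) [NormedAddCommGroup E] [NormedSpace ℝ E]
    [NormedAddCommGroup F] [NormedSpace ℝ F] : C(K, E →L[ℝ] F) →L[ℝ] C(K, E) →L[ℝ] C(K, F) :=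
  LinearMap.mkContinuous₂
    (LinearMap.mk₂ ℝ (fun (A : C(K, E →L[ℝ] F)) (h : C(K, E)) =>
        (⟨fun k => A k (h k), A.continuous.clm_apply h.continuous⟩ : C(K, F)))
      (fun _ _ _ => by ext; simp) (fun _ _ _ => by ext; simp)
      (fun _ _ _ => by ext; simp) (fun _ _ _ => by ext; simp)) 1
    (fun A h => by
      rw [one_mul, ContinuousMap.norm_le _ (by positivity)]
      intro k
      exact ((A k).le_opNorm _).trans (mul_le_mul (A.norm_coe_le_norm k) (h.norm_coe_le_norm k)
        (norm_nonneg (h k)) (norm_nonneg A)))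

/-- The composition operator `γ ↦ f ∘ γ` on continuous maps. -/
def compositionOperator (K : Type*) [TopologicalSpace K] {E F : Type*}
    [TopologicalSpace E] [TopologicalSpace F] (f : C(E, F)) (γ : C(K, E)) : C(K, F) := f.comp γ

lemma hasFDerivAt_compositionOperator {f : C(E, F)} {f' : C(E, E →L[ℝ] F)}
    (hf : ∀ x, HasFDerivAt f (f' x) x) (γ : C(K, E)) :
    HasFDerivAt (compositionOperator K f) (pointwiseApply K E F (compositionOperator K f' γ)) γ := by
  rw [hasFDerivAt_iff_isLittleO_nhds_zero, Asymptotics.isLittleO_iff]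
  intro ε hε
  have hc : IsCompact (range γ) := isCompact_range γ.continuous
  have hu := hc.uniformContinuousAt_of_continuousAt f' (fun x _ => f'.continuous.continuousAt)
    (Metric.dist_mem_uniformity hε)
  obtain ⟨δ, hδ, hδ'⟩ := Metric.mem_uniformity_dist.1 hu
  filter_upwards [Metric.ball_mem_nhds (0 : C(K, E)) hδ] with h hh
  rw [mem_ball_zero_iff] at hh
  rw [ContinuousMap.norm_le _ (by positivity)]
  intro k
  have hk : ‖h k‖ < δ := (h.norm_coe_le_norm k).trans_lt hh
  have key : ‖f (γ k + h k) - f (γ k) - f' (γ k) (h k)‖ ≤ ε * ‖h k‖ := by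
    have := (convex_ball (γ k) δ).norm_image_sub_le_of_norm_hasFDerivWithin_le'
      (f := f) (f' := fun x => f' x) (φ := f' (γ k)) (C := ε)
      (fun x _ => (hf x).hasFDerivWithinAt)
      (fun x hx => by
        have := hδ' (a := γ k) (b := x) (by rw [dist_comm]; exact hx) (mem_range_self k)
        rw [← dist_eq_norm, dist_comm]
        exact le_of_lt this)
      (Metric.mem_ball_self hδ)
      (y := γ k + h k) (by simpa [Metric.mem_ball, dist_eq_norm] using hk)
    simpa using this
  exact key.trans (mul_le_mul_of_nonneg_left (h.norm_coe_le_norm k) hε.le)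

/-- The target `F` varies in the induction, because the derivative of composition with `f` is
composition with `f' : E → (E →L[ℝ] F)`; this is why `E` and `F` share a universe. -/
lemma contDiff_compositionOperator_nat {E : Type u} [NormedAddCommGroup E] [NormedSpace ℝ E]
    (m : ℕ) : ∀ {F : Type u} [NormedAddCommGroup F] [NormedSpace ℝ F]
      {f : C(E, F)}, ContDiff ℝ ∞ f → ContDiff ℝ m (compositionOperator K f) := by
  induction m with
  | zero =>
    intro F _ _ f _
    exact contDiff_zero.2 (ContinuousMap.continuous_postcomp f)
  | succ m ih =>
    intro F _ _ f hf
    have hd : ContDiff ℝ ∞ (fderiv ℝ f) := hf.fderiv_right (by simp)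
    let f' : C(E, E →L[ℝ] F) := ⟨fderiv ℝ f, hd.continuous⟩
    have : ((m + 1 : ℕ) : WithTop ℕ∞) = (m : WithTop ℕ∞) + 1 := by push_cast; rfl
    rw [this, contDiff_succ_iff_hasFDerivAt]
    refine ⟨fun γ => pointwiseApply K E F (compositionOperator K f' γ), ?_, ?_⟩
    · exact (pointwiseApply K E F).contDiff.comp (ih (f := f') hd)
    · intro γ
      exact hasFDerivAt_compositionOperator
        (fun x => (hf.differentiable (by simp)).differentiableAt.hasFDerivAt) γ

lemma contDiff_compositionOperator {E F : Type u} [NormedAddCommGroup E] [NormedSpace ℝ E]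
    [NormedAddCommGroup F] [NormedSpace ℝ F] {f : C(E, F)} (hf : ContDiff ℝ ∞ f) :
    ContDiff ℝ ∞ (compositionOperator K f) :=
  contDiff_infty.2 fun m => contDiff_compositionOperator_nat m hf

end Nemytskii

/-! ### Volterra operators -/

section Volterra

variable {E : Type*} [NormedAddCommGroup E] [NormedSpace ℝ E]

/-- The unit interval as the domain of reparametrized orbits. -/
abbrev UI : Type := Icc (0 : ℝ) 1

/-- Integration from `0`, as an operator on continuous maps on the unit interval. -/
noncomputable def primitive (E : Type*) [NormedAddCommGroup E] [NormedSpace ℝ E] :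
    C(UI, E) →L[ℝ] C(UI, E) :=
  LinearMap.mkContinuous
    { toFun := fun c => ⟨fun θ => ∫ t in (0 : ℝ)..θ, c (projIcc 0 1 zero_le_one t), by
        have : Continuous fun t : ℝ => c (projIcc 0 1 zero_le_one t) :=
          c.continuous.comp continuous_projIcc
        exact (intervalIntegral.continuous_primitive
          (fun a b => this.intervalIntegrable a b) 0).comp continuous_subtype_val⟩
      map_add' := fun c c' => by
        ext θ
        simp only [ContinuousMap.coe_mk, ContinuousMap.add_apply]
        exact intervalIntegral.integral_add
          ((c.continuous.comp continuous_projIcc).intervalIntegrable _ _)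
          ((c'.continuous.comp continuous_projIcc).intervalIntegrable _ _)
      map_smul' := fun r c => by
        ext θ
        simp only [ContinuousMap.coe_mk, ContinuousMap.smul_apply, RingHom.id_apply]
        exact intervalIntegral.integral_smul _ _ } 1
    (fun c => by
      rw [one_mul, ContinuousMap.norm_le _ (norm_nonneg _)]
      intro θ
      have := intervalIntegral.norm_integral_le_of_norm_le_const (a := (0 : ℝ)) (b := θ)
        (f := fun t => c (projIcc 0 1 zero_le_one t)) (C := ‖c‖)
        (fun t _ => c.norm_coe_le_norm _)
      refine this.trans ?_
      rw [sub_zero, abs_of_nonneg θ.2.1]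
      exact mul_le_of_le_one_right (norm_nonneg _) θ.2.2)

lemma primitive_apply (c : C(UI, E)) (θ : UI) :
    primitive E c θ = ∫ t in (0 : ℝ)..θ, c (projIcc 0 1 zero_le_one t) := rfl

/-- A bounded operator that integrates a function controlled pointwise by its argument gains a
factor `C * θ / k` at the `k`-th iteration. -/
lemma norm_primitive_pow_le (V : C(UI, E) →L[ℝ] C(UI, E)) {C : ℝ} (hC : 0 ≤ C)
    (hV : ∀ h : C(UI, E), ∃ h' : C(UI, E), V h = primitive E h' ∧ ∀ θ, ‖h' θ‖ ≤ C * ‖h θ‖)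
    (k : ℕ) (h : C(UI, E)) (θ : UI) :
    ‖(V ^ k) h θ‖ ≤ C ^ k * (θ : ℝ) ^ k / k.factorial * ‖h‖ := by
  induction k generalizing θ with
  | zero => simpa using h.norm_coe_le_norm θ
  | succ k ih =>
    rw [pow_succ', mul_apply_eq_comp]
    obtain ⟨h', e, hh'⟩ := hV ((V ^ k) h)
    rw [e, primitive_apply]
    have hθ := θ.2.1
    have h1 : ∀ t ∈ Icc (0 : ℝ) θ, ‖h' (projIcc 0 1 zero_le_one t)‖
        ≤ C * (C ^ k / k.factorial * ‖h‖) * t ^ k := by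
      intro t ht
      have ht' : t ∈ Icc (0 : ℝ) 1 := ⟨ht.1, ht.2.trans θ.2.2⟩
      rw [projIcc_of_mem zero_le_one ht']
      refine (hh' _).trans ((mul_le_mul_of_nonneg_left (ih ⟨t, ht'⟩) hC).trans (le_of_eq ?_))
      simp only
      ring
    have h2 := intervalIntegral.norm_integral_le_of_norm_le (μ := MeasureTheory.volume) hθ
      (f := fun t => h' (projIcc 0 1 zero_le_one t))
      (g := fun t => C * (C ^ k / k.factorial * ‖h‖) * t ^ k)
      (Filter.Eventually.of_forall fun t ht => h1 t ⟨ht.1.le, ht.2⟩)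
      ((by fun_prop : Continuous fun t : ℝ =>
        C * (C ^ k / k.factorial * ‖h‖) * t ^ k).intervalIntegrable _ _)
    refine h2.trans (le_of_eq ?_)
    rw [intervalIntegral.integral_const_mul, integral_pow, Nat.factorial_succ]
    have : (k.factorial : ℝ) ≠ 0 := by positivity
    have : ((k : ℝ) + 1) ≠ 0 := by positivity
    push_cast
    field_simp
    ring

/-- Some power of a Volterra operator is a contraction, since the norm of the `k`-th power is at most
`C ^ k / k!`; and `1 - V` is a factor of the invertible `1 - V ^ k`. -/
lemma isUnit_one_sub_volterra [CompleteSpace E] (V : C(UI, E) →L[ℝ] C(UI, E)) {C : ℝ} (hC : 0 ≤ C)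
    (hV : ∀ h : C(UI, E), ∃ h' : C(UI, E), V h = primitive E h' ∧ ∀ θ, ‖h' θ‖ ≤ C * ‖h θ‖) :
    IsUnit (1 - V) := by
  obtain ⟨k, hk⟩ : ∃ k : ℕ, C ^ k / k.factorial < 1 :=
    ((FloorSemiring.tendsto_pow_div_factorial_atTop C).eventually (gt_mem_nhds one_pos)).exists
  have hn : ‖V ^ k‖ < 1 := by
    refine (ContinuousLinearMap.opNorm_le_bound _ (by positivity) fun h => ?_).trans_lt hk
    rw [ContinuousMap.norm_le _ (by positivity)]
    intro θ
    refine (norm_primitive_pow_le V hC hV k h θ).trans ?_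
    have : (θ : ℝ) ^ k ≤ 1 := pow_le_one₀ θ.2.1 θ.2.2
    gcongr
    exact mul_le_of_le_one_right (by positivity) this
  have hu : IsUnit (1 - V ^ k) :=
    isUnit_one_sub_of_norm_lt_one (R := C(UI, E) →L[ℝ] C(UI, E)) hn
  have e : (1 - V) * (∑ i ∈ Finset.range k, V ^ i) = 1 - V ^ k := mul_neg_geom_sum V k
  have hc : Commute (1 - V) (∑ i ∈ Finset.range k, V ^ i) :=
    Commute.sum_right _ _ _ fun i _ =>
      (Commute.one_left _).sub_left ((Commute.refl V).pow_right i)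
  rw [← e] at hu
  exact (hc.isUnit_mul_iff.1 hu).1

end Volterra

/-! ### Orbits of a vector field in an open set -/

section Orbits

variable {E : Type*} [NormedAddCommGroup E] [NormedSpace ℝ E]

/-- `Reaches X U P s Q`: an integral curve of `X` inside `U`, defined on an open interval, leads
from `P` to `Q` in the (possibly negative) time `s`. -/
def Reaches (X : E → E) (U : Set E) (P : E) (s : ℝ) (Q : E) : Prop :=
  ∃ (γ : ℝ → E) (a b : ℝ), (0 : ℝ) ∈ Ioo a b ∧ s ∈ Ioo a b ∧ γ 0 = P ∧ γ s = Q ∧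
    ∀ τ ∈ Ioo a b, γ τ ∈ U ∧ HasDerivAt γ (X (γ τ)) τ

lemma ContDiffOn.exists_lipschitzOnWith_of_isCompact {X : E → E} {U K : Set E}
    (hU : IsOpen U) (hX : ContDiffOn ℝ 1 X U) (hK : IsCompact K) (hKU : K ⊆ U) :
    ∃ C, LipschitzOnWith C X K := by
  have : LocallyLipschitzOn K X := by
    intro x hx
    obtain ⟨C, t, ht, hC⟩ := (hX.contDiffAt (hU.mem_nhds (hKU hx))).exists_lipschitzOnWith
    exact ⟨C, t, mem_nhdsWithin_of_mem_nhds ht, hC⟩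
  exact this.exists_lipschitzOnWith_of_compact hK

lemma eqOn_Ioo_of_integralCurves {X : E → E} {U : Set E} (hU : IsOpen U) (hX : ContDiffOn ℝ 1 X U)
    {γ₁ γ₂ : ℝ → E} {a b c : ℝ} (hc : c ∈ Ioo a b) (h0 : γ₁ c = γ₂ c)
    (h₁ : ∀ τ ∈ Ioo a b, γ₁ τ ∈ U ∧ HasDerivAt γ₁ (X (γ₁ τ)) τ)
    (h₂ : ∀ τ ∈ Ioo a b, γ₂ τ ∈ U ∧ HasDerivAt γ₂ (X (γ₂ τ)) τ) :
    EqOn γ₁ γ₂ (Ioo a b) := by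
  intro t ht
  obtain ⟨a', ha', ha''⟩ := exists_between (lt_min hc.1 ht.1)
  obtain ⟨b', hb', hb''⟩ := exists_between (max_lt hc.2 ht.2)
  have hsub : Icc a' b' ⊆ Ioo a b := fun x hx => ⟨ha'.trans_le hx.1, hx.2.trans_lt hb''⟩
  have hsub' : Ioo a' b' ⊆ Ioo a b := fun x hx => hsub (Ioo_subset_Icc_self hx)
  have hcc : ∀ γ : ℝ → E, (∀ τ ∈ Ioo a b, γ τ ∈ U ∧ HasDerivAt γ (X (γ τ)) τ) →
      ContinuousOn γ (Icc a' b') := fun γ h τ hτ =>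
    (h τ (hsub hτ)).2.continuousAt.continuousWithinAt
  obtain ⟨C, hC⟩ := ContDiffOn.exists_lipschitzOnWith_of_isCompact hU hX
    (K := γ₁ '' Icc a' b' ∪ γ₂ '' Icc a' b')
    ((isCompact_Icc.image_of_continuousOn (hcc _ h₁)).union
      (isCompact_Icc.image_of_continuousOn (hcc _ h₂))) (by
    rintro _ (⟨τ, hτ, rfl⟩ | ⟨τ, hτ, rfl⟩)
    · exact (h₁ τ (hsub hτ)).1
    · exact (h₂ τ (hsub hτ)).1)
  exact ODE_solution_unique_of_mem_Ioo (v := fun _ => X) (K := C)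
    (s := fun _ => γ₁ '' Icc a' b' ∪ γ₂ '' Icc a' b') (fun _ _ => hC)
    ⟨ha''.trans_le (min_le_left _ _), (le_max_left _ _).trans_lt hb'⟩
    (fun τ hτ => ⟨(h₁ τ (hsub' hτ)).2, Or.inl ⟨τ, Ioo_subset_Icc_self hτ, rfl⟩⟩)
    (fun τ hτ => ⟨(h₂ τ (hsub' hτ)).2, Or.inr ⟨τ, Ioo_subset_Icc_self hτ, rfl⟩⟩) h0
    ⟨ha''.trans_le (min_le_right _ _), (le_max_right _ _).trans_lt hb'⟩

namespace Reaches

variable {X : E → E} {U : Set E} {P Q R : E} {s r : ℝ}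

lemma left_mem (h : Reaches X U P s Q) : P ∈ U := by
  obtain ⟨γ, a, b, h0, hs, rfl, rfl, h⟩ := h
  exact (h 0 h0).1

lemma right_mem (h : Reaches X U P s Q) : Q ∈ U := by
  obtain ⟨γ, a, b, h0, hs, rfl, rfl, h⟩ := h
  exact (h s hs).1

lemma symm (h : Reaches X U P s Q) : Reaches X U Q (-s) P := by
  obtain ⟨γ, a, b, h0, hs, rfl, rfl, h⟩ := h
  refine ⟨fun τ => γ (τ + s), a - s, b - s, ⟨by linarith [hs.1], by linarith [hs.2]⟩,
    ⟨by linarith [h0.1], by linarith [h0.2]⟩, by simp, by simp, fun τ hτ => ?_⟩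
  have := h (τ + s) ⟨by linarith [hτ.1], by linarith [hτ.2]⟩
  exact ⟨this.1, this.2.comp_add_const τ s⟩

lemma unique (hU : IsOpen U) (hX : ContDiffOn ℝ 1 X U) (h : Reaches X U P s Q)
    (h' : Reaches X U P s R) : Q = R := by
  obtain ⟨γ, a, b, h0, hs, rfl, rfl, h⟩ := h
  obtain ⟨γ', a', b', h0', hs', e, rfl, h'⟩ := h'
  refine eqOn_Ioo_of_integralCurves hU hX (a := max a a') (b := min b b') (c := 0)
    ⟨max_lt h0.1 h0'.1, lt_min h0.2 h0'.2⟩ e.symm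
    (fun τ hτ => h τ ⟨(le_max_left _ _).trans_lt hτ.1, hτ.2.trans_le (min_le_left _ _)⟩)
    (fun τ hτ => h' τ ⟨(le_max_right _ _).trans_lt hτ.1, hτ.2.trans_le (min_le_right _ _)⟩)
    ⟨max_lt hs.1 hs'.1, lt_min hs.2 hs'.2⟩

lemma trans (hU : IsOpen U) (hX : ContDiffOn ℝ 1 X U) (h : Reaches X U P s Q)
    (h' : Reaches X U Q r R) : Reaches X U P (s + r) R := by
  classical
  obtain ⟨γ, a, b, h0, hs, rfl, rfl, h⟩ := h
  obtain ⟨γ', a', b', h0', hr, e, rfl, h'⟩ := h'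
  -- the second curve, shifted so that it passes through the joint at time `s`
  have h'' : ∀ τ ∈ Ioo (a' + s) (b' + s), γ' (τ - s) ∈ U ∧
      HasDerivAt (fun τ => γ' (τ - s)) (X (γ' (τ - s))) τ := fun τ hτ => by
    have := h' (τ - s) ⟨by linarith [hτ.1], by linarith [hτ.2]⟩
    exact ⟨this.1, this.2.comp_sub_const τ s⟩
  have heq : EqOn γ (fun τ => γ' (τ - s)) (Ioo (max a (a' + s)) (min b (b' + s))) :=
    eqOn_Ioo_of_integralCurves hU hX (c := s)
      ⟨max_lt hs.1 (by linarith [h0'.1]), lt_min hs.2 (by linarith [h0'.2])⟩ (by simp [e])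
      (fun τ hτ => h τ ⟨(le_max_left _ _).trans_lt hτ.1, hτ.2.trans_le (min_le_left _ _)⟩)
      (fun τ hτ => h'' τ ⟨(le_max_right _ _).trans_lt hτ.1, hτ.2.trans_le (min_le_right _ _)⟩)
  let η : ℝ → E := fun τ => if τ ∈ Ioo a b then γ τ else γ' (τ - s)
  have e₁ : EqOn η γ (Ioo a b) := fun τ hτ => if_pos hτ
  have e₂ : EqOn η (fun τ => γ' (τ - s)) (Ioo (a' + s) (b' + s)) := fun τ hτ => by
    by_cases hτ' : τ ∈ Ioo a b
    · rw [e₁ hτ']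
      exact heq ⟨max_lt hτ'.1 hτ.1, lt_min hτ'.2 hτ.2⟩
    · exact if_neg hτ'
  refine ⟨η, min a (a' + s), max b (b' + s),
    ⟨(min_le_left _ _).trans_lt h0.1, h0.2.trans_le (le_max_left _ _)⟩,
    ⟨(min_le_right _ _).trans_lt (by linarith [hr.1]),
      lt_of_lt_of_le (by linarith [hr.2]) (le_max_right _ _)⟩, e₁ h0, ?_, fun τ hτ => ?_⟩
  · rw [e₂ ⟨by linarith [hr.1], by linarith [hr.2]⟩]
    simp
  · have hcase : τ ∈ Ioo a b ∨ τ ∈ Ioo (a' + s) (b' + s) := by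
      by_contra hcon
      simp only [mem_Ioo, not_or, not_and_or, not_lt] at hcon hτ hs h0'
      rcases hcon with ⟨h1 | h1, h2 | h2⟩
      · rcases min_lt_iff.1 hτ.1 with h3 | h3 <;> linarith
      · linarith
      · linarith
      · rcases lt_max_iff.1 hτ.2 with h3 | h3 <;> linarith
    rcases hcase with hτ | hτ
    · rw [e₁ hτ]
      exact ⟨(h τ hτ).1, (h τ hτ).2.congr_of_eventuallyEq
        (e₁.eventuallyEq_of_mem (Ioo_mem_nhds hτ.1 hτ.2))⟩
    · rw [e₂ hτ]
      exact ⟨(h'' τ hτ).1, (h'' τ hτ).2.congr_of_eventuallyEq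
        (e₂.eventuallyEq_of_mem (Ioo_mem_nhds hτ.1 hτ.2))⟩

lemma neg_field_iff : Reaches (-X) U P s Q ↔ Reaches X U P (-s) Q := by
  have key : ∀ (Y : E → E) (s : ℝ), Reaches Y U P s Q → Reaches (-Y) U P (-s) Q := by
    rintro Y s ⟨γ, a, b, h0, hs, rfl, rfl, h⟩
    refine ⟨fun τ => γ (-τ), -b, -a, ⟨by linarith [h0.2], by linarith [h0.1]⟩,
      ⟨by linarith [hs.2], by linarith [hs.1]⟩, by simp, by simp, fun τ hτ => ?_⟩
    have := h (-τ) ⟨by linarith [hτ.2], by linarith [hτ.1]⟩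
    refine ⟨this.1, ?_⟩
    simpa [Function.comp_def] using HasDerivAt.scomp τ this.2 (hasDerivAt_neg τ)
  exact ⟨fun h => by simpa using key _ _ h, fun h => by simpa using key _ _ h⟩

lemma exists_curve [CompleteSpace E] (hU : IsOpen U) (hX : ContDiffOn ℝ 1 X U) (hP : P ∈ U) :
    ∃ γ : ℝ → E, ∃ ε > 0, γ 0 = P ∧ ∀ τ ∈ Ioo (-ε) ε, γ τ ∈ U ∧ HasDerivAt γ (X (γ τ)) τ := by
  obtain ⟨γ, h0, ε, hε, h⟩ :=
    (hX.contDiffAt (hU.mem_nhds hP)).exists_forall_mem_closedBall_exists_eq_forall_mem_Ioo_hasDerivAt₀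
      0
  simp only [zero_sub, zero_add] at h
  have hc : ContinuousAt γ 0 := (h 0 ⟨by linarith, hε⟩).continuousAt
  obtain ⟨η, hη, hη'⟩ := Metric.eventually_nhds_iff.1
    (hc.eventually (hU.mem_nhds (show γ 0 ∈ U by rwa [h0])))
  refine ⟨γ, min ε η, lt_min hε hη, h0, fun τ hτ => ⟨hη' ?_, h τ ?_⟩⟩
  · rw [Real.dist_eq, sub_zero, abs_lt]
    exact ⟨by linarith [hτ.1, min_le_right ε η], by linarith [hτ.2, min_le_right ε η]⟩
  · exact ⟨by linarith [hτ.1, min_le_left ε η], by linarith [hτ.2, min_le_left ε η]⟩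

lemma of_curve {γ : ℝ → E} {ε : ℝ}
    (h : ∀ τ ∈ Ioo (-ε) ε, γ τ ∈ U ∧ HasDerivAt γ (X (γ τ)) τ) (hs : s ∈ Ioo (-ε) ε) :
    Reaches X U (γ 0) s (γ s) := by
  have : 0 < ε := by linarith [hs.1, hs.2]
  exact ⟨γ, -ε, ε, ⟨by linarith, this⟩, hs, rfl, rfl, h⟩

lemma zero [CompleteSpace E] (hU : IsOpen U) (hX : ContDiffOn ℝ 1 X U) (hP : P ∈ U) :
    Reaches X U P 0 P := by
  obtain ⟨γ, ε, hε, rfl, h⟩ := exists_curve hU hX hP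
  exact of_curve h ⟨by linarith, hε⟩

/-- An integral curve on `[0, s]`, with derivatives known in the open interval only, extends to an
open interval if its end points belong to `U`. -/
lemma of_Icc [CompleteSpace E] (hU : IsOpen U) (hX : ContDiffOn ℝ 1 X U) {γ : ℝ → E} (hs : 0 < s)
    (hc : ContinuousOn γ (Icc 0 s)) (h0 : γ 0 ∈ U) (h1 : γ s ∈ U)
    (h : ∀ τ ∈ Ioo 0 s, γ τ ∈ U ∧ HasDerivAt γ (X (γ τ)) τ) : Reaches X U (γ 0) s (γ s) := by
  obtain ⟨α, ε, hε, hα0, hα⟩ := exists_curve hU hX h0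
  obtain ⟨β, η, hη, hβ0, hβ⟩ := exists_curve hU hX h1
  have hXc := hX.continuousOn
  have hd : ∀ τ ∈ Ioo 0 s, deriv γ τ = X (γ τ) := fun τ hτ => (h τ hτ).2.deriv
  have hdiff : DifferentiableOn ℝ γ (Ioo 0 s) := fun τ hτ =>
    (h τ hτ).2.differentiableAt.differentiableWithinAt
  have hc0 : Tendsto γ (𝓝[>] 0) (𝓝 (γ 0)) :=
    ((hc 0 ⟨le_rfl, hs.le⟩).mono_of_mem_nhdsWithin
      (mem_of_superset (Ioo_mem_nhdsGT hs) Ioo_subset_Icc_self))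
  have hc1 : Tendsto γ (𝓝[<] s) (𝓝 (γ s)) :=
    ((hc s ⟨hs.le, le_rfl⟩).mono_of_mem_nhdsWithin
      (mem_of_superset (Ioo_mem_nhdsLT hs) Ioo_subset_Icc_self))
  have r0 : HasDerivWithinAt γ (X (γ 0)) (Ici 0) 0 := by
    refine hasDerivWithinAt_Ici_of_tendsto_deriv hdiff
      ((hc 0 ⟨le_rfl, hs.le⟩).mono Ioo_subset_Icc_self) (Ioo_mem_nhdsGT hs) ?_
    refine Tendsto.congr' (f₁ := fun τ => X (γ τ)) ?_
      ((hXc.continuousAt (hU.mem_nhds h0)).tendsto.comp hc0)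
    filter_upwards [Ioo_mem_nhdsGT hs] with τ hτ using (hd τ hτ).symm
  have r1 : HasDerivWithinAt γ (X (γ s)) (Iic s) s := by
    refine hasDerivWithinAt_Iic_of_tendsto_deriv hdiff
      ((hc s ⟨hs.le, le_rfl⟩).mono Ioo_subset_Icc_self) (Ioo_mem_nhdsLT hs) ?_
    refine Tendsto.congr' (f₁ := fun τ => X (γ τ)) ?_
      ((hXc.continuousAt (hU.mem_nhds h1)).tendsto.comp hc1)
    filter_upwards [Ioo_mem_nhdsLT hs] with τ hτ using (hd τ hτ).symm
  let ζ : ℝ → E := fun τ => if τ ≤ 0 then α τ else if τ ≤ s then γ τ else β (τ - s)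
  have z0 : ∀ τ ≤ 0, ζ τ = α τ := fun τ hτ => if_pos hτ
  have z1 : ∀ τ ∈ Icc 0 s, ζ τ = γ τ := fun τ hτ => by
    rcases hτ.1.eq_or_lt with rfl | h'
    · rw [z0 _ le_rfl, hα0]
    · simp [ζ, not_le.2 h', hτ.2]
  have z2 : ∀ τ ≥ s, ζ τ = β (τ - s) := fun τ hτ => by
    rcases (show s ≤ τ from hτ).eq_or_lt with rfl | h'
    · rw [z1 _ ⟨hs.le, le_rfl⟩, sub_self, hβ0]
    · simp [ζ, not_le.2 h', not_le.2 (hs.trans h')]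
  refine ⟨ζ, -ε, s + η, ⟨by linarith, by linarith⟩, ⟨by linarith, by linarith⟩,
    z1 _ ⟨le_rfl, hs.le⟩, z1 _ ⟨hs.le, le_rfl⟩, fun τ hτ => ?_⟩
  have hβ' : ∀ τ ∈ Ioo (s - η) (s + η), β (τ - s) ∈ U ∧
      HasDerivAt (fun τ => β (τ - s)) (X (β (τ - s))) τ := fun τ hτ => by
    have := hβ (τ - s) ⟨by linarith [hτ.1], by linarith [hτ.2]⟩
    exact ⟨this.1, this.2.comp_sub_const τ s⟩
  rcases lt_trichotomy τ 0 with h' | rfl | h'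
  · rw [z0 _ h'.le]
    have := hα τ ⟨hτ.1, h'.trans hε⟩
    refine ⟨this.1, this.2.congr_of_eventuallyEq ?_⟩
    filter_upwards [Iio_mem_nhds h'] with x hx using z0 x (le_of_lt hx)
  · rw [z1 _ ⟨le_rfl, hs.le⟩]
    refine ⟨h0, ?_⟩
    have e1 : HasDerivWithinAt ζ (X (γ 0)) (Iic 0) 0 := by
      have := (hα 0 ⟨by linarith, hε⟩).2.hasDerivWithinAt (s := Iic 0)
      rw [hα0] at this
      exact this.congr (fun x hx => z0 x hx) (z0 0 le_rfl)
    have e2 : HasDerivWithinAt ζ (X (γ 0)) (Ici 0) 0 := by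
      refine r0.congr_of_eventuallyEq ?_ (z1 0 ⟨le_rfl, hs.le⟩)
      filter_upwards [Icc_mem_nhdsGE hs] with x hx using z1 x hx
    simpa using e1.union e2
  · rcases lt_trichotomy τ s with h'' | rfl | h''
    · rw [z1 _ ⟨h'.le, h''.le⟩]
      refine ⟨(h τ ⟨h', h''⟩).1, (h τ ⟨h', h''⟩).2.congr_of_eventuallyEq ?_⟩
      filter_upwards [Ioo_mem_nhds h' h''] with x hx using z1 x (Ioo_subset_Icc_self hx)
    · rw [z1 _ ⟨hs.le, le_rfl⟩]
      refine ⟨h1, ?_⟩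
      have e1 : HasDerivWithinAt ζ (X (γ τ)) (Ici τ) τ := by
        have := (hβ' τ ⟨by linarith, by linarith⟩).2.hasDerivWithinAt (s := Ici τ)
        rw [sub_self, hβ0] at this
        exact this.congr (fun x hx => z2 x hx) (z2 τ le_rfl)
      have e2 : HasDerivWithinAt ζ (X (γ τ)) (Iic τ) τ := by
        refine r1.congr_of_eventuallyEq ?_ (z1 τ ⟨hs.le, le_rfl⟩)
        filter_upwards [Icc_mem_nhdsLE hs] with x hx using z1 x hx
      simpa using e2.union e1
    · rw [z2 _ h''.le]
      have := hβ' τ ⟨by linarith, hτ.2⟩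
      refine ⟨this.1, this.2.congr_of_eventuallyEq ?_⟩
      filter_upwards [Ioi_mem_nhds h''] with x hx using z2 x (le_of_lt hx)

end Reaches

/-- A vector field that is smooth on an open set agrees near a compact subset with a globally
smooth one. -/
lemma exists_contDiff_eqOn_nhds_compact [FiniteDimensional ℝ E] {X : E → E} {U K : Set E}
    (hU : IsOpen U) (hX : ContDiffOn ℝ ∞ X U) (hK : IsCompact K) (hKU : K ⊆ U) :
    ∃ Y : E → E, ContDiff ℝ ∞ Y ∧ ∃ V, IsOpen V ∧ K ⊆ V ∧ V ⊆ U ∧ EqOn Y X V := by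
  obtain ⟨L, hL, hKL, hLU⟩ := exists_compact_between hK hU hKU
  obtain ⟨f, hf1, hf0, -⟩ := exists_contMDiffMap_one_nhds_of_subset_interior
    (modelWithCornersSelf ℝ E) (n := (⊤ : ℕ∞)) hK.isClosed hKL
  have hf : ContDiff ℝ ∞ f := f.contMDiff.contDiff
  obtain ⟨V, hKV, hV⟩ := mem_nhdsSet_iff_exists.1 hf1
  refine ⟨fun x => f x • X x, ?_, V ∩ U, ?_, ?_, inter_subset_right, ?_⟩
  · rw [contDiff_iff_contDiffAt]
    intro x
    by_cases hx : x ∈ U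
    · exact hf.contDiffAt.smul (hX.contDiffAt (hU.mem_nhds hx))
    · have : (fun x => f x • X x) =ᶠ[𝓝 x] fun _ => 0 := by
        filter_upwards [hL.isClosed.isOpen_compl.mem_nhds (fun h => hx (hLU h))] with y hy
        rw [hf0 y hy, zero_smul]
      exact contDiffAt_const.congr_of_eventuallyEq this
  · exact hKV.inter hU
  · exact subset_inter hV.1 hKU
  · intro x hx
    have : f x = 1 := hV.2 hx.1
    simp [this]

end Orbits

/-! ### Smooth dependence of orbits on the starting point and the time -/

section SmoothFlow

variable {E : Type*} [NormedAddCommGroup E] [NormedSpace ℝ E]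

/-- The integral equation of an orbit of duration `r > 0`, parametrized by the unit interval. -/
lemma Reaches.of_integral_eq [CompleteSpace E] {X : E → E} {U : Set E} (hU : IsOpen U)
    (hX : ContDiffOn ℝ 1 X U) {c : C(UI, E)} (hc : ∀ θ, c θ ∈ U) {P : E} {r : ℝ} (hr : 0 < r)
    (h : ∀ θ : UI, c θ = P + r • ∫ t in (0 : ℝ)..θ, X (c (projIcc 0 1 zero_le_one t))) :
    Reaches X U P r (c 1) := by
  have hcont : Continuous fun t : ℝ => X (c (projIcc 0 1 zero_le_one t)) := by
    rw [continuous_iff_continuousAt]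
    intro t
    exact ContinuousAt.comp (g := X) (hX.continuousOn.continuousAt (hU.mem_nhds (hc _)))
      (c.continuous.comp continuous_projIcc).continuousAt
  let γ : ℝ → E := fun τ => c (projIcc 0 1 zero_le_one (r⁻¹ * τ))
  have hγc : Continuous γ := c.continuous.comp (continuous_projIcc.comp (by fun_prop))
  have hmem : ∀ τ ∈ Icc 0 r, r⁻¹ * τ ∈ Icc (0 : ℝ) 1 := fun τ hτ =>
    ⟨by have := hτ.1; positivity, by rw [inv_mul_le_iff₀ hr]; simpa using hτ.2⟩
  have e : ∀ τ ∈ Icc 0 r,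
      γ τ = P + r • ∫ t in (0 : ℝ)..(r⁻¹ * τ), X (c (projIcc 0 1 zero_le_one t)) := fun τ hτ => by
    simp only [γ]
    rw [h, projIcc_of_mem _ (hmem τ hτ)]
  have e0 : γ 0 = P := by rw [e 0 ⟨le_rfl, hr.le⟩]; simp
  have e1 : γ r = c 1 := by
    simp only [γ]
    rw [inv_mul_cancel₀ hr.ne', projIcc_right]
    rfl
  rw [← e0, ← e1]
  refine Reaches.of_Icc hU hX hr hγc.continuousOn (hc _) (hc _) fun τ hτ => ⟨hc _, ?_⟩
  have hd : HasDerivAt (fun τ : ℝ => P + r • ∫ t in (0 : ℝ)..(r⁻¹ * τ),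
      X (c (projIcc 0 1 zero_le_one t))) (r • (r⁻¹ • X (γ τ))) τ := by
    have h1 := (intervalIntegral.integral_hasDerivAt_right (hcont.intervalIntegrable 0 (r⁻¹ * τ))
      (hcont.stronglyMeasurableAtFilter _ _) hcont.continuousAt)
    have h2 : HasDerivAt (fun τ : ℝ => r⁻¹ * τ) r⁻¹ τ := by
      simpa using (hasDerivAt_id τ).const_mul r⁻¹
    exact ((HasDerivAt.scomp τ h1 h2).const_smul r).const_add P
  rw [smul_smul, mul_inv_cancel₀ hr.ne', one_smul] at hd
  refine hd.congr_of_eventuallyEq ?_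
  filter_upwards [Ioo_mem_nhds hτ.1 hτ.2] with x hx using e x (Ioo_subset_Icc_self hx)

/-- Constant maps, as a bounded operator. -/
noncomputable def constantMap (E : Type*) [NormedAddCommGroup E] [NormedSpace ℝ E] :
    E →L[ℝ] C(UI, E) :=
  LinearMap.mkContinuous
    { toFun := fun x => ContinuousMap.const UI x
      map_add' := fun _ _ => rfl
      map_smul' := fun _ _ => rfl } 1
    (fun x => by
      rw [one_mul, ContinuousMap.norm_le _ (norm_nonneg _)]
      exact fun _ => le_rfl)

@[simp] lemma constantMap_apply (x : E) (θ : UI) : constantMap E x θ = x := rfl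

/-- The time-`s` flow map of a smooth vector field is smooth in the starting point and in `s`, near
any orbit that stays in the domain `U`. The whole orbit, parametrized by the unit interval, solves
an integral equation in the Banach space of continuous maps whose linearization is the identity
minus a Volterra operator, so that the implicit function theorem applies. -/
theorem Reaches.exists_smooth_flow [FiniteDimensional ℝ E] {X : E → E} {U : Set E} (hU : IsOpen U)
    (hX : ContDiffOn ℝ ∞ X U) {P Q : E} {s : ℝ} (h : Reaches X U P s Q) :
    ∃ Φ : E × ℝ → E, ContDiffAt ℝ ∞ Φ (P, s) ∧ ∀ᶠ p in 𝓝 (P, s), Reaches X U p.1 p.2 (Φ p) := by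
  have : CompleteSpace E := FiniteDimensional.complete ℝ E
  have hX1 : ContDiffOn ℝ 1 X U := hX.of_le (by exact_mod_cast le_top)
  obtain ⟨γ, a, b, h0, hs, rfl, rfl, h⟩ := h
  have hseg : ∀ θ ∈ Icc (0 : ℝ) 1, s * θ ∈ Ioo a b := fun θ hθ => by
    constructor
    · rcases le_total 0 s with h' | h'
      · nlinarith [h0.1, mul_nonneg h' hθ.1]
      · nlinarith [hs.1, mul_nonneg (neg_nonneg.2 h') (sub_nonneg.2 hθ.2)]
    · rcases le_total 0 s with h' | h'
      · nlinarith [hs.2, mul_nonneg h' (sub_nonneg.2 hθ.2)]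
      · nlinarith [h0.2, mul_nonneg (neg_nonneg.2 h') hθ.1]
  let c₀ : C(UI, E) := ⟨fun θ => γ (s * θ), by
    rw [continuous_iff_continuousAt]
    intro θ
    exact ContinuousAt.comp (g := γ) (h _ (hseg θ θ.2)).2.continuousAt (by fun_prop)⟩
  obtain ⟨Y, hY, V, hV, hKV, hVU, hYX⟩ := exists_contDiff_eqOn_nhds_compact hU hX
    (isCompact_range c₀.continuous) (by rintro _ ⟨θ, rfl⟩; exact (h _ (hseg θ θ.2)).1)
  let Y' : C(E, E) := ⟨Y, hY.continuous⟩
  let N : C(UI, E) → C(UI, E) := compositionOperator UI Y'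
  have hN : ContDiff ℝ ∞ N := contDiff_compositionOperator hY
  let F : (E × ℝ) × C(UI, E) → C(UI, E) := fun q =>
    q.2 - constantMap E q.1.1 - q.1.2 • primitive E (N q.2)
  have hF : ContDiff ℝ ∞ F := by
    refine (contDiff_snd.sub ((constantMap E).contDiff.comp (contDiff_fst.comp contDiff_fst))).sub
      ((contDiff_snd.comp contDiff_fst).smul ((primitive E).contDiff.comp (hN.comp contDiff_snd)))
  let u : (E × ℝ) × C(UI, E) := ((γ 0, s), c₀)
  have hFu : F u = 0 := by
    ext θ
    simp only [F, u, ContinuousMap.sub_apply, ContinuousMap.smul_apply, ContinuousMap.zero_apply,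
      constantMap_apply, primitive_apply]
    have hθ := θ.2
    have hcongr : ∫ t in (0 : ℝ)..θ, N c₀ (projIcc 0 1 zero_le_one t)
        = ∫ t in (0 : ℝ)..θ, X (γ (s * t)) := by
      refine intervalIntegral.integral_congr fun t ht => ?_
      rw [uIcc_of_le hθ.1] at ht
      have ht' : t ∈ Icc (0 : ℝ) 1 := ⟨ht.1, ht.2.trans hθ.2⟩
      simp only [projIcc_of_mem zero_le_one ht']
      exact hYX (hKV (mem_range_self (⟨t, ht'⟩ : UI)))
    have hsub : ∀ t ∈ uIcc (0 : ℝ) θ, s * t ∈ Ioo a b := fun t ht => by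
      rw [uIcc_of_le hθ.1] at ht
      exact hseg t ⟨ht.1, ht.2.trans hθ.2⟩
    have hderiv : ∀ t ∈ uIcc (0 : ℝ) θ,
        HasDerivAt (fun t => γ (s * t)) (s • X (γ (s * t))) t := fun t ht => by
      have h2 : HasDerivAt (fun t : ℝ => s * t) s t := by
        simpa using (hasDerivAt_id t).const_mul s
      exact HasDerivAt.scomp t (h _ (hsub t ht)).2 h2
    have hint : ContinuousOn (fun t => s • X (γ (s * t))) (uIcc (0 : ℝ) θ) := fun t ht =>
      (ContinuousAt.const_smul (ContinuousAt.comp (g := X) (f := fun t => γ (s * t))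
        (hX.continuousOn.continuousAt (hU.mem_nhds (h _ (hsub t ht)).1))
        (hderiv t ht).continuousAt) s).continuousWithinAt
    have := intervalIntegral.integral_eq_sub_of_hasDerivAt hderiv hint.intervalIntegrable
    rw [intervalIntegral.integral_smul] at this
    rw [hcongr, this]
    simp [c₀]
  let Y1 : C(E, E →L[ℝ] E) := ⟨fderiv ℝ Y, (hY.fderiv_right (m := ∞) (by simp)).continuous⟩
  let B : C(UI, E) →L[ℝ] C(UI, E) := pointwiseApply UI E E (compositionOperator UI Y1 c₀)
  let W : C(UI, E) →L[ℝ] C(UI, E) := s • (primitive E ∘L B)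
  have hpart : fderiv ℝ F u ∘L .inr ℝ (E × ℝ) C(UI, E) = 1 - W := by
    have h1 : HasFDerivAt (fun c : C(UI, E) => F ((γ 0, s), c))
        (fderiv ℝ F u ∘L .inr ℝ (E × ℝ) C(UI, E)) c₀ :=
      HasFDerivAt.comp c₀ ((hF.differentiable (by simp)) u).hasFDerivAt
        (hasFDerivAt_prodMk_right (γ 0, s) c₀)
    have h2 : HasFDerivAt (fun c : C(UI, E) => F ((γ 0, s), c)) (1 - W) c₀ := by
      have hNd : HasFDerivAt N B c₀ := hasFDerivAt_compositionOperator
        (fun x => (hY.differentiable (by simp)).differentiableAt.hasFDerivAt) c₀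
      exact ((hasFDerivAt_id c₀).sub_const (constantMap E (γ 0))).sub
        (((primitive E).hasFDerivAt.comp c₀ hNd).const_smul s)
    exact h1.unique h2
  have hunit : IsUnit (1 - W) := by
    refine isUnit_one_sub_volterra W (C := |s| * ‖compositionOperator UI Y1 c₀‖) (by positivity)
      fun f => ⟨s • B f, ?_, fun θ => ?_⟩
    · simp [W]
    · rw [ContinuousMap.smul_apply, norm_smul, Real.norm_eq_abs, mul_assoc]
      refine mul_le_mul_of_nonneg_left ?_ (abs_nonneg s)
      exact ((compositionOperator UI Y1 c₀ θ).le_opNorm _).trans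
        (mul_le_mul_of_nonneg_right (ContinuousMap.norm_coe_le_norm _ θ) (norm_nonneg _))
  have hinv : (fderiv ℝ F u ∘L .inr ℝ (E × ℝ) C(UI, E)).IsInvertible := by
    rw [hpart]
    obtain ⟨w, hw⟩ := hunit
    exact ⟨ContinuousLinearEquiv.unitsEquiv ℝ _ w, hw⟩
  have hFu' : ContDiffAt ℝ ∞ F u := hF.contDiffAt
  let ψ := hFu'.implicitFunction (by simp) hinv
  have hψ : ContDiffAt ℝ ∞ ψ (γ 0, s) := hFu'.contDiffAt_implicitFunction (by simp) hinv
  have hψ0 : ψ (γ 0, s) = c₀ := hFu'.implicitFunction_apply_self (by simp) hinv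
  have hev : ContDiff ℝ ∞ fun c : C(UI, E) => c 1 :=
    ContinuousLinearMap.contDiff (ContinuousMap.evalCLM ℝ (1 : UI) : C(UI, E) →L[ℝ] E)
  refine ⟨fun p => ψ p 1, hev.contDiffAt.comp _ hψ, ?_⟩
  have hopen : IsOpen {c : C(UI, E) | MapsTo c univ V} :=
    ContinuousMap.isOpen_setOfPred_mapsTo isCompact_univ hV
  filter_upwards [hFu'.eventually_apply_implicitFunction (by simp) hinv,
    hψ.continuousAt.eventually (hopen.mem_nhds (by
      rw [hψ0]; exact fun θ _ => hKV (mem_range_self θ)))] with p hp hpV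
  rw [hFu] at hp
  have hc : ∀ θ, ψ p θ ∈ V := fun θ => hpV (mem_univ θ)
  have heq : ∀ θ : UI, ψ p θ = p.1 +
      p.2 • ∫ t in (0 : ℝ)..θ, X (ψ p (projIcc 0 1 zero_le_one t)) := fun θ => by
    have := DFunLike.congr_fun hp θ
    simp only [F, ContinuousMap.sub_apply, ContinuousMap.smul_apply, ContinuousMap.zero_apply,
      constantMap_apply, primitive_apply] at this
    rw [sub_sub, sub_eq_zero] at this
    refine this.trans ?_
    congr 2
    exact intervalIntegral.integral_congr fun t _ => hYX (hc _)
  rcases lt_trichotomy p.2 0 with hneg | hz | hpos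
  · have := Reaches.of_integral_eq (X := -X) hU hX1.neg (c := ψ p) (fun θ => hVU (hc θ))
      (P := p.1) (neg_pos.2 hneg) (fun θ => by
        rw [heq θ]
        simp [intervalIntegral.integral_neg])
    simpa using Reaches.neg_field_iff.1 this
  · have e := heq 1
    rw [hz, zero_smul, add_zero] at e
    simp only [e, hz]
    exact Reaches.zero hU hX1 (e ▸ hVU (hc 1))
  · exact Reaches.of_integral_eq hU hX1 (fun θ => hVU (hc θ)) hpos heq

end SmoothFlow

/-! ### Flow boxes -/

section FlowBox

variable {E : Type*} [NormedAddCommGroup E] [NormedSpace ℝ E] [FiniteDimensional ℝ E]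
  {X : E → E} {U : Set E} {P Q : E} {s : ℝ}

lemma Reaches.exists_smooth_flow_hasDerivAt (hU : IsOpen U)
    (hX : ContDiffOn ℝ ∞ X U) (h : Reaches X U P s Q) :
    ∃ Φ : E × ℝ → E, ContDiffAt ℝ ∞ Φ (P, s) ∧ Φ (P, s) = Q ∧
      ∀ᶠ p in 𝓝 (P, s), Reaches X U p.1 p.2 (Φ p) ∧
        HasDerivAt (fun r => Φ (p.1, r)) (X (Φ p)) p.2 := by
  have : CompleteSpace E := FiniteDimensional.complete ℝ E
  have hX1 : ContDiffOn ℝ 1 X U := hX.of_le (by exact_mod_cast le_top)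
  obtain ⟨Φ, hΦ, hr⟩ := h.exists_smooth_flow hU hX
  refine ⟨Φ, hΦ, hr.self_of_nhds.unique hU hX1 h, ?_⟩
  filter_upwards [hr, eventually_eventually_nhds.2 hr] with p hp hp'
  refine ⟨hp, ?_⟩
  obtain ⟨γ, ε, hε, hγ0, hγ⟩ := Reaches.exists_curve hU hX1 hp.right_mem
  have hd : HasDerivAt (fun r => γ (r - p.2)) (X (Φ p)) p.2 := by
    have := (hγ 0 ⟨by linarith, hε⟩).2
    rw [hγ0] at this
    have h2 : HasDerivAt γ (X (Φ p)) (p.2 - p.2) := by rwa [sub_self]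
    exact h2.comp_sub_const p.2 p.2
  refine hd.congr_of_eventuallyEq ?_
  have hc : Tendsto (fun r : ℝ => (p.1, r)) (𝓝 p.2) (𝓝 p) :=
    (Continuous.prodMk_right p.1).tendsto p.2
  filter_upwards [hc.eventually hp', Ioo_mem_nhds (show p.2 - ε < p.2 by linarith)
    (show p.2 < p.2 + ε by linarith)] with r hr hrε
  have h1 := Reaches.of_curve hγ (s := r - p.2) ⟨by linarith [hrε.1], by linarith [hrε.2]⟩
  rw [hγ0] at h1
  have h2 := hp.trans hU hX1 h1
  rw [add_sub_cancel] at h2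
  exact Reaches.unique hU hX1 hr h2

/-- Flow box: if the differential of `f` does not vanish on `X` at a zero `P` of `f`, then the
points near `Q` have smooth coordinates `(π, τ)`: the point of `{f = 0}` on their orbit and the time
that passed since. -/
theorem Reaches.exists_flowBox (hU : IsOpen U)
    (hX : ContDiffOn ℝ ∞ X U) (h : Reaches X U P s Q) {f : E → ℝ} (hf : ContDiffAt ℝ ∞ f P)
    (hf0 : f P = 0) (hfX : fderiv ℝ f P (X P) ≠ 0) :
    ∃ (τ : E → ℝ) (π : E → E), ContDiffAt ℝ ∞ τ Q ∧ ContDiffAt ℝ ∞ π Q ∧ τ Q = s ∧ π Q = P ∧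
      (∀ᶠ Q' in 𝓝 Q, Reaches X U (π Q') (τ Q') Q' ∧ f (π Q') = 0) ∧
      (∀ᶠ p in 𝓝 (P, s), f p.1 = 0 → ∀ Q', Reaches X U p.1 p.2 Q' → τ Q' = p.2 ∧ π Q' = p.1) := by
  have : CompleteSpace E := FiniteDimensional.complete ℝ E
  have hX1 : ContDiffOn ℝ 1 X U := hX.of_le (by exact_mod_cast le_top)
  obtain ⟨Φ, hΦ, hΦ0, hΦr⟩ := h.exists_smooth_flow_hasDerivAt hU hX
  obtain ⟨Ψ', hΨ', hΨ0', hΨr'⟩ := h.symm.exists_smooth_flow_hasDerivAt hU hX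
  -- the backward flow
  let ν : E × ℝ → E × ℝ := fun q => (q.1, -q.2)
  have hν : ContDiff ℝ ∞ ν := contDiff_fst.prodMk contDiff_snd.neg
  let Ψ : E × ℝ → E := fun q => Ψ' (ν q)
  have hΨ : ContDiffAt ℝ ∞ Ψ (Q, s) := ContDiffAt.comp (Q, s) (g := Ψ') hΨ' hν.contDiffAt
  have hνt : Tendsto ν (𝓝 (Q, s)) (𝓝 (Q, -s)) := hν.continuous.tendsto (Q, s)
  have hΨ0 : Ψ (Q, s) = P := hΨ0'
  have hΨr : ∀ᶠ q in 𝓝 (Q, s), Reaches X U (Ψ q) q.2 q.1 := by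
    filter_upwards [hνt.eventually hΨr'] with q hq
    simpa [Ψ, ν] using hq.1.symm
  let G : E × ℝ → ℝ := fun q => f (Ψ q)
  have hG : ContDiffAt ℝ ∞ G (Q, s) :=
    ContDiffAt.comp (Q, s) (g := f) (by rw [hΨ0]; exact hf) hΨ
  have hG0 : G (Q, s) = 0 := by simp only [G, hΨ0, hf0]
  have hpart : (fderiv ℝ G (Q, s) ∘L .inr ℝ E ℝ) 1 = -fderiv ℝ f P (X P) := by
    have h1 : HasFDerivAt (fun r => G (Q, r)) (fderiv ℝ G (Q, s) ∘L .inr ℝ E ℝ) s :=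
      HasFDerivAt.comp s (hG.differentiableAt (by simp)).hasFDerivAt
        (hasFDerivAt_prodMk_right Q s)
    have h2 : HasDerivAt (fun r => Ψ (Q, r)) (-X P) s := by
      have hd := (hΨr'.self_of_nhds).2
      simp only [hΨ0'] at hd
      simpa [Function.comp_def, Ψ, ν] using HasDerivAt.scomp s hd (hasDerivAt_neg s)
    have h3 : HasFDerivAt f (fderiv ℝ f P) (Ψ (Q, s)) := by
      rw [hΨ0]; exact (hf.differentiableAt (by simp)).hasFDerivAt
    have h4 := h3.comp_hasDerivAt s h2
    have h5 := h1.hasDerivAt.unique h4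
    simpa using h5
  have hinv : (fderiv ℝ G (Q, s) ∘L .inr ℝ E ℝ).IsInvertible := by
    set c := -fderiv ℝ f P (X P) with hc
    have hc0 : c ≠ 0 := neg_ne_zero.2 hfX
    refine ⟨ContinuousLinearEquiv.unitsEquivAut ℝ (Units.mk0 c hc0), ?_⟩
    ext
    simp [hpart]
  let τ := hG.implicitFunction (by simp) hinv
  have hτ : ContDiffAt ℝ ∞ τ Q := hG.contDiffAt_implicitFunction (by simp) hinv
  have hτ0 : τ Q = s := hG.implicitFunction_apply_self (by simp) hinv
  have hpair : ContDiffAt ℝ ∞ (fun Q' => (Q', τ Q')) Q := contDiffAt_id.prodMk hτ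
  have hpt : Tendsto (fun Q' => (Q', τ Q')) (𝓝 Q) (𝓝 (Q, s)) := by
    have := hpair.continuousAt.tendsto
    rwa [hτ0] at this
  refine ⟨τ, fun Q' => Ψ (Q', τ Q'), hτ, ?_, hτ0, by simp only [hτ0, hΨ0], ?_, ?_⟩
  · exact ContDiffAt.comp Q (g := Ψ) (by rw [hτ0]; exact hΨ) hpair
  · filter_upwards [hpt.eventually hΨr, hG.eventually_apply_implicitFunction (by simp) hinv]
      with Q' h1 h2
    rw [hG0] at h2
    exact ⟨h1, h2⟩
  · have hΦt : Tendsto (fun p : E × ℝ => (Φ p, p.2)) (𝓝 (P, s)) (𝓝 (Q, s)) := by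
      have := hΦ.continuousAt.tendsto.prodMk_nhds (continuous_snd.tendsto (P, s))
      rwa [hΦ0] at this
    filter_upwards [hΦr, hΦt.eventually
      (hG.eventually_apply_eq_iff_implicitFunction (by simp) hinv), hΦt.eventually hΨr]
      with p h1 h2 h3 hp Q' hQ'
    have e : Φ p = Q' := h1.1.unique hU hX1 hQ'
    rw [e] at h2 h3
    have e' : Ψ (Q', p.2) = p.1 := h3.symm.unique hU hX1 hQ'.symm
    have : τ Q' = p.2 := h2.1 (by rw [hG0]; simp only [G, e', hp])
    exact ⟨this, by simp only [this, e']⟩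

end FlowBox

/-! ### The level set operator -/

section LevelSet

variable {E : Type*} [NormedAddCommGroup E] [InnerProductSpace ℝ E]

open scoped InnerProductSpace

/-- The trace of `H` over the hyperplane orthogonal to `p`. -/
noncomputable def tangentialTrace (p : E) (H : E →L[ℝ] E) : ℝ :=
  LinearMap.trace ℝ E (H : E →ₗ[ℝ] E) - ⟪p, H p⟫_ℝ / ‖p‖ ^ 2

/-- The level set operator of the law `V = -κ + A`: if `ψ` is positive inside the moving
hypersurface and vanishes on it, then `∂ₜψ = levelSetOp A (∇ψ) (D∇ψ)` there. -/
noncomputable def levelSetOp (A : ℝ) (p : E) (H : E →L[ℝ] E) : ℝ :=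
  tangentialTrace p H + A * ‖p‖

lemma tangentialTrace_sub (p : E) (H H' : E →L[ℝ] E) :
    tangentialTrace p (H - H') = tangentialTrace p H - tangentialTrace p H' := by
  simp only [tangentialTrace, ContinuousLinearMap.toLinearMap_sub, map_sub, sub_apply,
    inner_sub_right]
  ring

lemma ContDiffAt.eventually_differentiableAt {g : E → ℝ} {Q : E} (hg : ContDiffAt ℝ 2 g Q) :
    ∀ᶠ Q' in 𝓝 Q, DifferentiableAt ℝ g Q' := by
  filter_upwards [hg.eventually (by simp)] with Q' h using h.differentiableAt (by simp)

lemma contDiff_line (Q v : E) {k : WithTop ℕ∞} : ContDiff ℝ k fun r : ℝ => Q + r • v :=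
  contDiff_const.add (contDiff_id.smul contDiff_const)

lemma levelSetOp_smul {c : ℝ} (hc : 0 < c) (A : ℝ) (p : E) (H : E →L[ℝ] E) :
    levelSetOp A (c • p) (c • H) = c * levelSetOp A p H := by
  simp only [levelSetOp, tangentialTrace, ContinuousLinearMap.toLinearMap_smul, map_smul, smul_eq_mul,
    smul_apply, inner_smul_right, inner_smul_left, norm_smul, Real.norm_eq_abs,
    abs_of_pos hc, RCLike.conj_to_real]
  by_cases hn : ‖p‖ = 0
  · simp [hn]
  · field_simp

variable [FiniteDimensional ℝ E]

/-- The trace over `p^⊥` is read off in an orthonormal basis that contains `p / ‖p‖`. -/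
lemma tangentialTrace_nonneg {p : E} (hp : p ≠ 0) {D : E →L[ℝ] E}
    (hD : ∀ v, ⟪p, v⟫_ℝ = 0 → 0 ≤ ⟪v, D v⟫_ℝ) : 0 ≤ tangentialTrace p D := by
  classical
  have hn : ‖p‖ ≠ 0 := norm_ne_zero_iff.2 hp
  have : Nontrivial E := ⟨p, 0, hp⟩
  have hpos : 0 < Module.finrank ℝ E := Module.finrank_pos
  let i₀ : Fin (Module.finrank ℝ E) := ⟨0, hpos⟩
  have horth : Orthonormal ℝ (({i₀} : Set _).domRestrict
      (fun _ : Fin (Module.finrank ℝ E) => ‖p‖⁻¹ • p)) := by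
    constructor
    · intro i
      simp [Set.domRestrict, norm_smul, hn]
    · intro i j hij
      exact absurd (Subtype.ext (i.2.trans j.2.symm)) hij
  obtain ⟨b, hb⟩ := horth.exists_orthonormalBasis_extension_of_card_eq (by simp)
  have hb0 : b i₀ = ‖p‖⁻¹ • p := hb i₀ rfl
  have hsplit : tangentialTrace p D = ∑ i ∈ Finset.univ.erase i₀, ⟪b i, D (b i)⟫_ℝ := by
    rw [tangentialTrace, LinearMap.trace_eq_sum_inner _ b,
      ← Finset.add_sum_erase _ _ (Finset.mem_univ i₀), hb0]
    simp only [ContinuousLinearMap.coe_coe, map_smul, inner_smul_left, inner_smul_right]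
    simp
    field_simp
    ring
  rw [hsplit]
  refine Finset.sum_nonneg fun i hi => hD _ ?_
  have h1 : ⟪b i₀, b i⟫_ℝ = 0 := b.orthonormal.2 (Finset.ne_of_mem_erase hi).symm
  rw [hb0, inner_smul_left] at h1
  simpa [hn] using h1

lemma tangentialTrace_mono {p : E} (hp : p ≠ 0) {H H' : E →L[ℝ] E}
    (h : ∀ v, ⟪p, v⟫_ℝ = 0 → ⟪v, H v⟫_ℝ ≤ ⟪v, H' v⟫_ℝ) :
    tangentialTrace p H ≤ tangentialTrace p H' := by
  have := tangentialTrace_nonneg hp (D := H' - H) fun v hv => by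
    rw [sub_apply, inner_sub_right]
    linarith [h v hv]
  rw [tangentialTrace_sub] at this
  linarith

/-- The tangential trace is controlled by the operator norm, uniformly in the direction. -/
lemma exists_tangentialTrace_le (E : Type*) [NormedAddCommGroup E] [InnerProductSpace ℝ E]
    [FiniteDimensional ℝ E] :
    ∃ C : ℝ, 0 ≤ C ∧ ∀ (p : E) (H : E →L[ℝ] E), |tangentialTrace p H| ≤ C * ‖H‖ := by
  let b := stdOrthonormalBasis ℝ E
  refine ⟨Module.finrank ℝ E + 1, by positivity, fun p H => ?_⟩
  have h1 : |LinearMap.trace ℝ E (H : E →ₗ[ℝ] E)| ≤ Module.finrank ℝ E * ‖H‖ := by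
    rw [LinearMap.trace_eq_sum_inner _ b]
    refine (Finset.abs_sum_le_sum_abs _ _).trans ?_
    have : ∀ i ∈ Finset.univ, |⟪b i, H (b i)⟫_ℝ| ≤ ‖H‖ := fun i _ => by
      refine (abs_real_inner_le_norm _ _).trans ?_
      have := H.le_opNorm (b i)
      rw [b.norm_eq_one, mul_one] at this
      rwa [b.norm_eq_one, one_mul]
    refine (Finset.sum_le_sum this).trans ?_
    simp
  have h2 : |⟪p, H p⟫_ℝ / ‖p‖ ^ 2| ≤ ‖H‖ := by
    rw [abs_div, abs_of_nonneg (by positivity : (0 : ℝ) ≤ ‖p‖ ^ 2)]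
    refine div_le_of_le_mul₀ (by positivity) (norm_nonneg H) ?_
    refine (abs_real_inner_le_norm _ _).trans ?_
    nlinarith [H.le_opNorm p, norm_nonneg p]
  calc |tangentialTrace p H| ≤ _ := abs_sub _ _
    _ ≤ (Module.finrank ℝ E + 1) * ‖H‖ := by linarith

lemma ContDiffAt.gradient {g : E → ℝ} {Q : E} {m k : WithTop ℕ∞} (hg : ContDiffAt ℝ k g Q)
    (hm : m + 1 ≤ k) : ContDiffAt ℝ m (gradient g) Q :=
  (InnerProductSpace.toDual ℝ E).symm.toContinuousLinearEquiv.toContinuousLinearMap.contDiff.contDiffAt.comp Q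
    (hg.fderiv_right hm)

/-- Second derivative along a curve. -/
lemma deriv_deriv_comp_curve {g : E → ℝ} {c : ℝ → E} {Q : E} (hg : ContDiffAt ℝ 2 g Q)
    (hc : ContDiffAt ℝ 2 c 0) (h0 : c 0 = Q) :
    deriv (fun r => g (c r)) 0 = ⟪gradient g Q, deriv c 0⟫_ℝ ∧
    deriv (deriv fun r => g (c r)) 0 =
      ⟪deriv c 0, fderiv ℝ (gradient g) Q (deriv c 0)⟫_ℝ + ⟪gradient g Q, deriv (deriv c) 0⟫_ℝ := by
  have hev : ∀ᶠ r in 𝓝 (0 : ℝ), deriv (fun r => g (c r)) r = ⟪gradient g (c r), deriv c r⟫_ℝ := by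
    have h1 : Tendsto c (𝓝 0) (𝓝 Q) := by
      have := hc.continuousAt.tendsto
      rwa [h0] at this
    filter_upwards [h1.eventually hg.eventually_differentiableAt, hc.eventually (by simp)] with r hr hr'
    have := hr.hasFDerivAt.comp_hasDerivAt r (hr'.differentiableAt (by simp)).hasDerivAt
    rw [inner_gradient_left]
    exact this.deriv
  refine ⟨by rw [hev.self_of_nhds, h0], ?_⟩
  rw [Filter.EventuallyEq.deriv_eq hev]
  have hc' : DifferentiableAt ℝ c 0 := hc.differentiableAt (by simp)
  have hcd : DifferentiableAt ℝ (deriv c) 0 := by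
    have : ContDiffAt ℝ 1 (deriv c) 0 := by
      have := hc.fderiv_right (m := 1) (by norm_num)
      exact this.clm_apply contDiffAt_const
    exact this.differentiableAt (by simp)
  have hgr : HasFDerivAt (gradient g) (fderiv ℝ (gradient g) Q) (c 0) := by
    rw [h0]
    exact ((hg.gradient (m := 1) (by norm_num)).differentiableAt (by simp)).hasFDerivAt
  have h2 := (hgr.comp_hasDerivAt (0 : ℝ) hc'.hasDerivAt).inner ℝ hcd.hasDerivAt
  rw [show deriv (fun r => ⟪gradient g (c r), deriv c r⟫_ℝ) 0 = _ from h2.deriv]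
  simp only [Function.comp, h0]
  rw [add_comm, real_inner_comm]

lemma IsLocalMin.deriv_deriv_nonneg {f : ℝ → ℝ} {a : ℝ} (h : IsLocalMin f a)
    (hf : ContinuousAt f a) : 0 ≤ deriv (deriv f) a := by
  by_contra! hneg
  have hmax := isLocalMax_of_deriv_deriv_neg hneg h.deriv_eq_zero hf
  have hconst : f =ᶠ[𝓝 a] fun _ => f a := by
    filter_upwards [h, hmax] with x h1 h2 using le_antisymm h2 h1
  have : deriv f =ᶠ[𝓝 a] fun _ => 0 := by
    have := hconst.deriv
    simpa using this
  rw [this.deriv_eq] at hneg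
  simp at hneg

lemma gradient_sub_apply {f g : E → ℝ} {Q : E} (hf : ContDiffAt ℝ 2 f Q)
    (hg : ContDiffAt ℝ 2 g Q) :
    gradient (fun Q => f Q - g Q) Q = gradient f Q - gradient g Q ∧
    fderiv ℝ (gradient fun Q => f Q - g Q) Q
      = fderiv ℝ (gradient f) Q - fderiv ℝ (gradient g) Q := by
  have hev : gradient (fun Q => f Q - g Q) =ᶠ[𝓝 Q] fun Q => gradient f Q - gradient g Q := by
    filter_upwards [hf.eventually_differentiableAt, hg.eventually_differentiableAt] with Q' h1 h2
    simp only [gradient]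
    rw [fderiv_fun_sub h1 h2, map_sub]
  refine ⟨hev.self_of_nhds, ?_⟩
  rw [hev.fderiv_eq]
  exact fderiv_fun_sub ((hf.gradient (m := 1) (by norm_num)).differentiableAt (by simp))
    ((hg.gradient (m := 1) (by norm_num)).differentiableAt (by simp))

/-- Ellipticity: a function that touches another one from below has a smaller level set operator
at the point of contact. -/
lemma levelSetOp_le_of_touches {f g : E → ℝ} {Q : E} (A : ℝ) (hf : ContDiffAt ℝ 2 f Q)
    (hg : ContDiffAt ℝ 2 g Q) (hle : ∀ᶠ Q' in 𝓝 Q, f Q' ≤ g Q') (heq : f Q = g Q)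
    (hne : gradient g Q ≠ 0) :
    levelSetOp A (gradient f Q) (fderiv ℝ (gradient f) Q)
      ≤ levelSetOp A (gradient g Q) (fderiv ℝ (gradient g) Q) := by
  let w : E → ℝ := fun Q => g Q - f Q
  have hw : ContDiffAt ℝ 2 w Q := hg.sub hf
  have hmin : IsLocalMin w Q := by
    filter_upwards [hle] with Q' h
    simp only [w, heq, sub_self]
    linarith
  obtain ⟨hg1, hg2⟩ := gradient_sub_apply hg hf
  have hgrad : gradient f Q = gradient g Q := by
    have h0 : gradient w Q = 0 := by simp [gradient, hmin.fderiv_eq_zero]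
    have h1 : gradient w Q = gradient g Q - gradient f Q := hg1
    rw [h0] at h1
    exact (sub_eq_zero.1 h1.symm).symm
  rw [hgrad, levelSetOp, levelSetOp]
  gcongr
  refine tangentialTrace_mono hne fun v _ => ?_
  have hline : ContDiffAt ℝ 2 (fun r : ℝ => Q + r • v) 0 := (contDiff_line Q v).contDiffAt
  have h1 := (deriv_deriv_comp_curve hw hline (by simp)).2
  have hd : deriv (fun r : ℝ => Q + r • v) = fun _ => v := by
    funext r
    simpa using (((hasDerivAt_id r).smul_const v).const_add Q).deriv
  simp only [hd, deriv_const, inner_zero_right, add_zero] at h1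
  have hloc : IsLocalMin (fun r : ℝ => w (Q + r • v)) 0 := by
    have ht : Tendsto (fun r : ℝ => Q + r • v) (𝓝 0) (𝓝 Q) := by
      simpa using hline.continuousAt.tendsto
    have := ht.eventually hmin
    simpa [IsLocalMin, IsMinFilter] using this
  have h2 := hloc.deriv_deriv_nonneg
    (ContinuousAt.comp (g := w) (by simpa using hw.continuousAt) hline.continuousAt)
  rw [h1] at h2
  have h3 : fderiv ℝ (gradient w) Q = fderiv ℝ (gradient g) Q - fderiv ℝ (gradient f) Q := hg2
  rw [h3, sub_apply, inner_sub_right] at h2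
  linarith

/-- A curve in a level set with prescribed tangent vector. -/
lemma exists_curve_in_levelSet {ψ : E → ℝ} {Q : E} (hψ : ContDiffAt ℝ 2 ψ Q) (h0 : ψ Q = 0)
    (hne : gradient ψ Q ≠ 0) {v : E} (hv : ⟪gradient ψ Q, v⟫_ℝ = 0) :
    ∃ c : ℝ → E, ContDiffAt ℝ 2 c 0 ∧ c 0 = Q ∧ deriv c 0 = v ∧ (∀ᶠ r in 𝓝 0, ψ (c r) = 0) ∧
      ∃ k : ℝ, deriv (deriv c) 0 = k • gradient ψ Q := by
  set p := gradient ψ Q with hp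
  let L : ℝ × ℝ → E := fun q => Q + q.1 • v + q.2 • p
  have hL : ContDiff ℝ 2 L := (contDiff_const.add (contDiff_fst.smul contDiff_const)).add
    (contDiff_snd.smul contDiff_const)
  have hL0 : L (0, 0) = Q := by simp [L]
  let G : ℝ × ℝ → ℝ := fun q => ψ (L q)
  have hG : ContDiffAt ℝ 2 G (0, 0) :=
    ContDiffAt.comp (0, 0) (g := ψ) (by rw [hL0]; exact hψ) hL.contDiffAt
  have hpart : (fderiv ℝ G (0, 0) ∘L .inr ℝ ℝ ℝ) 1 = ‖p‖ ^ 2 := by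
    have h1 : HasFDerivAt (fun r => G (0, r)) (fderiv ℝ G (0, 0) ∘L .inr ℝ ℝ ℝ) 0 :=
      HasFDerivAt.comp (0 : ℝ) (hG.differentiableAt (by simp)).hasFDerivAt
        (hasFDerivAt_prodMk_right 0 0)
    have h2 : HasDerivAt (fun r : ℝ => L (0, r)) p 0 := by
      simpa [L] using ((hasDerivAt_id (0 : ℝ)).smul_const p).const_add Q
    have h3 : HasFDerivAt ψ (fderiv ℝ ψ Q) (L (0, 0)) := by
      rw [hL0]; exact (hψ.differentiableAt (by simp)).hasFDerivAt
    have h5 := h1.hasDerivAt.unique (h3.comp_hasDerivAt (0 : ℝ) h2)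
    rw [h5, ← inner_gradient_left, ← hp, real_inner_self_eq_norm_sq]
  have hpn : ‖p‖ ^ 2 ≠ 0 := by simpa using hne
  have hinv : (fderiv ℝ G (0, 0) ∘L .inr ℝ ℝ ℝ).IsInvertible := by
    refine ⟨ContinuousLinearEquiv.unitsEquivAut ℝ (Units.mk0 _ hpn), ?_⟩
    ext
    simp [hpart]
  let κ := hG.implicitFunction (by simp) hinv
  have hκ : ContDiffAt ℝ 2 κ 0 := hG.contDiffAt_implicitFunction (by simp) hinv
  have hκ0 : κ 0 = 0 := hG.implicitFunction_apply_self (by simp) hinv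
  let c : ℝ → E := fun r => Q + r • v + κ r • p
  have hc : ContDiffAt ℝ 2 c 0 := (contDiff_line Q v).contDiffAt.add (hκ.smul contDiffAt_const)
  have hc0 : c 0 = Q := by simp [c, hκ0]
  have hz : ∀ᶠ r in 𝓝 (0 : ℝ), ψ (c r) = 0 := by
    filter_upwards [hG.eventually_apply_implicitFunction (by simp) hinv] with r hr
    have : G (0, 0) = 0 := by simp only [G, hL0, h0]
    rw [this] at hr
    exact hr
  have hder : ∀ᶠ r in 𝓝 (0 : ℝ), deriv c r = v + deriv κ r • p := by
    filter_upwards [hκ.eventually (by simp)] with r hr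
    have h1 := ((hasDerivAt_id r).smul_const v).const_add Q
    have h2 := (hr.differentiableAt (by simp)).hasDerivAt.smul_const p
    have h3 := (h1.add h2).deriv
    rw [one_smul] at h3
    exact h3
  have hκ' : deriv κ 0 = 0 := by
    have h1 := (deriv_deriv_comp_curve hψ hc hc0).1
    have h2 : deriv (fun r => ψ (c r)) 0 = 0 := by
      rw [Filter.EventuallyEq.deriv_eq (show (fun r => ψ (c r)) =ᶠ[𝓝 0] fun _ => 0 from hz)]
      simp
    rw [h2, hder.self_of_nhds, inner_add_right, hv, inner_smul_right,
      real_inner_self_eq_norm_sq] at h1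
    rcases mul_eq_zero.1 (show deriv κ 0 * ‖p‖ ^ 2 = 0 by linarith) with h | h
    · exact h
    · exact absurd h hpn
  refine ⟨c, hc, hc0, ?_, hz, deriv (deriv κ) 0, ?_⟩
  · rw [hder.self_of_nhds, hκ', zero_smul, add_zero]
  · rw [Filter.EventuallyEq.deriv_eq hder]
    have hκd : DifferentiableAt ℝ (deriv κ) 0 := by
      have : ContDiffAt ℝ 1 (deriv κ) 0 :=
        (hκ.fderiv_right (m := 1) (by norm_num)).clm_apply contDiffAt_const
      exact this.differentiableAt (by simp)
    simpa using ((hκd.hasDerivAt.smul_const p).const_add v).deriv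

/-- If `g` vanishes on the level set `{ψ = 0}`, then `∇g = c ∇ψ` on it, and the level set operators
of `g` and `ψ` are proportional if `c` is positive. -/
lemma levelSetOp_of_vanishing {g ψ : E → ℝ} {Q : E} (A : ℝ) (hg : ContDiffAt ℝ 2 g Q)
    (hψ : ContDiffAt ℝ 2 ψ Q) (h0 : ψ Q = 0) (hne : gradient ψ Q ≠ 0)
    (hz : ∀ᶠ Q' in 𝓝 Q, ψ Q' = 0 → g Q' = 0) :
    ∃ c : ℝ, gradient g Q = c • gradient ψ Q ∧
      (0 < c → levelSetOp A (gradient g Q) (fderiv ℝ (gradient g) Q) =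
        c * levelSetOp A (gradient ψ Q) (fderiv ℝ (gradient ψ) Q)) := by
  set p := gradient ψ Q with hp
  have hpn : ‖p‖ ^ 2 ≠ 0 := by simpa using hne
  have key : ∀ v, ⟪p, v⟫_ℝ = 0 → ⟪gradient g Q, v⟫_ℝ = 0 ∧
      ∃ k : ℝ, ⟪v, fderiv ℝ (gradient g) Q v⟫_ℝ + k * ⟪gradient g Q, p⟫_ℝ = 0 ∧
        ⟪v, fderiv ℝ (gradient ψ) Q v⟫_ℝ + k * ⟪p, p⟫_ℝ = 0 := by
    intro v hv
    obtain ⟨c, hc, hc0, hc1, hcz, k, hk⟩ := exists_curve_in_levelSet hψ h0 hne hv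
    have hct : Tendsto c (𝓝 0) (𝓝 Q) := by
      have := hc.continuousAt.tendsto
      rwa [hc0] at this
    have hgz : (fun r => g (c r)) =ᶠ[𝓝 0] fun _ => 0 := by
      filter_upwards [hct.eventually hz, hcz] with r h1 h2 using h1 h2
    have hψz : (fun r => ψ (c r)) =ᶠ[𝓝 0] fun _ => 0 := hcz
    obtain ⟨a1, a2⟩ := deriv_deriv_comp_curve hg hc hc0
    obtain ⟨-, b2⟩ := deriv_deriv_comp_curve hψ hc hc0
    rw [hgz.deriv_eq, hc1, deriv_const] at a1
    rw [hgz.deriv.deriv_eq, hc1, hk] at a2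
    rw [hψz.deriv.deriv_eq, hc1, hk] at b2
    simp only [deriv_const', inner_smul_right] at a2 b2
    exact ⟨a1.symm, k, a2.symm, b2.symm⟩
  let c : ℝ := ⟪gradient g Q, p⟫_ℝ / ‖p‖ ^ 2
  have hgrad : gradient g Q = c • p := by
    have hort : ⟪p, gradient g Q - c • p⟫_ℝ = 0 := by
      rw [inner_sub_right, inner_smul_right, real_inner_self_eq_norm_sq, real_inner_comm]
      simp only [c]
      field_simp
      ring
    have h1 := (key _ hort).1
    have h2 : ⟪gradient g Q - c • p, gradient g Q - c • p⟫_ℝ = 0 := by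
      rw [inner_sub_left, h1, inner_smul_left, hort]
      simp
    exact sub_eq_zero.1 (inner_self_eq_zero.1 h2)
  refine ⟨c, hgrad, fun hc => ?_⟩
  rw [← levelSetOp_smul hc, hgrad, levelSetOp, levelSetOp]
  congr 1
  have heq : ∀ v, ⟪c • p, v⟫_ℝ = 0 →
      ⟪v, fderiv ℝ (gradient g) Q v⟫_ℝ = ⟪v, (c • fderiv ℝ (gradient ψ) Q) v⟫_ℝ := by
    intro v hv
    have hv' : ⟪p, v⟫_ℝ = 0 := by
      rw [inner_smul_left] at hv
      simpa [hc.ne'] using hv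
    obtain ⟨-, k, e1, e2⟩ := key v hv'
    rw [hgrad, inner_smul_left] at e1
    rw [smul_apply, inner_smul_right]
    simp only [RCLike.conj_to_real] at e1
    linear_combination e1 - c * e2
  have hcp : c • p ≠ 0 := smul_ne_zero hc.ne' hne
  exact le_antisymm (tangentialTrace_mono hcp fun v hv => (heq v hv).le)
    (tangentialTrace_mono hcp fun v hv => (heq v hv).ge)

end LevelSet

/-! ### Mean curvature and the evolution law in level set form -/

lemma two_le_smooth : (2 : WithTop ℕ∞) ≤ ∞ := by
  exact WithTop.coe_le_coe.2 (le_top : (2 : ℕ∞) ≤ ⊤)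

section Curvature

variable {n : ℕ}

open scoped InnerProductSpace

/-- The mean curvature of a level set, as the tangential trace of the Hessian. -/
lemma meanCurvature_eq {g : Amb n → ℝ} {Q : Amb n} (hg : ContDiffAt ℝ 2 g Q)
    (hne : gradient g Q ≠ 0) :
    meanCurvature g Q
      = -(tangentialTrace (gradient g Q) (fderiv ℝ (gradient g) Q) / ‖gradient g Q‖) := by
  set p := gradient g Q with hp
  set H := fderiv ℝ (gradient g) Q with hH
  have hn : ‖p‖ ≠ 0 := norm_ne_zero_iff.2 hne
  have hG : HasFDerivAt (gradient g) H Q :=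
    ((hg.gradient (m := 1) (by norm_num)).differentiableAt (by simp)).hasFDerivAt
  have hnorm : HasFDerivAt (fun Q' => ‖gradient g Q'‖) (‖p‖⁻¹ • (innerSL ℝ p ∘L H)) Q := by
    have h1 : HasFDerivAt (fun Q' => ‖gradient g Q'‖ ^ 2) (2 • (innerSL ℝ p ∘L H)) Q :=
      hG.norm_sq
    have h2 := h1.sqrt (by positivity)
    have h3 : (fun Q' => √(‖gradient g Q'‖ ^ 2)) = fun Q' => ‖gradient g Q'‖ := by
      funext Q'; exact Real.sqrt_sq (norm_nonneg _)
    rw [h3, Real.sqrt_sq (norm_nonneg _)] at h2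
    refine h2.congr_fderiv ?_
    ext v
    simp only [smul_apply, smul_eq_mul, nsmul_eq_mul]
    push_cast
    rw [← hp]
    field_simp
  have hinv : HasFDerivAt (fun Q' => ‖gradient g Q'‖⁻¹)
      (-(‖p‖ ^ 2)⁻¹ • (‖p‖⁻¹ • (innerSL ℝ p ∘L H))) Q :=
    (hasDerivAt_inv hn).comp_hasFDerivAt Q hnorm
  have hN : HasFDerivAt (outerNormal g) (-(‖p‖⁻¹ • H +
      (-(‖p‖ ^ 2)⁻¹ • (‖p‖⁻¹ • (innerSL ℝ p ∘L H))).smulRight p)) Q :=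
    (hinv.smul hG).neg
  rw [meanCurvature, divergence, hN.fderiv]
  have htr : LinearMap.trace ℝ (Amb n)
      (((-(‖p‖ ^ 2)⁻¹ • (‖p‖⁻¹ • (innerSL ℝ p ∘L H))).smulRight p : Amb n →L[ℝ] Amb n) :
        Amb n →ₗ[ℝ] Amb n) = (-(‖p‖ ^ 2)⁻¹ • (‖p‖⁻¹ • (innerSL ℝ p ∘L H))) p := by
    exact LinearMap.trace_smulRight _ _
  rw [ContinuousLinearMap.toLinearMap_neg, ContinuousLinearMap.toLinearMap_add, map_neg, map_add,
    htr, ContinuousLinearMap.toLinearMap_smul, map_smul, tangentialTrace]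
  simp only [smul_apply, ContinuousLinearMap.comp_apply, innerSL_apply_apply, smul_eq_mul]
  field_simp
  ring

/-- The evolution law in level set form. -/
lemma EvolvesByForcedMCF.exists_levelSet {A T : ℝ} {Γ D : ℝ → Set (Amb n)}
    (h : EvolvesByForcedMCF A T Γ D) {t : ℝ} (ht : t ∈ Ioo 0 T) {Q : Amb n} (hQ : Q ∈ Γ t) :
    ∃ N : Set (Amb n × ℝ), IsOpen N ∧ (Q, t) ∈ N ∧ ∃ ψ : Amb n → ℝ → ℝ,
      ContDiffOn ℝ ∞ (Function.uncurry ψ) N ∧ gradient (fun Q' => ψ Q' t) Q ≠ 0 ∧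
      (∀ q ∈ N, (q.1 ∈ Γ q.2 ↔ ψ q.1 q.2 = 0) ∧ (q.1 ∈ D q.2 ↔ 0 < ψ q.1 q.2)) ∧
      ContDiffAt ℝ ∞ (fun Q' => ψ Q' t) Q ∧
      deriv (fun τ => ψ Q τ) t =
        levelSetOp A (gradient (fun Q' => ψ Q' t) Q) (fderiv ℝ (gradient fun Q' => ψ Q' t) Q) := by
  obtain ⟨N, hN, hmem, ψ, hψ, hne, hiff, hV⟩ := h t ht Q hQ
  have hsl : ContDiffAt ℝ ∞ (fun Q' => ψ Q' t) Q :=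
    ContDiffAt.comp Q (g := Function.uncurry ψ) (f := fun Q' => (Q', t))
      (hψ.contDiffAt (hN.mem_nhds hmem)) (contDiffAt_id.prodMk contDiffAt_const)
  refine ⟨N, hN, hmem, ψ, hψ, hne, hiff, hsl, ?_⟩
  rw [normalVelocity, meanCurvature_eq (hsl.of_le two_le_smooth) hne] at hV
  have hn : ‖gradient (fun Q' => ψ Q' t) Q‖ ≠ 0 := norm_ne_zero_iff.2 hne
  rw [levelSetOp]
  field_simp at hV
  linarith

end Curvature

/-! ### The flow relation and the explicit parts of the flow -/

section Ambient

variable {n : ℕ}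

@[simp] lemma pt_fst (x : ℝ) (y : EuclideanSpace ℝ (Fin n)) : (pt x y).fst = x := rfl

@[simp] lemma pt_snd (x : ℝ) (y : EuclideanSpace ℝ (Fin n)) : (pt x y).snd = y := rfl

@[simp] lemma pt_fst_snd (P : Amb n) : pt P.fst P.snd = P := rfl

lemma Amb.ext {P Q : Amb n} (h1 : P.fst = Q.fst) (h2 : P.snd = Q.snd) : P = Q := by
  rw [← pt_fst_snd P, ← pt_fst_snd Q, h1, h2]

lemma norm_sq_pt (x : ℝ) (y : EuclideanSpace ℝ (Fin n)) : ‖pt x y‖ ^ 2 = x ^ 2 + ‖y‖ ^ 2 := by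
  rw [WithLp.prod_norm_sq_eq_of_L2]
  simp

lemma continuous_pt {Y : Type*} [TopologicalSpace Y] {f : Y → ℝ}
    {g : Y → EuclideanSpace ℝ (Fin n)} (hf : Continuous f) (hg : Continuous g) :
    Continuous fun y => pt (f y) (g y) :=
  (WithLp.prodContinuousLinearEquiv 2 ℝ ℝ (EuclideanSpace ℝ (Fin n))).symm.continuous.comp
    (hf.prodMk hg)

lemma hasDerivAt_pt {f : ℝ → ℝ} {g : ℝ → EuclideanSpace ℝ (Fin n)} {f' t : ℝ}
    {g' : EuclideanSpace ℝ (Fin n)} (hf : HasDerivAt f f' t) (hg : HasDerivAt g g' t) :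
    HasDerivAt (fun r => pt (f r) (g r)) (pt f' g') t :=
  (WithLp.prodContinuousLinearEquiv 2 ℝ ℝ
    (EuclideanSpace ℝ (Fin n))).symm.toContinuousLinearMap.hasFDerivAt.comp_hasDerivAt t
      (hf.prodMk hg)

lemma isClosed_axisSegment (n : ℕ) (ε : ℝ) : IsClosed (axisSegment n ε) :=
  (isClosed_eq (f := fun P : Amb n => P.snd) (by fun_prop) continuous_const).inter
    (isClosed_le (f := fun P : Amb n => |P.fst|) (by fun_prop) continuous_const)

lemma mem_ball_zero_pt {ε : ℝ} (hε : 0 < ε) (x : ℝ) (y : EuclideanSpace ℝ (Fin n)) :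
    pt x y ∈ Metric.ball (0 : Amb n) ε ↔ x ^ 2 + ‖y‖ ^ 2 < ε ^ 2 := by
  rw [mem_ball_zero_iff, ← norm_sq_pt]
  exact (pow_lt_pow_iff_left₀ (norm_nonneg _) hε.le two_ne_zero).symm

lemma isOpen_compl_axisSegment (n : ℕ) (ε : ℝ) : IsOpen (axisSegment n ε)ᶜ :=
  (isClosed_axisSegment n ε).isOpen_compl

lemma exists_snd_ne_zero_of_isOpen (hn : 2 ≤ n) {V : Set (Amb n)} (hV : IsOpen V) {P : Amb n}
    (hP : P ∈ V) : ∃ Q ∈ V, Q.snd ≠ 0 := by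
  by_cases h0 : P.snd = 0
  · have : Nonempty (Fin n) := ⟨⟨0, by omega⟩⟩
    obtain ⟨e, he⟩ := exists_ne (0 : EuclideanSpace ℝ (Fin n))
    have hc : Continuous fun r : ℝ => pt P.fst (r • e) := continuous_pt (by fun_prop) (by fun_prop)
    have h1 : pt P.fst ((0 : ℝ) • e) ∈ V := by
      rw [zero_smul, ← h0]; exact hP
    have h2 : ∀ᶠ r in 𝓝 (0 : ℝ), pt P.fst (r • e) ∈ V := hc.continuousAt.eventually (hV.mem_nhds h1)
    obtain ⟨r, hr, hr0⟩ := ((h2.filter_mono nhdsWithin_le_nhds).and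
      (self_mem_nhdsWithin : ∀ᶠ r : ℝ in 𝓝[>] 0, r ∈ Ioi (0 : ℝ))).exists
    exact ⟨_, hr, smul_ne_zero (ne_of_gt hr0) he⟩
  · exact ⟨P, hP, h0⟩

end Ambient

section FlowsTo

variable {n : ℕ} {X : Amb n → Amb n} {Z : Set (Amb n)} {P Q R : Amb n} {s : ℝ}

lemma FlowsTo.neg (h : FlowsTo X Z P s Q) : FlowsTo (-X) Z P (-s) Q := by
  obtain ⟨γ, h0, hs, hc, hd⟩ := h
  refine ⟨fun τ => γ (-τ), by simpa using h0, by simpa using hs, ?_, fun τ hτ => ?_⟩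
  · refine hc.comp continuous_neg.continuousOn fun τ hτ => ?_
    rw [mem_uIcc] at hτ ⊢
    rcases hτ with h | h
    · exact Or.inr ⟨by linarith [h.2], by linarith [h.1]⟩
    · exact Or.inl ⟨by linarith [h.2], by linarith [h.1]⟩
  · have hmem : -τ ∈ Ioo (min 0 s) (max 0 s) := by
      rcases le_total 0 s with h | h
      · rw [min_eq_right (by linarith), max_eq_left (by linarith)] at hτ
        rw [min_eq_left h, max_eq_right h]
        exact ⟨by linarith [hτ.2], by linarith [hτ.1]⟩
      · rw [min_eq_left (by linarith), max_eq_right (by linarith)] at hτ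
        rw [min_eq_right h, max_eq_left h]
        exact ⟨by linarith [hτ.2], by linarith [hτ.1]⟩
    have := hd (-τ) hmem
    refine ⟨this.1, ?_⟩
    simpa [Function.comp_def] using HasDerivAt.scomp τ this.2 (hasDerivAt_neg τ)

lemma FlowsTo.reaches (hZ : IsClosed Z) (hX : ContDiffOn ℝ 1 X Zᶜ) (h : FlowsTo X Z P s Q)
    (hP : P ∉ Z) (hQ : Q ∉ Z) : Reaches X Zᶜ P s Q := by
  have key : ∀ (Y : Amb n → Amb n) (r : ℝ), ContDiffOn ℝ 1 Y Zᶜ → 0 < r → FlowsTo Y Z P r Q →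
      Reaches Y Zᶜ P r Q := by
    rintro Y r hY hr ⟨γ, rfl, rfl, hc, hd⟩
    rw [uIcc_of_le hr.le] at hc
    rw [min_eq_left hr.le, max_eq_right hr.le] at hd
    exact Reaches.of_Icc hZ.isOpen_compl hY hr hc hP hQ hd
  rcases lt_trichotomy s 0 with hs | rfl | hs
  · simpa using Reaches.neg_field_iff.1 (key (-X) (-s) hX.neg (by linarith) h.neg)
  · obtain ⟨γ, h0, hs, -⟩ := h
    rw [← hs, h0]
    exact Reaches.zero hZ.isOpen_compl hX hP
  · exact key X s hX hs h

lemma FlowsTo.eq_of_reaches (hZ : IsClosed Z) (hX : ContDiffOn ℝ 1 X Zᶜ) (h : FlowsTo X Z P s Q)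
    (h' : Reaches X Zᶜ P s R) : Q = R := by
  have key : ∀ (Y : Amb n → Amb n) (r : ℝ), ContDiffOn ℝ 1 Y Zᶜ → 0 < r → FlowsTo Y Z P r Q →
      Reaches Y Zᶜ P r R → Q = R := by
    rintro Y r hY hr ⟨γ, rfl, rfl, hc, hd⟩ ⟨ζ, a, b, h0, hr', e0, rfl, hζ⟩
    rw [uIcc_of_le hr.le] at hc
    rw [min_eq_left hr.le, max_eq_right hr.le] at hd
    have heq : ∀ τ ∈ Ioo 0 r, γ τ = ζ τ := fun τ hτ => by
      have h1 := Reaches.of_Icc hZ.isOpen_compl hY hτ.1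
        (hc.mono (Icc_subset_Icc_right hτ.2.le)) (e0 ▸ (hζ 0 h0).1) (hd τ hτ).1
        (fun σ hσ => hd σ ⟨hσ.1, hσ.2.trans hτ.2⟩)
      exact h1.unique hZ.isOpen_compl hY
        ⟨ζ, a, b, h0, ⟨h0.1.trans hτ.1, hτ.2.trans hr'.2⟩, e0, rfl, hζ⟩
    have hc1 : Tendsto γ (𝓝[<] r) (𝓝 (γ r)) :=
      ((hc r ⟨hr.le, le_rfl⟩).mono_of_mem_nhdsWithin
        (mem_of_superset (Ioo_mem_nhdsLT hr) Ioo_subset_Icc_self))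
    have hc2 : Tendsto ζ (𝓝[<] r) (𝓝 (ζ r)) :=
      (hζ r hr').2.continuousAt.tendsto.mono_left nhdsWithin_le_nhds
    refine tendsto_nhds_unique hc1 (hc2.congr' ?_)
    filter_upwards [Ioo_mem_nhdsLT hr] with τ hτ using (heq τ hτ).symm
  rcases lt_trichotomy s 0 with hs | rfl | hs
  · exact key (-X) (-s) hX.neg (by linarith) h.neg (Reaches.neg_field_iff.2 (by simpa using h'))
  · obtain ⟨γ, h0, hs, -⟩ := h
    obtain ⟨γ', a, b, -, -, h0', hs', -⟩ := h'
    rw [← hs, h0, ← h0', hs']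
  · exact key X s hX hs h h'

lemma Reaches.flowsTo (h : Reaches X Zᶜ P s Q) : FlowsTo X Z P s Q := by
  obtain ⟨γ, a, b, h0, hs, e0, es, hγ⟩ := h
  refine ⟨γ, e0, es, fun τ hτ => ?_, fun τ hτ => ?_⟩
  · refine (hγ τ ⟨?_, ?_⟩).2.continuousAt.continuousWithinAt
    · exact (lt_min h0.1 hs.1).trans_le hτ.1
    · exact hτ.2.trans_lt (max_lt h0.2 hs.2)
  · exact hγ τ ⟨(lt_min h0.1 hs.1).trans hτ.1, hτ.2.trans (max_lt h0.2 hs.2)⟩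

end FlowsTo

section ExplicitFlow

variable {n : ℕ} {b₀ : ℝ} {u₀ : ℝ → ℝ} {ε₀ ε₁ : ℝ} {X : Amb n → Amb n}

namespace IsTransverseField

lemma contDiffOn_one (hX : IsTransverseField b₀ u₀ ε₀ ε₁ X) :
    ContDiffOn ℝ 1 X (axisSegment n ε₀)ᶜ :=
  hX.smooth.of_le (by exact_mod_cast le_top)

/-- The balls on which `X` is explicit are disjoint since `X` takes different values there. -/
lemma disjoint_balls (hn : 2 ≤ n) (hX : IsTransverseField b₀ u₀ ε₀ ε₁ X) :
    Disjoint (Metric.ball (0 : Amb n) ε₀) (Metric.ball (pt b₀ 0 : Amb n) ε₁) ∧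
    Disjoint (Metric.ball (0 : Amb n) ε₀) (Metric.ball (pt (-b₀) 0 : Amb n) ε₁) ∧
    Disjoint (Metric.ball (pt b₀ 0 : Amb n) ε₁) (Metric.ball (pt (-b₀) 0 : Amb n) ε₁) := by
  have key : ∀ (a : ℝ) (V : Set (Amb n)), IsOpen V → a ≠ 0 → (∀ P ∈ V, X P = pt a 0) →
      Disjoint (Metric.ball (0 : Amb n) ε₀) V := by
    intro a V hV ha hXV
    rw [Set.disjoint_left]
    intro P hP hPV
    obtain ⟨Q, hQ, hQ0⟩ := exists_snd_ne_zero_of_isOpen hn (Metric.isOpen_ball.inter hV) ⟨hP, hPV⟩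
    have h1 := hX.near_origin Q.fst Q.snd hQ0 hQ.1
    rw [pt_fst_snd, hXV Q hQ.2] at h1
    exact ha (congrArg WithLp.fst h1)
  refine ⟨key (-1) _ Metric.isOpen_ball (by norm_num) hX.near_right,
    key 1 _ Metric.isOpen_ball (by norm_num) hX.near_left, ?_⟩
  rw [Set.disjoint_left]
  intro P hP hP'
  have h1 := congrArg WithLp.fst ((hX.near_right P hP).symm.trans (hX.near_left P hP'))
  simp only [pt_fst] at h1
  norm_num at h1

lemma axisSegment_subset_closure (hX : IsTransverseField b₀ u₀ ε₀ ε₁ X) :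
    axisSegment n ε₀ ⊆ closure (Metric.ball (0 : Amb n) ε₀) := by
  rintro P ⟨h1, h2⟩
  rw [closure_ball _ hX.ε₀_pos.ne', mem_closedBall_zero_iff, ← abs_norm,
    ← abs_of_pos hX.ε₀_pos, ← sq_le_sq, ← pt_fst_snd P, norm_sq_pt, h1]
  simpa [sq_le_sq, abs_of_pos hX.ε₀_pos] using h2

lemma notMem_axisSegment_of_mem_right (hn : 2 ≤ n) (hX : IsTransverseField b₀ u₀ ε₀ ε₁ X)
    {P : Amb n} (hP : P ∈ Metric.ball (pt b₀ 0 : Amb n) ε₁) : P ∉ axisSegment n ε₀ := fun h =>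
  Set.disjoint_left.1 ((hX.disjoint_balls hn).1.closure_left Metric.isOpen_ball)
    (hX.axisSegment_subset_closure h) hP

lemma notMem_axisSegment_of_mem_left (hn : 2 ≤ n) (hX : IsTransverseField b₀ u₀ ε₀ ε₁ X)
    {P : Amb n} (hP : P ∈ Metric.ball (pt (-b₀) 0 : Amb n) ε₁) : P ∉ axisSegment n ε₀ := fun h =>
  Set.disjoint_left.1 ((hX.disjoint_balls hn).2.1.closure_left Metric.isOpen_ball)
    (hX.axisSegment_subset_closure h) hP

/-- Near the origin the flow moves points towards the axis at unit speed, and reaches the axis at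
the time `|y|`. -/
lemma radial_flow (hX : IsTransverseField b₀ u₀ ε₀ ε₁ X) {x s : ℝ}
    {y : EuclideanSpace ℝ (Fin n)} {R : Amb n} (hy : y ≠ 0)
    (hP : pt x y ∈ Metric.ball (0 : Amb n) ε₀)
    (hs : s < 0 → pt x ((1 - s / ‖y‖) • y) ∈ Metric.ball (0 : Amb n) ε₀)
    (h : Reaches X (axisSegment n ε₀)ᶜ (pt x y) s R) :
    s < ‖y‖ ∧ R = pt x ((1 - s / ‖y‖) • y) := by
  have hr : 0 < ‖y‖ := norm_pos_iff.2 hy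
  have hε := hX.ε₀_pos
  set r := ‖y‖ with hrdef
  let γ : ℝ → Amb n := fun τ => pt x ((1 - τ / r) • y)
  have hball : ∀ τ, γ τ ∈ Metric.ball (0 : Amb n) ε₀ ↔ x ^ 2 + (r - τ) ^ 2 < ε₀ ^ 2 := fun τ => by
    rw [mem_ball_zero_pt hε, norm_smul, ← hrdef, Real.norm_eq_abs, mul_pow, sq_abs, ← mul_pow]
    have : (1 - τ / r) * r = r - τ := by field_simp
    rw [this]
  have hγ0 : γ 0 = pt x y := by simp [γ]
  have h0 : x ^ 2 + (r - 0) ^ 2 < ε₀ ^ 2 := (hball 0).1 (by rw [hγ0]; exact hP)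
  have hx : 0 < ε₀ ^ 2 - x ^ 2 := by nlinarith
  let a : ℝ := r - √(ε₀ ^ 2 - x ^ 2)
  have ha : ∀ τ < r, a < τ ↔ x ^ 2 + (r - τ) ^ 2 < ε₀ ^ 2 := fun τ hτ => by
    have : a < τ ↔ r - τ < √(ε₀ ^ 2 - x ^ 2) := ⟨fun h => by simp only [a] at h; linarith,
      fun h => by simp only [a]; linarith⟩
    rw [this, Real.lt_sqrt (by linarith)]
    constructor <;> intro h <;> linarith
  have hcurve : ∀ τ ∈ Ioo a r, γ τ ∈ (axisSegment n ε₀)ᶜ ∧ HasDerivAt γ (X (γ τ)) τ := by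
    intro τ hτ
    have hb := (hball τ).2 ((ha τ hτ.2).1 hτ.1)
    have hcoef : 0 < 1 - τ / r := by
      rw [sub_pos, div_lt_one hr]; exact hτ.2
    have hne : (1 - τ / r) • y ≠ 0 := smul_ne_zero hcoef.ne' hy
    refine ⟨fun hZ => hne hZ.1, ?_⟩
    rw [show X (γ τ) = _ from hX.near_origin x _ hne hb]
    refine hasDerivAt_pt (hasDerivAt_const τ x) ?_
    have h1 : HasDerivAt (fun τ : ℝ => 1 - τ / r) (-(1 / r)) τ :=
      ((hasDerivAt_id τ).div_const r).const_sub 1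
    convert! h1.smul_const y using 1
    rw [norm_smul, ← hrdef, Real.norm_eq_abs, abs_of_pos hcoef, smul_smul, ← neg_smul]
    congr 1
    have key : ∀ q : ℝ, q ≠ 0 → -(1 / r) = -((q * r)⁻¹ * q) := fun q hq => by field_simp
    exact (key _ hcoef.ne').symm
  have h0a : (0 : ℝ) ∈ Ioo a r := ⟨(ha 0 hr).2 h0, hr⟩
  have hlt : s < r := by
    by_contra! hrs
    obtain ⟨ζ, a', b', h0', hs', e0, -, hζ⟩ := h
    have hrb : r < b' := hrs.trans_lt hs'.2
    have heq : ∀ τ ∈ Ico 0 r, ζ τ = γ τ := fun τ hτ => by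
      have h1 : Reaches X (axisSegment n ε₀)ᶜ (pt x y) τ (ζ τ) :=
        ⟨ζ, a', b', h0', ⟨h0'.1.trans_le hτ.1, hτ.2.trans hrb⟩, e0, rfl, hζ⟩
      exact h1.unique (isOpen_compl_axisSegment n ε₀) hX.contDiffOn_one
        ⟨γ, a, r, h0a, ⟨h0a.1.trans_le hτ.1, hτ.2⟩, hγ0, rfl, hcurve⟩
    have hζr := hζ r ⟨h0'.1.trans hr, hrb⟩
    have hγc : Continuous γ := continuous_pt continuous_const (by fun_prop)
    have : ζ r = γ r := by
      refine tendsto_nhds_unique (hζr.2.continuousAt.tendsto.mono_left nhdsWithin_le_nhds)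
        (((hγc.tendsto r).mono_left nhdsWithin_le_nhds).congr' ?_ : Tendsto ζ (𝓝[<] r) (𝓝 (γ r)))
      filter_upwards [Ico_mem_nhdsLT hr] with τ hτ using (heq τ hτ).symm
    refine hζr.1 ?_
    rw [this]
    refine ⟨by simp [γ, div_self hr.ne'], ?_⟩
    rw [← sq_le_sq₀ (abs_nonneg _) hε.le, sq_abs]
    simp only [γ, pt_fst]
    linarith
  refine ⟨hlt, ?_⟩
  have hsa : a < s := by
    rcases le_or_gt 0 s with h' | h'
    · exact h0a.1.trans_le h'
    · exact (ha s hlt).2 ((hball s).1 (hs h'))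
  exact h.unique (isOpen_compl_axisSegment n ε₀) hX.contDiffOn_one
    ⟨γ, a, r, h0a, ⟨hsa, hlt⟩, hγ0, rfl, hcurve⟩

end IsTransverseField

end ExplicitFlow

/-! ### Coordinates along the orbits starting on the reference hypersurface -/

lemma three_le_smooth : (3 : WithTop ℕ∞) ≤ ∞ :=
  WithTop.coe_le_coe.2 (le_top : (3 : ℕ∞) ≤ ⊤)

section Reference

variable {n : ℕ} {b₀ : ℝ} {u₀ : ℝ → ℝ} {ε₀ ε₁ : ℝ} {X : Amb n → Amb n} {S : Set (Amb n)}
  {ρ c d δ : ℝ}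

namespace IsReferenceHypersurface

lemma notMem_axisSegment (hS : IsReferenceHypersurface b₀ u₀ ε₀ ε₁ X S ρ c d δ) {P : Amb n}
    (hP : P ∈ S) : P ∉ axisSegment n ε₀ := by
  obtain ⟨Q, hQ, γ, h0, h1, -⟩ := hS.flow P hP 0 ⟨by linarith [hS.δ_pos], hS.δ_pos⟩ hS.ρ_pos
  rwa [← h0, h1]

lemma right_mem (hS : IsReferenceHypersurface b₀ u₀ ε₀ ε₁ X S ρ c d δ)
    {y : EuclideanSpace ℝ (Fin n)} (hy : ‖y‖ ≤ ρ) : pt c y ∈ S :=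
  (hS.inner_part (pt c y) hy).2 (Or.inl (Or.inl ⟨rfl, hy⟩))

lemma left_mem (hS : IsReferenceHypersurface b₀ u₀ ε₀ ε₁ X S ρ c d δ)
    {y : EuclideanSpace ℝ (Fin n)} (hy : ‖y‖ ≤ ρ) : pt (-c) y ∈ S :=
  (hS.inner_part (pt (-c) y) hy).2 (Or.inl (Or.inr ⟨rfl, hy⟩))

lemma right_flow (hn : 2 ≤ n) (hX : IsTransverseField b₀ u₀ ε₀ ε₁ X)
    (hS : IsReferenceHypersurface b₀ u₀ ε₀ ε₁ X S ρ c d δ)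
    {y : EuclideanSpace ℝ (Fin n)} (hy : ‖y‖ ≤ ρ) {s : ℝ} (hs : s ∈ Ioo (-δ) δ) :
    Reaches X (axisSegment n ε₀)ᶜ (pt c y) s (pt (c - s) y) := by
  have := Reaches.of_curve (X := X) (U := (axisSegment n ε₀)ᶜ) (γ := fun τ => pt (c - τ) y)
    (fun τ hτ => ?_) hs
  · simpa using this
  · have hb : pt (c - τ) y ∈ _ := hS.right_disc (pt c y) ⟨rfl, hy⟩ τ hτ
    refine ⟨hX.notMem_axisSegment_of_mem_right hn hb, ?_⟩
    rw [hX.near_right _ hb]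
    exact hasDerivAt_pt ((hasDerivAt_id τ).const_sub c) (hasDerivAt_const τ y)

lemma left_flow (hn : 2 ≤ n) (hX : IsTransverseField b₀ u₀ ε₀ ε₁ X)
    (hS : IsReferenceHypersurface b₀ u₀ ε₀ ε₁ X S ρ c d δ)
    {y : EuclideanSpace ℝ (Fin n)} (hy : ‖y‖ ≤ ρ) {s : ℝ} (hs : s ∈ Ioo (-δ) δ) :
    Reaches X (axisSegment n ε₀)ᶜ (pt (-c) y) s (pt (-c + s) y) := by
  have := Reaches.of_curve (X := X) (U := (axisSegment n ε₀)ᶜ) (γ := fun τ => pt (-c + τ) y)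
    (fun τ hτ => ?_) hs
  · simpa using this
  · have hb : pt (-c + τ) y ∈ _ := hS.left_disc (pt (-c) y) ⟨rfl, hy⟩ τ hτ
    refine ⟨hX.notMem_axisSegment_of_mem_left hn hb, ?_⟩
    rw [hX.near_left _ hb]
    exact hasDerivAt_pt ((hasDerivAt_id τ).const_add (-c)) (hasDerivAt_const τ y)

/-- A defining function of the reference hypersurface whose differential is non-zero on `X`. By the
Lagrange multiplier theorem all functions that vanish on a hypersurface have proportional
differentials. -/
lemma exists_defining_function (hS : IsReferenceHypersurface b₀ u₀ ε₀ ε₁ X S ρ c d δ) {P : Amb n}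
    (hP : P ∈ S) : ∃ f : Amb n → ℝ, ContDiffAt ℝ ∞ f P ∧ f P = 0 ∧ fderiv ℝ f P (X P) ≠ 0 ∧
      ∀ᶠ Q in 𝓝 P, Q ∈ S ↔ f Q = 0 := by
  obtain ⟨N, hN, hPN, f, hf, hne, hiff⟩ := hS.hypersurface P hP
  have hfP : f P = 0 := (hiff P hPN).1 hP
  have hfc : ContDiffAt ℝ ∞ f P := hf.contDiffAt (hN.mem_nhds hPN)
  refine ⟨f, hfc, hfP, fun h0 => ?_, ?_⟩
  · refine hS.transverse P hP fun g hg hgz => ?_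
    have hloc : IsLocalExtrOn g {x | f x = f P} P := by
      have hg0 : g P = 0 := hgz.self_of_nhdsWithin hP
      refine Or.inl ?_
      have h1 := eventually_nhdsWithin_iff.1 hgz
      refine eventually_nhdsWithin_iff.2 ?_
      filter_upwards [h1, hN.mem_nhds hPN] with Q hQ hQN hQf
      rw [hg0, hQ ((hiff Q hQN).2 (by rw [← hfP]; exact hQf))]
    obtain ⟨a, b, hab, e⟩ := hloc.exists_multipliers_of_hasStrictFDerivAt_1d
      (hfc.hasStrictFDerivAt (by simp)) (hg.hasStrictFDerivAt (by simp))
    have hb : b ≠ 0 := by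
      rintro rfl
      rw [zero_smul, add_zero] at e
      rcases smul_eq_zero.1 e with rfl | h
      · exact hab rfl
      · exact hne h
    have h2 := DFunLike.congr_fun e (X P)
    simp only [add_apply, smul_apply, h0, smul_eq_mul, zero_apply, mul_zero,
      zero_add] at h2
    exact (mul_eq_zero.1 h2).resolve_left hb
  · filter_upwards [hN.mem_nhds hPN] with Q hQ using hiff Q hQ

end IsReferenceHypersurface

/-- Coordinates `(π, τ)` on an open set `V`: the point of `S` on the orbit of a point of `V`, and
the time that passed since; `η` bounds the times for which the compatibility with the flow is
recorded. -/
structure IsFlowBox (X : Amb n → Amb n) (Z S : Set (Amb n)) (δ : ℝ) (V : Set (Amb n))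
    (τ : Amb n → ℝ) (π : Amb n → Amb n) (η : ℝ) : Prop where
  isOpen : IsOpen V
  smooth_time : ContDiffOn ℝ 3 τ V
  smooth_proj : ContDiffOn ℝ 3 π V
  η_pos : 0 < η
  proj_mem : ∀ Q ∈ V, π Q ∈ S
  time_mem : ∀ Q ∈ V, τ Q ∈ Ioo (-δ) δ
  reaches : ∀ Q ∈ V, Reaches X Zᶜ (π Q) (τ Q) Q
  shift : ∀ Q ∈ V, ∀ r, |r| < η → ∀ Q', Reaches X Zᶜ Q r Q' → τ Q' = τ Q + r ∧ π Q' = π Q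

lemma IsReferenceHypersurface.exists_flowBox (hX : IsTransverseField b₀ u₀ ε₀ ε₁ X)
    (hS : IsReferenceHypersurface b₀ u₀ ε₀ ε₁ X S ρ c d δ) {P Q : Amb n} {s : ℝ} (hP : P ∈ S)
    (hs : s ∈ Ioo (-δ) δ) (h : Reaches X (axisSegment n ε₀)ᶜ P s Q) {V₀ : Set (Amb n)}
    (hV₀ : V₀ ∈ 𝓝 Q) :
    ∃ V τ π η, IsFlowBox X (axisSegment n ε₀) S δ V τ π η ∧ Q ∈ V ∧ V ⊆ V₀ ∧
      ∀ᶠ p in 𝓝 (P, s), p.1 ∈ S → ∀ Q', Reaches X (axisSegment n ε₀)ᶜ p.1 p.2 Q' →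
        Q' ∈ V ∧ τ Q' = p.2 ∧ π Q' = p.1 := by
  have hU := isOpen_compl_axisSegment n ε₀
  obtain ⟨f, hf, hf0, hfX, hfS⟩ := hS.exists_defining_function hP
  obtain ⟨τ, π, hτ, hπ, hτ0, hπ0, hr, hconv⟩ := h.exists_flowBox hU hX.smooth hf hf0 hfX
  obtain ⟨Φ, hΦ, hΦ0, hΦr⟩ := h.exists_smooth_flow_hasDerivAt hU hX.smooth
  obtain ⟨η, hη, hηconv⟩ := Metric.eventually_nhds_iff.1 hconv
  have hπt : Tendsto π (𝓝 Q) (𝓝 P) := by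
    have := hπ.continuousAt.tendsto
    rwa [hπ0] at this
  have hτt : Tendsto τ (𝓝 Q) (𝓝 s) := by
    have := hτ.continuousAt.tendsto
    rwa [hτ0] at this
  have hsm : ∀ᶠ Q' in 𝓝 Q, ContDiffAt ℝ 3 τ Q' ∧ ContDiffAt ℝ 3 π Q' :=
    ((hτ.of_le three_le_smooth).eventually (by simp)).and
      ((hπ.of_le three_le_smooth).eventually (by simp))
  have hgood : ∀ᶠ Q' in 𝓝 Q, Q' ∈ V₀ ∧ ContDiffAt ℝ 3 τ Q' ∧ ContDiffAt ℝ 3 π Q' ∧ π Q' ∈ S ∧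
      τ Q' ∈ Ioo (-δ) δ ∧ Reaches X (axisSegment n ε₀)ᶜ (π Q') (τ Q') Q' ∧ f (π Q') = 0 ∧
      dist (π Q') P < η ∧ dist (τ Q') s < η / 2 := by
    filter_upwards [hV₀, hsm, hr, hπt.eventually hfS, hτt.eventually (Ioo_mem_nhds hs.1 hs.2),
      hπt.eventually (Metric.ball_mem_nhds P hη),
      hτt.eventually (Metric.ball_mem_nhds s (half_pos hη))] with Q' h1 h2 h3 h4 h5 h6 h7
    exact ⟨h1, h2.1, h2.2, h4.2 h3.2, h5, h3.1, h3.2, h6, h7⟩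
  obtain ⟨V, hVsub, hV, hQV⟩ := eventually_nhds_iff.1 hgood
  refine ⟨V, τ, π, η / 2, ⟨hV, fun Q' hQ' => (hVsub Q' hQ').2.1.contDiffWithinAt,
    fun Q' hQ' => (hVsub Q' hQ').2.2.1.contDiffWithinAt, half_pos hη,
    fun Q' hQ' => (hVsub Q' hQ').2.2.2.1, fun Q' hQ' => (hVsub Q' hQ').2.2.2.2.1,
    fun Q' hQ' => (hVsub Q' hQ').2.2.2.2.2.1, ?_⟩, hQV, fun Q' hQ' => (hVsub Q' hQ').1, ?_⟩
  · intro Q' hQ' r hrη Q'' hQ''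
    obtain ⟨-, -, -, -, -, h1, h2, h3, h4⟩ := hVsub Q' hQ'
    refine hηconv (y := (π Q', τ Q' + r)) ?_ h2 Q'' (h1.trans hU hX.contDiffOn_one hQ'')
    rw [Prod.dist_eq, max_lt_iff]
    refine ⟨h3, ?_⟩
    rw [Real.dist_eq] at h4 ⊢
    have := abs_add_le (τ Q' - s) r
    have e : τ Q' + r - s = (τ Q' - s) + r := by ring
    rw [e]
    linarith
  · have hΦt : Tendsto Φ (𝓝 (P, s)) (𝓝 Q) := by
      have := hΦ.continuousAt.tendsto
      rwa [hΦ0] at this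
    filter_upwards [hfS.prod_inl_nhds s, hconv, hΦr, hΦt.eventually (hV.mem_nhds hQV)]
      with p h1 h2 h3 h4 hpS Q' hQ'
    have e : Φ p = Q' := h3.1.unique hU hX.contDiffOn_one hQ'
    rw [e] at h4
    exact ⟨h4, h2 (h1.1 hpS) Q' hQ'⟩

end Reference

/-! ### Admissible families -/

section Family

variable {n : ℕ} {b₀ : ℝ} {u₀ : ℝ → ℝ} {ε₀ ε₁ : ℝ} {X : Amb n → Amb n} {S : Set (Amb n)}
  {ρ c d δ T : ℝ} {α : ℝ → ℝ} {Γ D : ℝ → Set (Amb n)} {u : Amb n → ℝ → ℝ} {t : ℝ}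

open scoped InnerProductSpace

namespace IsAdmissibleFamily

lemma right_cap (hn : 2 ≤ n) (hX : IsTransverseField b₀ u₀ ε₀ ε₁ X)
    (hS : IsReferenceHypersurface b₀ u₀ ε₀ ε₁ X S ρ c d δ)
    (h : IsAdmissibleFamily ε₀ X S ρ c d δ T α Γ D u) (ht : t ∈ Icc 0 T)
    {y : EuclideanSpace ℝ (Fin n)} (hy : ‖y‖ ≤ ρ) :
    pt (c - u (pt c y) t) y ∈ Γ t ∧
      pt (c - u (pt c y) t) y ∈ Metric.ball (pt b₀ 0 : Amb n) ε₁ ∧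
      Reaches X (axisSegment n ε₀)ᶜ (pt c y) (u (pt c y) t) (pt (c - u (pt c y) t) y) := by
  obtain ⟨hu, Q, hQ, hf⟩ := (h.graph t ht).1 _ (hS.right_mem hy)
  have hr := hS.right_flow hn hX hy hu
  rw [hf.eq_of_reaches (isClosed_axisSegment n ε₀) hX.contDiffOn_one hr] at hQ
  exact ⟨hQ, hS.right_disc (pt c y) ⟨rfl, hy⟩ _ hu, hr⟩

lemma left_cap (hn : 2 ≤ n) (hX : IsTransverseField b₀ u₀ ε₀ ε₁ X)
    (hS : IsReferenceHypersurface b₀ u₀ ε₀ ε₁ X S ρ c d δ)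
    (h : IsAdmissibleFamily ε₀ X S ρ c d δ T α Γ D u) (ht : t ∈ Icc 0 T)
    {y : EuclideanSpace ℝ (Fin n)} (hy : ‖y‖ ≤ ρ) :
    pt (-c + u (pt (-c) y) t) y ∈ Γ t ∧
      pt (-c + u (pt (-c) y) t) y ∈ Metric.ball (pt (-b₀) 0 : Amb n) ε₁ ∧
      Reaches X (axisSegment n ε₀)ᶜ (pt (-c) y) (u (pt (-c) y) t)
        (pt (-c + u (pt (-c) y) t) y) := by
  obtain ⟨hu, Q, hQ, hf⟩ := (h.graph t ht).1 _ (hS.left_mem hy)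
  have hr := hS.left_flow hn hX hy hu
  rw [hf.eq_of_reaches (isClosed_axisSegment n ε₀) hX.contDiffOn_one hr] at hQ
  exact ⟨hQ, hS.left_disc (pt (-c) y) ⟨rfl, hy⟩ _ hu, hr⟩

/-- The radial profile of the enclosed domain. The domain meets the axis in an interval whose end
points are the tips of the two caps. -/
lemma exists_profile (hn : 2 ≤ n) (hu₀ : IsInitialProfile n b₀ u₀)
    (hX : IsTransverseField b₀ u₀ ε₀ ε₁ X)
    (hS : IsReferenceHypersurface b₀ u₀ ε₀ ε₁ X S ρ c d δ)
    (h : IsAdmissibleFamily ε₀ X S ρ c d δ T α Γ D u) (ht : t ∈ Ioc 0 T) :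
    ∃ (k : ℝ → ℝ) (a₁ a₂ : ℝ), D t = {P | ‖P.snd‖ < k P.fst} ∧ {x | 0 < k x} = Ioo a₁ a₂ ∧
      a₁ < a₂ ∧ ContDiffOn ℝ ∞ k (Ioo a₁ a₂) ∧
      pt a₁ 0 ∈ Metric.ball (pt (-b₀) 0 : Amb n) ε₁ ∧
      pt a₂ 0 ∈ Metric.ball (pt b₀ 0 : Amb n) ε₁ ∧ a₂ = c - u (pt c 0) t ∧
      (∀ P ∈ Γ t, P.fst ∈ Icc a₁ a₂) ∧ ∀ x, pt x 0 ∈ Γ t → x = a₁ ∨ x = a₂ := by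
  have ht' : t ∈ Icc 0 T := ⟨ht.1.le, ht.2⟩
  obtain ⟨hopen, k, hD, ⟨a₁, a₂, ha, hk⟩, hsm, -⟩ := h.alphaDomain t ht
  rw [hk] at hsm
  have hpos : ∀ P ∈ D t, P.fst ∈ Ioo a₁ a₂ := fun P hP => by
    rw [hD] at hP
    rw [← hk]
    exact (norm_nonneg _).trans_lt hP
  have hfst : ∀ P ∈ Γ t, P.fst ∈ Icc a₁ a₂ := fun P hP => by
    rw [← h.boundary t ht] at hP
    have h1 : IsClosed {P : Amb n | P.fst ∈ Icc a₁ a₂} := isClosed_Icc.preimage (by fun_prop)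
    have h2 : D t ⊆ {P : Amb n | P.fst ∈ Icc a₁ a₂} := fun P hP =>
      Ioo_subset_Icc_self (hpos P hP)
    exact closure_minimal h2 h1 (frontier_subset_closure hP)
  have haxis : ∀ x, pt x 0 ∈ Γ t → x = a₁ ∨ x = a₂ := fun x hx => by
    have h1 := hfst _ hx
    rw [← h.boundary t ht, hopen.frontier_eq] at hx
    have h2 : ¬ 0 < k x := fun h0 => hx.2 (by rw [hD]; simpa using h0)
    by_contra! hcon
    have : x ∈ {x | 0 < k x} := by
      rw [hk]
      exact ⟨lt_of_le_of_ne h1.1 hcon.1.symm, lt_of_le_of_ne h1.2 hcon.2⟩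
    exact h2 this
  have h0 : ‖(0 : EuclideanSpace ℝ (Fin n))‖ ≤ ρ := by simpa using hS.ρ_pos.le
  obtain ⟨hr1, hr2, -⟩ := h.right_cap hn hX hS ht' h0
  obtain ⟨hl1, hl2, -⟩ := h.left_cap hn hX hS ht' h0
  set xr := c - u (pt c 0) t with hxr
  set xl := -c + u (pt (-c) 0) t with hxl
  have hdist : ∀ x z : ℝ, dist (pt x 0 : Amb n) (pt z 0) = |x - z| := fun x z => by
    rw [show (pt x 0 : Amb n) = WithLp.toLp 2 (x, 0) from rfl,
      show (pt z 0 : Amb n) = WithLp.toLp 2 (z, 0) from rfl, WithLp.dist_toLp_fst, Real.dist_eq]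
  have hlt : xl < xr := by
    have hb := hu₀.b₀_pos
    rw [Metric.mem_ball, hdist, abs_lt] at hr2 hl2
    have : ε₁ ≤ b₀ := by
      by_contra! hlt
      have hdis := Set.disjoint_left.1 (hX.disjoint_balls hn).2.2
      refine hdis (a := (pt 0 0 : Amb n)) ?_ ?_
      · rw [Metric.mem_ball, hdist, zero_sub, abs_neg, abs_of_pos hb]; exact hlt
      · rw [Metric.mem_ball, hdist, zero_sub, neg_neg, abs_of_pos hb]; exact hlt
    linarith [hr2.1, hl2.2]
  have e1 : xl = a₁ ∧ xr = a₂ := by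
    rcases haxis _ hr1 with e | e <;> rcases haxis _ hl1 with e' | e'
    · linarith
    · linarith
    · exact ⟨e', e⟩
    · linarith
  exact ⟨k, a₁, a₂, hD, hk, ha, hsm, e1.1 ▸ hl2, e1.2 ▸ hr2, e1.2.symm, hfst, haxis⟩

lemma notMem_axisSegment (hn : 2 ≤ n) (hu₀ : IsInitialProfile n b₀ u₀)
    (hX : IsTransverseField b₀ u₀ ε₀ ε₁ X)
    (hS : IsReferenceHypersurface b₀ u₀ ε₀ ε₁ X S ρ c d δ)
    (h : IsAdmissibleFamily ε₀ X S ρ c d δ T α Γ D u) (ht : t ∈ Ioc 0 T) {Q : Amb n}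
    (hQ : Q ∈ Γ t) : Q ∉ axisSegment n ε₀ := by
  obtain ⟨k, a₁, a₂, -, -, -, -, h1, h2, -, -, hax⟩ := h.exists_profile hn hu₀ hX hS ht
  intro hZ
  have e : Q = pt Q.fst 0 := Amb.ext rfl hZ.1
  rw [e] at hQ hZ
  rcases hax _ hQ with e' | e' <;> rw [e'] at hZ
  · exact hX.notMem_axisSegment_of_mem_left hn h1 hZ
  · exact hX.notMem_axisSegment_of_mem_right hn h2 hZ

lemma mem_Ioo (h : IsAdmissibleFamily ε₀ X S ρ c d δ T α Γ D u) (ht : t ∈ Icc 0 T) {P : Amb n}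
    (hP : P ∈ S) : u P t ∈ Ioo (-δ) δ := ((h.graph t ht).1 P hP).1

lemma exists_reaches (hn : 2 ≤ n) (hu₀ : IsInitialProfile n b₀ u₀)
    (hX : IsTransverseField b₀ u₀ ε₀ ε₁ X)
    (hS : IsReferenceHypersurface b₀ u₀ ε₀ ε₁ X S ρ c d δ)
    (h : IsAdmissibleFamily ε₀ X S ρ c d δ T α Γ D u) (ht : t ∈ Ioc 0 T) {P : Amb n} (hP : P ∈ S) :
    ∃ Q ∈ Γ t, Reaches X (axisSegment n ε₀)ᶜ P (u P t) Q := by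
  obtain ⟨-, Q, hQ, hf⟩ := (h.graph t ⟨ht.1.le, ht.2⟩).1 P hP
  exact ⟨Q, hQ, hf.reaches (isClosed_axisSegment n ε₀) hX.contDiffOn_one
    (hS.notMem_axisSegment hP) (h.notMem_axisSegment hn hu₀ hX hS ht hQ)⟩

lemma exists_reaches_to (hn : 2 ≤ n) (hu₀ : IsInitialProfile n b₀ u₀)
    (hX : IsTransverseField b₀ u₀ ε₀ ε₁ X)
    (hS : IsReferenceHypersurface b₀ u₀ ε₀ ε₁ X S ρ c d δ)
    (h : IsAdmissibleFamily ε₀ X S ρ c d δ T α Γ D u) (ht : t ∈ Ioc 0 T) {Q : Amb n}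
    (hQ : Q ∈ Γ t) : ∃ P ∈ S, Reaches X (axisSegment n ε₀)ᶜ P (u P t) Q := by
  obtain ⟨P, hP, hf⟩ := (h.graph t ⟨ht.1.le, ht.2⟩).2.2 Q hQ
  exact ⟨P, hP, hf.reaches (isClosed_axisSegment n ε₀) hX.contDiffOn_one
    (hS.notMem_axisSegment hP) (h.notMem_axisSegment hn hu₀ hX hS ht hQ)⟩

lemma mem_of_reaches (hX : IsTransverseField b₀ u₀ ε₀ ε₁ X)
    (h : IsAdmissibleFamily ε₀ X S ρ c d δ T α Γ D u) (ht : t ∈ Icc 0 T) {P Q : Amb n} (hP : P ∈ S)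
    (hr : Reaches X (axisSegment n ε₀)ᶜ P (u P t) Q) : Q ∈ Γ t := by
  obtain ⟨-, Q', hQ', hf⟩ := (h.graph t ht).1 P hP
  rwa [← hf.eq_of_reaches (isClosed_axisSegment n ε₀) hX.contDiffOn_one hr]

lemma time_eq (h : IsAdmissibleFamily ε₀ X S ρ c d δ T α Γ D u) (ht : t ∈ Icc 0 T) {P Q : Amb n}
    (hP : P ∈ S) {s : ℝ} (hs : s ∈ Ioo (-δ) δ) (hQ : Q ∈ Γ t)
    (hr : Reaches X (axisSegment n ε₀)ᶜ P s Q) : s = u P t :=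
  (h.graph t ht).2.1 P hP s hs Q hQ hr.flowsTo

end IsAdmissibleFamily

/-! ### Defining functions in flow box coordinates -/

/-- In flow box coordinates `Γ t` is the zero set of `τ - u(π, t)`. -/
def boxFunction (τ : Amb n → ℝ) (π : Amb n → Amb n) (u : Amb n → ℝ → ℝ) (t : ℝ) (Q : Amb n) : ℝ :=
  τ Q - u (π Q) t

namespace IsFlowBox

variable {V : Set (Amb n)} {τ : Amb n → ℝ} {π : Amb n → Amb n} {η : ℝ}

lemma boxFunction_eq_zero_iff (hX : IsTransverseField b₀ u₀ ε₀ ε₁ X)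
    (h : IsAdmissibleFamily ε₀ X S ρ c d δ T α Γ D u)
    (hB : IsFlowBox X (axisSegment n ε₀) S δ V τ π η) (ht : t ∈ Icc 0 T) {Q : Amb n} (hQ : Q ∈ V) :
    boxFunction τ π u t Q = 0 ↔ Q ∈ Γ t := by
  rw [boxFunction, sub_eq_zero]
  constructor
  · intro e
    have := hB.reaches Q hQ
    rw [e] at this
    exact h.mem_of_reaches hX ht (hB.proj_mem Q hQ) this
  · intro hQΓ
    exact h.time_eq ht (hB.proj_mem Q hQ) (hB.time_mem Q hQ) hQΓ (hB.reaches Q hQ)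

lemma contDiffOn_boxFunction (h : IsAdmissibleFamily ε₀ X S ρ c d δ T α Γ D u)
    (hB : IsFlowBox X (axisSegment n ε₀) S δ V τ π η) (ht : t ∈ Ioc 0 T) :
    ContDiffOn ℝ 3 (boxFunction τ π u t) V := by
  refine hB.smooth_time.sub ?_
  exact ContDiffOn.comp (g := Function.uncurry u) (f := fun Q => (π Q, t))
    (h.smooth.of_le three_le_smooth) (hB.smooth_proj.prodMk contDiffOn_const)
    fun Q hQ => ⟨hB.proj_mem Q hQ, ht⟩

lemma boxFunction_shift (hB : IsFlowBox X (axisSegment n ε₀) S δ V τ π η) {Q Q' : Amb n}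
    (hQ : Q ∈ V) {r : ℝ} (hr : |r| < η) (h : Reaches X (axisSegment n ε₀)ᶜ Q r Q') :
    boxFunction τ π u t Q' = boxFunction τ π u t Q + r := by
  obtain ⟨e1, e2⟩ := hB.shift Q hQ r hr Q' h
  rw [boxFunction, boxFunction, e1, e2]
  ring

/-- The defining function grows at unit speed along `X`. -/
lemma inner_gradient_boxFunction (hX : IsTransverseField b₀ u₀ ε₀ ε₁ X)
    (hB : IsFlowBox X (axisSegment n ε₀) S δ V τ π η) {Q : Amb n} (hQ : Q ∈ V)
    (hd : DifferentiableAt ℝ (boxFunction τ π u t) Q) :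
    ⟪gradient (boxFunction τ π u t) Q, X Q⟫_ℝ = 1 := by
  obtain ⟨γ, ε, hε, rfl, hγ⟩ := Reaches.exists_curve (isOpen_compl_axisSegment n ε₀)
    hX.contDiffOn_one (hB.reaches Q hQ).right_mem
  have h1 := hd.hasFDerivAt.comp_hasDerivAt (0 : ℝ) (hγ 0 ⟨by linarith, hε⟩).2
  have h2 : HasDerivAt (boxFunction τ π u t ∘ γ) 1 0 := by
    refine ((hasDerivAt_id (0 : ℝ)).const_add (boxFunction τ π u t (γ 0))).congr_of_eventuallyEq ?_
    filter_upwards [Ioo_mem_nhds (neg_lt_zero.2 hε) hε,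
      Ioo_mem_nhds (neg_lt_zero.2 hB.η_pos) hB.η_pos] with r hr hr'
    exact hB.boxFunction_shift hQ (abs_lt.2 hr') (Reaches.of_curve hγ hr)
  rw [inner_gradient_left]
  exact h1.unique h2

lemma contDiffAt_boxFunction (h : IsAdmissibleFamily ε₀ X S ρ c d δ T α Γ D u)
    (hB : IsFlowBox X (axisSegment n ε₀) S δ V τ π η) (ht : t ∈ Ioc 0 T) {Q : Amb n} (hQ : Q ∈ V) :
    ContDiffAt ℝ 2 (boxFunction τ π u t) Q :=
  ((hB.contDiffOn_boxFunction h ht).contDiffAt (hB.isOpen.mem_nhds hQ)).of_le (by norm_num)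

end IsFlowBox

end Family

/-! ### The law of motion of the graph function -/

section Motion

variable {n : ℕ} {b₀ : ℝ} {u₀ : ℝ → ℝ} {ε₀ ε₁ : ℝ} {X : Amb n → Amb n} {S : Set (Amb n)}
  {ρ c d δ A T : ℝ} {α : ℝ → ℝ} {Γ D : ℝ → Set (Amb n)} {u : Amb n → ℝ → ℝ} {t : ℝ}

open scoped InnerProductSpace

lemma eventually_pos_of_inner_gradient_pos {E : Type*} [NormedAddCommGroup E]
    [InnerProductSpace ℝ E] [CompleteSpace E] {ψ : E → ℝ} {Q v : E} (h : DifferentiableAt ℝ ψ Q)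
    (h0 : ψ Q = 0) (hpos : 0 < ⟪gradient ψ Q, v⟫_ℝ) :
    ∀ᶠ ε in 𝓝[>] (0 : ℝ), 0 < ψ (Q + ε • v) := by
  have h1 : HasDerivAt (fun r : ℝ => Q + r • v) v 0 := by
    simpa using ((hasDerivAt_id (0 : ℝ)).smul_const v).const_add Q
  have h2 : HasFDerivAt ψ (fderiv ℝ ψ Q) (Q + (0 : ℝ) • v) := by simpa using h.hasFDerivAt
  have h3 := h2.comp_hasDerivAt (0 : ℝ) h1
  rw [← inner_gradient_left] at h3
  have h4 := (hasDerivAt_iff_tendsto_slope.1 h3).eventually (lt_mem_nhds hpos)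
  have h5 : 𝓝[>] (0 : ℝ) ≤ 𝓝[≠] 0 := nhdsWithin_mono _ fun x hx => ne_of_gt hx
  filter_upwards [h5 h4, self_mem_nhdsWithin] with ε hε hε0
  rw [slope_def_field] at hε
  simp only [Function.comp, zero_smul, add_zero, h0, sub_zero] at hε
  exact (div_pos_iff_of_pos_right hε0).1 hε

/-- Short segments in the direction of `X` starting at `Q` enter `W`. -/
def EntersAlong (X : Amb n → Amb n) (W : Set (Amb n)) (Q : Amb n) : Prop :=
  ∀ᶠ ε in 𝓝[>] (0 : ℝ), Q + ε • X Q ∈ W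

namespace EvolvesByForcedMCF

lemma eventually_entersAlong (hE : EvolvesByForcedMCF A T Γ D) (ht : t ∈ Ioo 0 T) {Q : Amb n}
    (hQ : Q ∈ Γ t) (hXQ : ContinuousAt X Q) {g : Amb n → ℝ} (hg : ContDiffAt ℝ 2 g Q)
    (hz : ∀ᶠ Q' in 𝓝 Q, Q' ∈ Γ t → g Q' = 0) (hgX : ⟪gradient g Q, X Q⟫_ℝ = 1) :
    (∀ᶠ Q' in 𝓝 Q, Q' ∈ Γ t → EntersAlong X (D t) Q') ∨
      ∀ᶠ Q' in 𝓝 Q, Q' ∈ Γ t → ¬ EntersAlong X (D t) Q' := by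
  obtain ⟨N, hN, hQN, ψ, -, hne, hiff, hsl, -⟩ := hE.exists_levelSet ht hQ
  have hsl2 : ContDiffAt ℝ 2 (fun Q' => ψ Q' t) Q := hsl.of_le two_le_smooth
  have hNt : ∀ᶠ Q' in 𝓝 Q, (Q', t) ∈ N :=
    (Continuous.prodMk_left t).continuousAt.eventually (hN.mem_nhds hQN)
  obtain ⟨k, hk, -⟩ := levelSetOp_of_vanishing A hg hsl2 ((hiff _ hQN).1.1 hQ) hne (by
    filter_upwards [hz, hNt] with Q' h1 h2 h3
    exact h1 ((hiff _ h2).1.2 h3))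
  have hnz : ⟪gradient (fun Q' => ψ Q' t) Q, X Q⟫_ℝ ≠ 0 := by
    intro h0
    rw [hk, inner_smul_left, h0, mul_zero] at hgX
    exact zero_ne_one hgX
  have hcont : ContinuousAt (fun Q' => ⟪gradient (fun Q' => ψ Q' t) Q', X Q'⟫_ℝ) Q :=
    (hsl2.gradient (m := 1) (by norm_num)).continuousAt.inner hXQ
  have hev : ∀ᶠ Q' in 𝓝 Q, (∀ᶠ Q'' in 𝓝 Q', (Q'', t) ∈ N) ∧
      DifferentiableAt ℝ (fun Q' => ψ Q' t) Q' :=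
    (eventually_eventually_nhds.2 hNt).and hsl2.eventually_differentiableAt
  have hray : ∀ {Q' : Amb n}, (∀ᶠ Q'' in 𝓝 Q', (Q'', t) ∈ N) →
      ∀ᶠ ε in 𝓝[>] (0 : ℝ), (Q' + ε • X Q', t) ∈ N := fun {Q'} h => by
    have : Tendsto (fun ε : ℝ => Q' + ε • X Q') (𝓝[>] 0) (𝓝 Q') := by
      have : Continuous fun ε : ℝ => Q' + ε • X Q' := by fun_prop
      have := (this.tendsto 0).mono_left (nhdsWithin_le_nhds (s := Ioi 0))
      simpa using this
    exact this.eventually h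
  rcases lt_or_gt_of_ne hnz with hlt | hgt
  · right
    filter_upwards [hev, hcont.eventually (gt_mem_nhds hlt)] with Q' h1 h2 hQ' hent
    have h3 := eventually_pos_of_inner_gradient_pos (ψ := fun Q' => -ψ Q' t) (Q := Q') (v := X Q')
      h1.2.neg (by simpa using (hiff (Q', t) h1.1.self_of_nhds).1.1 hQ') (by
        rw [inner_gradient_left]
        rw [inner_gradient_left] at h2
        rw [fderiv_fun_neg]
        simpa using h2)
    obtain ⟨ε, h4, h5, h6⟩ := (h3.and ((hray h1.1).and hent)).exists
    have := (hiff _ h5).2.1 h6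
    simp only at this h4
    linarith
  · left
    filter_upwards [hev, hcont.eventually (lt_mem_nhds hgt)] with Q' h1 h2 hQ'
    have h3 := eventually_pos_of_inner_gradient_pos (ψ := fun Q' => ψ Q' t) (Q := Q') (v := X Q')
      h1.2 ((hiff (Q', t) h1.1.self_of_nhds).1.1 hQ') h2
    filter_upwards [h3, hray h1.1] with ε h4 h5
    exact (hiff _ h5).2.2 h4

end EvolvesByForcedMCF

namespace IsAdmissibleFamily

lemma continuousOn_slice (h : IsAdmissibleFamily ε₀ X S ρ c d δ T α Γ D u) (ht : t ∈ Icc 0 T) :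
    ContinuousOn (fun P => u P t) S :=
  ContinuousOn.comp (g := Function.uncurry u) (f := fun P => (P, t)) h.continuousOn
    (Continuous.prodMk_left t).continuousOn fun _ hP => ⟨hP, ht⟩

/-- `X` points into the enclosed domain along the whole hypersurface: it is nowhere tangential, the
hypersurface is connected, and at the tip of the right cap it points into the domain. -/
lemma entersAlong (hn : 2 ≤ n) (hu₀ : IsInitialProfile n b₀ u₀)
    (hX : IsTransverseField b₀ u₀ ε₀ ε₁ X)
    (hS : IsReferenceHypersurface b₀ u₀ ε₀ ε₁ X S ρ c d δ)
    (h : IsAdmissibleFamily ε₀ X S ρ c d δ T α Γ D u) (hE : EvolvesByForcedMCF A T Γ D)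
    (ht : t ∈ Ioo 0 T) {P Q : Amb n} (hP : P ∈ S)
    (hr : Reaches X (axisSegment n ε₀)ᶜ P (u P t) Q) : EntersAlong X (D t) Q := by
  have ht' : t ∈ Ioc 0 T := ⟨ht.1, ht.2.le⟩
  have ht'' : t ∈ Icc 0 T := ⟨ht.1.le, ht.2.le⟩
  have hU := isOpen_compl_axisSegment n ε₀
  let R : Amb n → Prop := fun P =>
    ∀ Q, Reaches X (axisSegment n ε₀)ᶜ P (u P t) Q → EntersAlong X (D t) Q
  have hloc : ∀ P ∈ S, ∀ᶠ P' in 𝓝[S] P, (R P ↔ R P') := by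
    intro P hP
    obtain ⟨Q, hQ, hr⟩ := h.exists_reaches hn hu₀ hX hS ht' hP
    have hu := h.mem_Ioo ht'' hP
    obtain ⟨V₁, τ₁, π₁, η₁, hB₁, hQ₁, -, -⟩ := hS.exists_flowBox hX hP hu hr univ_mem
    have hor := hE.eventually_entersAlong (X := X) ht hQ
      ((hX.smooth.contDiffAt (hU.mem_nhds hr.right_mem)).continuousAt)
      (g := boxFunction τ₁ π₁ u t)
      (hB₁.contDiffAt_boxFunction h ht' hQ₁)
      (by
        filter_upwards [hB₁.isOpen.mem_nhds hQ₁] with Q' hQ' hQ''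
        exact (hB₁.boxFunction_eq_zero_iff hX h ht'' hQ').2 hQ'')
      (hB₁.inner_gradient_boxFunction hX hQ₁
        ((hB₁.contDiffAt_boxFunction h ht' hQ₁).differentiableAt (by simp)))
    have hnear : ∀ V₀ ∈ 𝓝 Q, ∀ᶠ P' in 𝓝[S] P, ∃ Q' ∈ V₀ ∩ Γ t,
        Reaches X (axisSegment n ε₀)ᶜ P' (u P' t) Q' := by
      intro V₀ hV₀
      obtain ⟨V, τ, π, η, hB, hQV, hVV, hconv⟩ := hS.exists_flowBox hX hP hu hr hV₀
      have hlim : Tendsto (fun P' => (P', u P' t)) (𝓝[S] P) (𝓝 (P, u P t)) :=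
        (tendsto_id.mono_left nhdsWithin_le_nhds).prodMk_nhds (h.continuousOn_slice ht'' P hP)
      filter_upwards [hlim.eventually hconv, self_mem_nhdsWithin] with P' h1 hP'
      obtain ⟨Q', hQ', hr'⟩ := h.exists_reaches hn hu₀ hX hS ht' hP'
      exact ⟨Q', ⟨hVV (h1 hP' Q' hr').1, hQ'⟩, hr'⟩
    have hRiff : ∀ {P Q}, Reaches X (axisSegment n ε₀)ᶜ P (u P t) Q →
        (R P ↔ EntersAlong X (D t) Q) := fun hr =>
      ⟨fun h => h _ hr, fun h Q' hr' => by rwa [← hr.unique hU hX.contDiffOn_one hr']⟩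
    rcases hor with hor | hor
    · filter_upwards [hnear _ hor] with P' ⟨Q', ⟨h1, h2⟩, h3⟩
      rw [hRiff hr, hRiff h3]
      exact iff_of_true (hor.self_of_nhds hQ) (h1 h2)
    · filter_upwards [hnear _ hor] with P' ⟨Q', ⟨h1, h2⟩, h3⟩
      rw [hRiff hr, hRiff h3]
      exact iff_of_false (hor.self_of_nhds hQ) (h1 h2)
  have hall := hS.connected.isPreconnected.induction₂ (fun P P' => R P ↔ R P') hloc
    (fun _ _ _ _ _ _ h1 h2 => h1.trans h2) (fun _ _ _ _ h => h.symm)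
    (hS.right_mem (y := 0) (by simpa using hS.ρ_pos.le)) hP
  refine hall.1 ?_ Q hr
  intro Q' hQ'
  obtain ⟨k, a₁, a₂, hD, hk, ha, -, -, hb, hca, -⟩ := h.exists_profile hn hu₀ hX hS ht'
  have e := (h.right_cap hn hX hS ht'' (y := 0) (by simpa using hS.ρ_pos.le)).2.2.unique hU
    hX.contDiffOn_one hQ'
  rw [← hca] at e
  rw [← e, EntersAlong, hX.near_right _ hb]
  filter_upwards [Ioo_mem_nhdsGT (sub_pos.2 ha)] with ε hε
  have : pt a₂ 0 + ε • pt (-1) 0 = (pt (a₂ - ε) 0 : Amb n) := by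
    refine Amb.ext ?_ ?_
    · simp [pt, sub_eq_add_neg]
    · simp [pt]
  rw [this, hD]
  have hmem : a₂ - ε ∈ {x | 0 < k x} := by
    rw [hk]
    exact ⟨by linarith [hε.2], by linarith [hε.1]⟩
  simpa using hmem

lemma contDiffAt_time (h : IsAdmissibleFamily ε₀ X S ρ c d δ T α Γ D u) (ht : t ∈ Ioo 0 T)
    {P : Amb n} (hP : P ∈ S) : ContDiffAt ℝ ∞ (u P) t :=
  (ContDiffOn.comp (g := Function.uncurry u) (f := fun t => (P, t)) h.smooth
    (contDiff_prodMk_right P).contDiffOn fun _ ht' => ⟨hP, ht'⟩).contDiffAt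
    (Ioc_mem_nhds ht.1 ht.2)

/-- The law of motion: along an orbit of `X` the hypersurface recedes at the rate given by the
level set operator of any function that vanishes on it and grows at unit speed along `X`. -/
lemma hasDerivAt_time (hn : 2 ≤ n) (hu₀ : IsInitialProfile n b₀ u₀)
    (hX : IsTransverseField b₀ u₀ ε₀ ε₁ X)
    (hS : IsReferenceHypersurface b₀ u₀ ε₀ ε₁ X S ρ c d δ)
    (h : IsAdmissibleFamily ε₀ X S ρ c d δ T α Γ D u) (hE : EvolvesByForcedMCF A T Γ D)
    (ht : t ∈ Ioo 0 T) {P Q : Amb n} (hP : P ∈ S)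
    (hr : Reaches X (axisSegment n ε₀)ᶜ P (u P t) Q) {g : Amb n → ℝ} (hg : ContDiffAt ℝ 2 g Q)
    (hz : ∀ᶠ Q' in 𝓝 Q, Q' ∈ Γ t → g Q' = 0) (hgX : ⟪gradient g Q, X Q⟫_ℝ = 1) :
    HasDerivAt (u P) (-levelSetOp A (gradient g Q) (fderiv ℝ (gradient g) Q)) t := by
  have ht' : t ∈ Ioc 0 T := ⟨ht.1, ht.2.le⟩
  have ht'' : t ∈ Icc 0 T := ⟨ht.1.le, ht.2.le⟩
  have hU := isOpen_compl_axisSegment n ε₀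
  have hQ := h.mem_of_reaches hX ht'' hP hr
  obtain ⟨N, hN, hQN, ψ, hψ, hne, hiff, hsl, hV⟩ := hE.exists_levelSet ht hQ
  have hsl2 : ContDiffAt ℝ 2 (fun Q' => ψ Q' t) Q := hsl.of_le two_le_smooth
  have hNt : ∀ᶠ Q' in 𝓝 Q, (Q', t) ∈ N :=
    (Continuous.prodMk_left t).continuousAt.eventually (hN.mem_nhds hQN)
  obtain ⟨k, hk, hF⟩ := levelSetOp_of_vanishing A hg hsl2 ((hiff _ hQN).1.1 hQ) hne (by
    filter_upwards [hz, hNt] with Q' h1 h2 h3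
    exact h1 ((hiff _ h2).1.2 h3))
  set l := ⟪gradient (fun Q' => ψ Q' t) Q, X Q⟫_ℝ with hl
  have hkl : k * l = 1 := by
    rw [hk, inner_smul_left, ← hl] at hgX
    exact hgX
  have hk0 : 0 < k := by
    by_contra! hk0
    have hl0 : l < 0 := by
      by_contra! hl0
      linarith [mul_nonpos_of_nonpos_of_nonneg hk0 hl0]
    have h3 := eventually_pos_of_inner_gradient_pos (ψ := fun Q' => -ψ Q' t) (Q := Q) (v := X Q)
      (hsl2.differentiableAt (by simp)).neg (by simpa using (hiff (Q, t) hQN).1.1 hQ) (by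
        rw [inner_gradient_left, fderiv_fun_neg]
        rw [hl, inner_gradient_left] at hl0
        simpa using hl0)
    have hray : ∀ᶠ ε in 𝓝[>] (0 : ℝ), (Q + ε • X Q, t) ∈ N := by
      have : Continuous fun ε : ℝ => Q + ε • X Q := by fun_prop
      have := (this.tendsto 0).mono_left (nhdsWithin_le_nhds (s := Ioi 0))
      rw [zero_smul, add_zero] at this
      exact this.eventually hNt
    obtain ⟨ε, h4, h5, h6⟩ :=
      (h3.and (hray.and (h.entersAlong hn hu₀ hX hS hE ht hP hr))).exists
    have := (hiff _ h5).2.1 h6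
    simp only at this h4
    linarith
  obtain ⟨Φ, hΦ, hΦ0, hΦr⟩ := hr.exists_smooth_flow_hasDerivAt hU hX.smooth
  have hut : HasDerivAt (u P) (deriv (u P) t) t :=
    ((h.contDiffAt_time ht hP).differentiableAt (by simp)).hasDerivAt
  -- the moving point of the hypersurface on the orbit of `P`
  have hpath : HasDerivAt (fun r => Φ (P, u P r)) (deriv (u P) t • X Q) t := by
    have h1 : HasDerivAt (fun r => Φ (P, r)) (X Q) (u P t) := by
      have := hΦr.self_of_nhds.2
      rwa [hΦ0] at this
    exact h1.scomp t hut
  have hψd : HasFDerivAt (Function.uncurry ψ) (fderiv ℝ (Function.uncurry ψ) (Q, t)) (Q, t) :=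
    ((hψ.contDiffAt (hN.mem_nhds hQN)).differentiableAt (by simp)).hasFDerivAt
  have hcomp : HasDerivAt (fun r => Function.uncurry ψ (Φ (P, u P r), r))
      (fderiv ℝ (Function.uncurry ψ) (Q, t) (deriv (u P) t • X Q, 1)) t := by
    have h2 : HasFDerivAt (Function.uncurry ψ) (fderiv ℝ (Function.uncurry ψ) (Q, t))
        (Φ (P, u P t), t) := by rwa [hΦ0]
    exact HasFDerivAt.comp_hasDerivAt (f := fun r => (Φ (P, u P r), r)) t h2
      (hpath.prodMk (hasDerivAt_id t))
  have hzero : (fun r => Function.uncurry ψ (Φ (P, u P r), r)) =ᶠ[𝓝 t] fun _ => 0 := by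
    have hc1 : ContinuousAt (fun r => (Φ (P, u P r), r)) t :=
      hpath.continuousAt.prodMk continuousAt_id
    have hc2 : ContinuousAt (fun r => (P, u P r)) t := continuousAt_const.prodMk hut.continuousAt
    have hNΦ : N ∈ 𝓝 (Φ (P, u P t), t) := by rw [hΦ0]; exact hN.mem_nhds hQN
    filter_upwards [hc1.eventually hNΦ,
      hc2.eventually hΦr, Icc_mem_nhds ht.1 ht.2] with r h1 h2 h3
    exact (hiff _ h1).1.1 (h.mem_of_reaches hX h3 hP h2.1)
  have h0 : fderiv ℝ (Function.uncurry ψ) (Q, t) (deriv (u P) t • X Q, 1) = 0 := by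
    rw [← hcomp.deriv, hzero.deriv_eq, deriv_const]
  have hx : fderiv ℝ (Function.uncurry ψ) (Q, t) (X Q, 0) = l := by
    rw [hl, inner_gradient_left]
    have h2 : HasFDerivAt (fun Q' => (Q', t)) (ContinuousLinearMap.inl ℝ (Amb n) ℝ) Q :=
      hasFDerivAt_prodMk_left Q t
    have := (hψd.comp Q h2).fderiv
    exact (DFunLike.congr_fun this (X Q)).symm
  have hτ : fderiv ℝ (Function.uncurry ψ) (Q, t) (0, 1) = deriv (fun τ => ψ Q τ) t := by
    have := hψd.comp_hasDerivAt t ((hasDerivAt_const t Q).prodMk (hasDerivAt_id t))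
    exact this.deriv.symm
  have hsum : deriv (u P) t * l + deriv (fun τ => ψ Q τ) t = 0 := by
    rw [← hx, ← hτ, ← smul_eq_mul, ← map_smul, ← map_add, Prod.smul_mk, Prod.mk_add_mk,
      smul_zero, add_zero, zero_add, h0]
  convert! hut using 1
  rw [hF hk0, ← hV]
  have : deriv (u P) t = k * l * deriv (u P) t := by rw [hkl, one_mul]
  rw [this]
  linear_combination (-k) * hsum

end IsAdmissibleFamily

end Motion

/-! ### Comparison of two families at a maximum of the difference -/

section Flow

variable {E : Type*} [NormedAddCommGroup E] [InnerProductSpace ℝ E] [FiniteDimensional ℝ E]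
  {X : E → E} {U : Set E} {P Q : E} {s : ℝ}

lemma Reaches.eventually_mem (hU : IsOpen U) (hX : ContDiffOn ℝ ∞ X U) (h : Reaches X U P s Q)
    {V : Set E} (hV : V ∈ 𝓝 Q) :
    ∀ᶠ p in 𝓝 (P, s), ∀ Q', Reaches X U p.1 p.2 Q' → Q' ∈ V := by
  have hX1 : ContDiffOn ℝ 1 X U := hX.of_le (by exact_mod_cast le_top)
  have : CompleteSpace E := FiniteDimensional.complete ℝ E
  obtain ⟨Φ, hΦ, hΦ0, hΦr⟩ := h.exists_smooth_flow_hasDerivAt hU hX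
  have hΦt : Tendsto Φ (𝓝 (P, s)) (𝓝 Q) := by
    have := hΦ.continuousAt.tendsto
    rwa [hΦ0] at this
  filter_upwards [hΦr, hΦt.eventually hV] with p h1 h2 Q' h3
  rwa [h1.1.unique hU hX1 h3] at h2

lemma Reaches.exists_dist_le (hU : IsOpen U) (hX : ContDiffOn ℝ ∞ X U) (h : Reaches X U P s Q) :
    ∃ K : ℝ, 0 ≤ K ∧ ∃ N ∈ 𝓝 (P, s), ∀ p ∈ N, ∀ q ∈ N, ∀ Q₁ Q₂, Reaches X U p.1 p.2 Q₁ →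
      Reaches X U q.1 q.2 Q₂ → dist Q₁ Q₂ ≤ K * dist p q := by
  have hX1 : ContDiffOn ℝ 1 X U := hX.of_le (by exact_mod_cast le_top)
  have : CompleteSpace E := FiniteDimensional.complete ℝ E
  obtain ⟨Φ, hΦ, -, hΦr⟩ := h.exists_smooth_flow_hasDerivAt hU hX
  obtain ⟨K, N, hN, hK⟩ := (hΦ.of_le (by exact_mod_cast le_top)).exists_lipschitzOnWith
  refine ⟨K, K.2, _, inter_mem hN hΦr, fun p hp q hq Q₁ Q₂ h1 h2 => ?_⟩
  rw [← hp.2.1.unique hU hX1 h1, ← hq.2.1.unique hU hX1 h2]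
  exact hK.dist_le_mul p hp.1 q hq.1

end Flow

lemma gradient_sub_const {E : Type*} [NormedAddCommGroup E] [InnerProductSpace ℝ E]
    [CompleteSpace E] (f : E → ℝ) (M : ℝ) :
    gradient (fun Q => f Q - M) = gradient f := by
  ext1 Q
  simp [gradient, fderiv_sub_const]

section Comparison

variable {n : ℕ} {b₀ : ℝ} {u₀ : ℝ → ℝ} {ε₀ ε₁ : ℝ} {X : Amb n → Amb n} {S : Set (Amb n)}
  {ρ c d δ A T : ℝ} {α : ℝ → ℝ} {Γ₁ Γ₂ D₁ D₂ : ℝ → Set (Amb n)} {u₁ u₂ : Amb n → ℝ → ℝ} {t : ℝ}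

open scoped InnerProductSpace

/-- At a spatial maximum of `u₁ - u₂` the defining function `f` of the second hypersurface, shifted
by the value of the maximum, touches a defining function of the first one from below. -/
lemma deriv_sub_deriv_le_of_isMax (hn : 2 ≤ n) (hu₀ : IsInitialProfile n b₀ u₀)
    (hX : IsTransverseField b₀ u₀ ε₀ ε₁ X)
    (hS : IsReferenceHypersurface b₀ u₀ ε₀ ε₁ X S ρ c d δ)
    (h₁ : IsAdmissibleFamily ε₀ X S ρ c d δ T α Γ₁ D₁ u₁)
    (h₂ : IsAdmissibleFamily ε₀ X S ρ c d δ T α Γ₂ D₂ u₂)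
    (hE₁ : EvolvesByForcedMCF A T Γ₁ D₁) (hE₂ : EvolvesByForcedMCF A T Γ₂ D₂) (ht : t ∈ Ioo 0 T)
    {P Q₁ Q₂ : Amb n} (hP : P ∈ S) (hmax : ∀ P' ∈ S, u₁ P' t - u₂ P' t ≤ u₁ P t - u₂ P t)
    (hr₁ : Reaches X (axisSegment n ε₀)ᶜ P (u₁ P t) Q₁)
    (hr₂ : Reaches X (axisSegment n ε₀)ᶜ P (u₂ P t) Q₂) {f : Amb n → ℝ}
    (hf₁ : ContDiffAt ℝ 2 f Q₁) (hf₂ : ContDiffAt ℝ 2 f Q₂)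
    (hz : ∀ᶠ Q in 𝓝 Q₂, Q ∈ Γ₂ t → f Q = 0) (hfX : ⟪gradient f Q₂, X Q₂⟫_ℝ = 1)
    (hbox : ∀ᶠ p in 𝓝 (P, u₁ P t), p.1 ∈ S → ∀ Q, Reaches X (axisSegment n ε₀)ᶜ p.1 p.2 Q →
      f Q = p.2 - u₂ p.1 t) :
    deriv (u₁ P) t - deriv (u₂ P) t ≤
      levelSetOp A (gradient f Q₂) (fderiv ℝ (gradient f) Q₂) -
        levelSetOp A (gradient f Q₁) (fderiv ℝ (gradient f) Q₁) := by
  have ht' : t ∈ Ioc 0 T := ⟨ht.1, ht.2.le⟩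
  have ht'' : t ∈ Icc 0 T := ⟨ht.1.le, ht.2.le⟩
  rw [(h₂.hasDerivAt_time hn hu₀ hX hS hE₂ ht hP hr₂ hf₂ hz hfX).deriv]
  obtain ⟨V, τ, π, η, hB, hQV, -, hconv⟩ :=
    hS.exists_flowBox hX hP (h₁.mem_Ioo ht'' hP) hr₁ univ_mem
  obtain ⟨-, hτ, hπ⟩ := hconv.self_of_nhds hP Q₁ hr₁
  simp only at hτ hπ
  set g := boxFunction τ π u₁ t with hg
  have hgc : ContDiffAt ℝ 2 g Q₁ := hB.contDiffAt_boxFunction h₁ ht' hQV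
  have hgX : ⟪gradient g Q₁, X Q₁⟫_ℝ = 1 :=
    hB.inner_gradient_boxFunction hX hQV (hgc.differentiableAt (by simp))
  have hgz : ∀ᶠ Q in 𝓝 Q₁, Q ∈ Γ₁ t → g Q = 0 := by
    filter_upwards [hB.isOpen.mem_nhds hQV] with Q hQ hQΓ
    exact (hB.boxFunction_eq_zero_iff hX h₁ ht'' hQ).2 hQΓ
  rw [(h₁.hasDerivAt_time hn hu₀ hX hS hE₁ ht hP hr₁ hgc hgz hgX).deriv]
  have hcoord : ContinuousAt (fun Q => (π Q, τ Q)) Q₁ :=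
    (hB.smooth_proj.continuousOn.continuousAt (hB.isOpen.mem_nhds hQV)).prodMk
      (hB.smooth_time.continuousOn.continuousAt (hB.isOpen.mem_nhds hQV))
  have hfg : ∀ᶠ Q in 𝓝 Q₁, Q ∈ V ∧ f Q = τ Q - u₂ (π Q) t := by
    have hbox' : ∀ᶠ p in 𝓝 (π Q₁, τ Q₁), p.1 ∈ S →
        ∀ Q, Reaches X (axisSegment n ε₀)ᶜ p.1 p.2 Q → f Q = p.2 - u₂ p.1 t := by
      rwa [hπ, hτ]
    filter_upwards [hcoord.eventually hbox', hB.isOpen.mem_nhds hQV] with Q h1 h2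
    exact ⟨h2, h1 (hB.proj_mem Q h2) Q (hB.reaches Q h2)⟩
  have key := levelSetOp_le_of_touches (f := fun Q => f Q - (u₁ P t - u₂ P t)) (g := g) (Q := Q₁) A
    (hf₁.sub contDiffAt_const) hgc
    (by
      filter_upwards [hfg] with Q ⟨h1, h2⟩
      have := hmax _ (hB.proj_mem Q h1)
      rw [h2, hg, boxFunction]
      linarith)
    (by
      have := hfg.self_of_nhds.2
      rw [this, hg, boxFunction, hτ, hπ]
      ring)
    (fun h0 => by
      rw [h0, inner_zero_left] at hgX
      exact zero_ne_one hgX)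
  rw [gradient_sub_const] at key
  linarith

/-- Near the point `P` and after the time `a`, the spatial maximum of `u₁ - u₂` grows at most
exponentially, at a rate controlled by `1 + α⁻²`. -/
def HasGrowthBound (S : Set (Amb n)) (α : ℝ → ℝ) (u₁ u₂ : Amb n → ℝ → ℝ) (a : ℝ) (P : Amb n) :
    Prop :=
  ∃ C, 0 ≤ C ∧ ∀ᶠ p in 𝓝 (P, a), p.1 ∈ S → a < p.2 →
    (∀ P' ∈ S, u₁ P' p.2 - u₂ P' p.2 ≤ u₁ p.1 p.2 - u₂ p.1 p.2) →
    0 < u₁ p.1 p.2 - u₂ p.1 p.2 →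
    deriv (u₁ p.1) p.2 - deriv (u₂ p.1) p.2 ≤
      C * (1 + 1 / α p.2 ^ 2) * (u₁ p.1 p.2 - u₂ p.1 p.2)

lemma IsAdmissibleFamily.eventually_time {α : ℝ → ℝ} {Γ D : ℝ → Set (Amb n)} {u : Amb n → ℝ → ℝ}
    (h : IsAdmissibleFamily ε₀ X S ρ c d δ T α Γ D u) {a : ℝ} (ha : a ∈ Ico 0 T) {P : Amb n}
    (hP : P ∈ S) {p : Amb n × ℝ → Prop} (hp : ∀ᶠ q in 𝓝 (P, u P a), p q) :
    ∀ᶠ q in 𝓝 (P, a), q.1 ∈ S → a < q.2 → q.2 ∈ Ioo 0 T ∧ p (q.1, u q.1 q.2) := by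
  have h1 : Tendsto (fun q : Amb n × ℝ => (q.1, u q.1 q.2)) (𝓝[S ×ˢ Icc 0 T] (P, a))
      (𝓝 (P, u P a)) :=
    (continuous_fst.continuousAt.mono_left nhdsWithin_le_nhds).prodMk_nhds
      (h.continuousOn (P, a) ⟨hP, ha.1, ha.2.le⟩)
  filter_upwards [eventually_nhdsWithin_iff.1 (h1.eventually hp),
    continuous_snd.continuousAt.eventually (gt_mem_nhds ha.2)] with q h2 h3 hq hqa
  exact ⟨⟨ha.1.trans_lt hqa, h3⟩, h2 ⟨hq, ha.1.trans hqa.le, h3.le⟩⟩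

/-- The growth bound in a region where the flow coordinates stay regular up to the time `a`: it
suffices to estimate the difference of the level set operators of a defining function at two points
of an orbit. -/
lemma hasGrowthBound_of_flowBox (hn : 2 ≤ n) (hu₀ : IsInitialProfile n b₀ u₀)
    (hX : IsTransverseField b₀ u₀ ε₀ ε₁ X)
    (hS : IsReferenceHypersurface b₀ u₀ ε₀ ε₁ X S ρ c d δ)
    (h₁ : IsAdmissibleFamily ε₀ X S ρ c d δ T α Γ₁ D₁ u₁)
    (h₂ : IsAdmissibleFamily ε₀ X S ρ c d δ T α Γ₂ D₂ u₂)
    (hE₁ : EvolvesByForcedMCF A T Γ₁ D₁) (hE₂ : EvolvesByForcedMCF A T Γ₂ D₂)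
    {a : ℝ} (ha : a ∈ Ico 0 T) (heq : ∀ P ∈ S, u₁ P a = u₂ P a) {P Q : Amb n} (hP : P ∈ S)
    (hr : Reaches X (axisSegment n ε₀)ᶜ P (u₁ P a) Q) {C : ℝ} (hC : 0 ≤ C)
    {V : Set (Amb n)} {τ : Amb n → ℝ} {π : Amb n → Amb n} {η : ℝ}
    (hB : IsFlowBox X (axisSegment n ε₀) S δ V τ π η)
    (hconv : ∀ᶠ p in 𝓝 (P, u₁ P a), p.1 ∈ S → ∀ Q', Reaches X (axisSegment n ε₀)ᶜ p.1 p.2 Q' →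
        Q' ∈ V ∧ τ Q' = p.2 ∧ π Q' = p.1)
    (hop : ∃ W ∈ 𝓝 Q, ∃ ε > 0, ∀ t ∈ Ioo a (a + ε), ∀ Q₂ ∈ W, ∀ Q₁ ∈ W, ∀ M ∈ Ioo 0 ε,
      Reaches X (axisSegment n ε₀)ᶜ Q₂ M Q₁ →
      levelSetOp A (gradient (boxFunction τ π u₂ t) Q₂)
          (fderiv ℝ (gradient (boxFunction τ π u₂ t)) Q₂) -
        levelSetOp A (gradient (boxFunction τ π u₂ t) Q₁)
          (fderiv ℝ (gradient (boxFunction τ π u₂ t)) Q₁) ≤ C * M) :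
    HasGrowthBound S α u₁ u₂ a P := by
  have hU := isOpen_compl_axisSegment n ε₀
  obtain ⟨W, hW, ε, hε, hop⟩ := hop
  have hr₂ : Reaches X (axisSegment n ε₀)ᶜ P (u₂ P a) Q := by rwa [← heq P hP]
  have hconv₂ := hconv
  rw [heq P hP] at hconv₂
  have hd₁ := h₁.eventually_time ha hP (((eventually_eventually_nhds.2 hconv).and
    (hr.eventually_mem hU hX.smooth hW)).and
    ((continuous_snd.tendsto (P, u₁ P a)).eventually (Metric.ball_mem_nhds (u₁ P a) (half_pos hε))))
  have hd₂ := h₂.eventually_time ha hP ((hconv₂.and (hr₂.eventually_mem hU hX.smooth hW)).and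
    ((continuous_snd.tendsto (P, u₂ P a)).eventually (Metric.ball_mem_nhds (u₂ P a) (half_pos hε))))
  refine ⟨C, hC, ?_⟩
  filter_upwards [hd₁, hd₂, continuous_snd.continuousAt.eventually (gt_mem_nhds (lt_add_of_pos_right a hε))]
    with ⟨P', t⟩ k₁ k₂ hta hP' hat hmax hpos
  obtain ⟨ht, ⟨hc₁, hW₁⟩, hu₁⟩ := k₁ hP' hat
  obtain ⟨-, ⟨hc₂, hW₂⟩, hu₂⟩ := k₂ hP' hat
  simp only at ht hc₁ hW₁ hu₁ hc₂ hW₂ hu₂ hmax hpos hat hta hP' ⊢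
  have ht' : t ∈ Ioc 0 T := ⟨ht.1, ht.2.le⟩
  have ht'' : t ∈ Icc 0 T := ⟨ht.1.le, ht.2.le⟩
  obtain ⟨Q₁, -, hr₁⟩ := h₁.exists_reaches hn hu₀ hX hS ht' hP'
  obtain ⟨Q₂, -, hr₂⟩ := h₂.exists_reaches hn hu₀ hX hS ht' hP'
  obtain ⟨hV₁, -, -⟩ := hc₁.self_of_nhds hP' Q₁ hr₁
  obtain ⟨hV₂, -, -⟩ := hc₂ hP' Q₂ hr₂
  set M := u₁ P' t - u₂ P' t with hM
  have hMε : M < ε := by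
    rw [Real.dist_eq, abs_lt] at hu₁ hu₂
    rw [heq P hP] at hu₁
    linarith [hu₁.2, hu₂.1]
  have hr₂₁ : Reaches X (axisSegment n ε₀)ᶜ Q₂ M Q₁ := by
    have := hr₂.symm.trans hU hX.contDiffOn_one hr₁
    rwa [neg_add_eq_sub] at this
  have hf₁ := hB.contDiffAt_boxFunction h₂ ht' hV₁
  have hf₂ := hB.contDiffAt_boxFunction h₂ ht' hV₂
  refine (deriv_sub_deriv_le_of_isMax hn hu₀ hX hS h₁ h₂ hE₁ hE₂ ht hP' hmax hr₁ hr₂ hf₁ hf₂ ?_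
    (hB.inner_gradient_boxFunction hX hV₂ (hf₂.differentiableAt (by simp))) ?_).trans
    ((hop t ⟨hat, hta⟩ Q₂ (hW₂ Q₂ hr₂) Q₁ (hW₁ Q₁ hr₁) M ⟨hpos, hMε⟩ hr₂₁).trans ?_)
  · filter_upwards [hB.isOpen.mem_nhds hV₂] with Q' hQ' hQ''
    exact (hB.boxFunction_eq_zero_iff hX h₂ ht'' hQ').2 hQ''
  · filter_upwards [hc₁] with p hp hpS Q' hQ'
    obtain ⟨-, e1, e2⟩ := hp hpS Q' hQ'
    rw [boxFunction, e1, e2]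
  · refine mul_le_mul_of_nonneg_right ?_ hpos.le
    exact le_mul_of_one_le_right hC (le_add_of_nonneg_right (by positivity))

/-- Near the flat discs `X` is constant, and translations do not affect the level set operator. -/
lemma hasGrowthBound_of_const (hn : 2 ≤ n) (hu₀ : IsInitialProfile n b₀ u₀)
    (hX : IsTransverseField b₀ u₀ ε₀ ε₁ X)
    (hS : IsReferenceHypersurface b₀ u₀ ε₀ ε₁ X S ρ c d δ)
    (h₁ : IsAdmissibleFamily ε₀ X S ρ c d δ T α Γ₁ D₁ u₁)
    (h₂ : IsAdmissibleFamily ε₀ X S ρ c d δ T α Γ₂ D₂ u₂)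
    (hE₁ : EvolvesByForcedMCF A T Γ₁ D₁) (hE₂ : EvolvesByForcedMCF A T Γ₂ D₂)
    {a : ℝ} (ha : a ∈ Ico 0 T) (heq : ∀ P ∈ S, u₁ P a = u₂ P a) {P Q : Amb n} (hP : P ∈ S)
    (hr : Reaches X (axisSegment n ε₀)ᶜ P (u₁ P a) Q) {e : Amb n} (hXe : ∀ᶠ Q' in 𝓝 Q, X Q' = e) :
    HasGrowthBound S α u₁ u₂ a P := by
  have hU := isOpen_compl_axisSegment n ε₀
  obtain ⟨V, τ, π, η, hB, hQV, -, hconv⟩ :=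
    hS.exists_flowBox hX hP (h₁.mem_Ioo ⟨ha.1, ha.2.le⟩ hP) hr univ_mem
  refine hasGrowthBound_of_flowBox hn hu₀ hX hS h₁ h₂ hE₁ hE₂ ha heq hP hr le_rfl hB hconv ?_
  obtain ⟨r, hr0, hball⟩ := Metric.eventually_nhds_iff_ball.1
    ((eventually_mem_set.2 (hB.isOpen.mem_nhds hQV)).and
      (hXe.and (eventually_mem_set.2 (hU.mem_nhds hr.right_mem))))
  -- inside the ball the flow is a translation
  have htrans : ∀ Q' ∈ Metric.ball Q r, ∀ M, 0 < M → Q' + M • e ∈ Metric.ball Q r →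
      Reaches X (axisSegment n ε₀)ᶜ Q' M (Q' + M • e) := by
    intro Q' hQ' M hM hQM
    have hseg : ∀ s ∈ Icc 0 M, Q' + s • e ∈ Metric.ball Q r := fun s hs => by
      have := (convex_ball Q r).add_smul_mem hQ' hQM (t := s / M)
        ⟨div_nonneg hs.1 hM.le, (div_le_one hM).2 hs.2⟩
      rwa [smul_smul, div_mul_cancel₀ _ hM.ne'] at this
    have := Reaches.of_Icc (γ := fun s : ℝ => Q' + s • e) hU hX.contDiffOn_one hM
      (by fun_prop) (hball _ (hseg 0 ⟨le_rfl, hM.le⟩)).2.2 (hball _ (hseg M ⟨hM.le, le_rfl⟩)).2.2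
      fun s hs => ⟨(hball _ (hseg s (Ioo_subset_Icc_self hs))).2.2, ?_⟩
    · simpa using this
    · rw [(hball _ (hseg s (Ioo_subset_Icc_self hs))).2.1]
      simpa using ((hasDerivAt_id s).smul_const e).const_add Q'
  have he : 0 < ‖e‖ + 1 := by positivity
  refine ⟨Metric.ball Q (r / 2), Metric.ball_mem_nhds Q (half_pos hr0),
    min η (r / 2 / (‖e‖ + 1)), lt_min hB.η_pos (by positivity), fun t ht Q₂ hQ₂ Q₁ hQ₁ M hM hr₂₁ => ?_⟩
  have hMη : M < η := hM.2.trans_le (min_le_left _ _)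
  have hMe : ‖M • e‖ < r / 2 := by
    have h1 : M * (‖e‖ + 1) < r / 2 := (lt_div_iff₀ he).1 (hM.2.trans_le (min_le_right _ _))
    rw [norm_smul, Real.norm_eq_abs, abs_of_pos hM.1]
    linarith [hM.1]
  have hin : ∀ Q' ∈ Metric.ball Q (r / 2), Q' ∈ Metric.ball Q r ∧ Q' + M • e ∈ Metric.ball Q r := by
    intro Q' hQ'
    rw [Metric.mem_ball, dist_eq_norm] at *
    refine ⟨by linarith, ?_⟩
    have := norm_add_le (Q' - Q) (M • e)
    rw [Metric.mem_ball, dist_eq_norm, add_sub_right_comm]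
    linarith
  have e₁ : Q₁ = Q₂ + M • e :=
    hr₂₁.unique hU hX.contDiffOn_one (htrans Q₂ (hin Q₂ hQ₂).1 M hM.1 (hin Q₂ hQ₂).2)
  set g := boxFunction τ π u₂ t with hg
  have hshift : ∀ᶠ Q' in 𝓝 Q₂, g (Q' + M • e) = g Q' + M := by
    filter_upwards [Metric.isOpen_ball.mem_nhds hQ₂] with Q' hQ'
    exact hB.boxFunction_shift (hball Q' (hin Q' hQ').1).1 (by rwa [abs_of_pos hM.1])
      (htrans Q' (hin Q' hQ').1 M hM.1 (hin Q' hQ').2)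
  have hgrad : ∀ᶠ Q' in 𝓝 Q₂, gradient g (Q' + M • e) = gradient g Q' := by
    filter_upwards [hshift.eventually_nhds] with Q' hQ'
    have := EventuallyEq.fderiv_eq (𝕜 := ℝ) hQ'
    rw [fderiv_comp_add_right, fderiv_add_const] at this
    rw [gradient, gradient, this]
  have hhess := EventuallyEq.fderiv_eq (𝕜 := ℝ) hgrad
  rw [fderiv_comp_add_right] at hhess
  rw [e₁, hhess, hgrad.self_of_nhds, sub_self, zero_mul]

/-! ### The region away from the flat parts -/

lemma ContDiffOn.fderiv_slice {E F : Type*} [NormedAddCommGroup E] [NormedSpace ℝ E]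
    [NormedAddCommGroup F] [NormedSpace ℝ F] {f : E → ℝ → F} {W : Set E} {I : Set ℝ}
    {k m : WithTop ℕ∞} (hf : ContDiffOn ℝ k (Function.uncurry f) (W ×ˢ I)) (hW : IsOpen W)
    (hI : UniqueDiffOn ℝ I) (hm : m + 1 ≤ k) :
    ContDiffOn ℝ m (fun q : E × ℝ => fderiv ℝ (fun Q => f Q q.2) q.1) (W ×ˢ I) := by
  have hu : UniqueDiffOn ℝ (W ×ˢ I) := hW.uniqueDiffOn.prod hI
  have h1 := hf.fderivWithin hu hm
  refine ((ContinuousLinearMap.compL ℝ E (E × ℝ) F).flip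
    (ContinuousLinearMap.inl ℝ E ℝ)).contDiff.comp_contDiffOn h1 |>.congr fun q hq => ?_
  have h2 : HasFDerivWithinAt (Function.uncurry f) (fderivWithin ℝ (Function.uncurry f) (W ×ˢ I) q)
      (W ×ˢ I) q :=
    ((hf q hq).differentiableWithinAt (by
      rintro rfl
      simp at hm)).hasFDerivWithinAt
  have h3 : HasFDerivAt (fun Q => (Q, q.2)) (ContinuousLinearMap.inl ℝ E ℝ) q.1 :=
    hasFDerivAt_prodMk_left q.1 q.2
  have h4 := HasFDerivWithinAt.comp (f := fun Q => (Q, q.2)) q.1 h2 h3.hasFDerivWithinAt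
    (t := W ×ˢ I) (s := W) fun Q hQ => ⟨hQ, hq.2⟩
  exact (h4.hasFDerivAt (hW.mem_nhds hq.1)).fderiv

lemma contDiffAt_levelSetOp {E : Type*} [NormedAddCommGroup E] [InnerProductSpace ℝ E]
    [FiniteDimensional ℝ E] (A : ℝ) {p : E} (hp : p ≠ 0) (H : E →L[ℝ] E) :
    ContDiffAt ℝ 1 (fun z : E × (E →L[ℝ] E) => levelSetOp A z.1 z.2) (p, H) := by
  have htr : ContDiff ℝ 1 fun H : E →L[ℝ] E => LinearMap.trace ℝ E (H : E →ₗ[ℝ] E) :=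
    (((LinearMap.trace ℝ E).comp (ContinuousLinearMap.coeLM ℝ)).toContinuousLinearMap :
      (E →L[ℝ] E) →L[ℝ] ℝ).contDiff
  have h1 : ContDiffAt ℝ 1 (fun z : E × (E →L[ℝ] E) => z.1) (p, H) := contDiffAt_fst
  have h2 : ContDiffAt ℝ 1 (fun z : E × (E →L[ℝ] E) => z.2 z.1) (p, H) :=
    contDiffAt_snd.clm_apply contDiffAt_fst
  refine ((htr.contDiffAt.comp (p, H) contDiffAt_snd).sub ((h1.inner ℝ h2).div ?_ ?_)).add
    (contDiffAt_const.mul (h1.norm ℝ hp))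
  · exact (h1.norm_sq ℝ)
  · exact pow_ne_zero 2 (norm_ne_zero_iff.2 hp)

lemma isClosed_flatPart (n : ℕ) (c d ρ : ℝ) : IsClosed (flatPart n c d ρ) := by
  have h1 : ∀ c : ℝ, IsClosed (flatDisc n c ρ) := fun c =>
    (isClosed_eq (f := fun P : Amb n => P.fst) (by fun_prop) continuous_const).inter
      (isClosed_le (f := fun P : Amb n => ‖P.snd‖) (by fun_prop) continuous_const)
  have h2 : IsClosed (pipe n d ρ) :=
    (isClosed_Icc.preimage (f := fun P : Amb n => P.fst) (by fun_prop)).inter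
      (isClosed_eq (f := fun P : Amb n => ‖P.snd‖) (by fun_prop) continuous_const)
  exact ((h1 c).union (h1 (-c))).union h2

/-- Away from the flat parts everything is smooth up to the time `a`, so that the level set operator
is Lipschitz along the orbits. -/
lemma hasGrowthBound_of_notMem_flatPart (hn : 2 ≤ n) (hu₀ : IsInitialProfile n b₀ u₀)
    (hX : IsTransverseField b₀ u₀ ε₀ ε₁ X)
    (hS : IsReferenceHypersurface b₀ u₀ ε₀ ε₁ X S ρ c d δ)
    (h₁ : IsAdmissibleFamily ε₀ X S ρ c d δ T α Γ₁ D₁ u₁)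
    (h₂ : IsAdmissibleFamily ε₀ X S ρ c d δ T α Γ₂ D₂ u₂)
    (hE₁ : EvolvesByForcedMCF A T Γ₁ D₁) (hE₂ : EvolvesByForcedMCF A T Γ₂ D₂)
    {a : ℝ} (ha : a ∈ Ico 0 T) (heq : ∀ P ∈ S, u₁ P a = u₂ P a) {P : Amb n} (hP : P ∈ S)
    (hPf : P ∉ flatPart n c d ρ) : HasGrowthBound S α u₁ u₂ a P := by
  have hU := isOpen_compl_axisSegment n ε₀
  have ha' : a ∈ Icc 0 T := ⟨ha.1, ha.2.le⟩
  have hT : 0 < T := ha.1.trans_lt ha.2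
  obtain ⟨Q, hr⟩ : ∃ Q, Reaches X (axisSegment n ε₀)ᶜ P (u₁ P a) Q := by
    obtain ⟨m, hm, hmu⟩ := h₁.bounded_below
    obtain ⟨Q, hQ, hf⟩ := hS.flow P hP _ (h₁.mem_Ioo ha' hP) (by linarith [hmu P ⟨hP, hPf⟩ a ha'])
    exact ⟨Q, hf.reaches (isClosed_axisSegment n ε₀) hX.contDiffOn_one (hS.notMem_axisSegment hP) hQ⟩
  obtain ⟨V, τ, π, η, hB, hQV, -, hconv⟩ :=
    hS.exists_flowBox hX hP (h₁.mem_Ioo ha' hP) hr univ_mem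
  obtain ⟨-, -, hπ⟩ := hconv.self_of_nhds hP Q hr
  simp only at hπ
  set W := V ∩ π ⁻¹' (flatPart n c d ρ)ᶜ with hWdef
  have hW : IsOpen W := hB.smooth_proj.continuousOn.isOpen_inter_preimage hB.isOpen
    (isClosed_flatPart n c d ρ).isOpen_compl
  have hQW : Q ∈ W := ⟨hQV, by rw [mem_preimage, hπ]; exact hPf⟩
  have hI : UniqueDiffOn ℝ (Icc 0 T) := uniqueDiffOn_Icc hT
  let g : Amb n → ℝ → ℝ := fun Q t => boxFunction τ π u₂ t Q
  have hg : ContDiffOn ℝ 3 (Function.uncurry g) (W ×ˢ Icc 0 T) := by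
    refine ContDiffOn.sub (f := fun q : Amb n × ℝ => τ q.1)
      (g := fun q : Amb n × ℝ => u₂ (π q.1) q.2) ?_ ?_
    · exact hB.smooth_time.comp contDiffOn_fst fun q hq => hq.1.1
    · exact ContDiffOn.comp (g := Function.uncurry u₂) (f := fun q : Amb n × ℝ => (π q.1, q.2))
        (h₂.smooth_initial.of_le three_le_smooth)
        ((hB.smooth_proj.comp contDiffOn_fst fun q hq => hq.1.1).prodMk contDiffOn_snd)
        fun q hq => ⟨⟨hB.proj_mem _ hq.1.1, hq.1.2⟩, hq.2⟩
  let G₁ : Amb n → ℝ → Amb n := fun Q t => gradient (fun Q => g Q t) Q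
  have hG₁ : ContDiffOn ℝ 2 (Function.uncurry G₁) (W ×ˢ Icc 0 T) :=
    (InnerProductSpace.toDual ℝ (Amb n)).symm.toContinuousLinearEquiv.toContinuousLinearMap.contDiff
      |>.comp_contDiffOn (hg.fderiv_slice hW hI (by norm_num))
  let G₂ : Amb n × ℝ → Amb n →L[ℝ] Amb n := fun q => fderiv ℝ (fun Q => G₁ Q q.2) q.1
  have hG₂ : ContDiffOn ℝ 1 G₂ (W ×ˢ Icc 0 T) := hG₁.fderiv_slice hW hI (by norm_num)
  have hne : G₁ Q a ≠ 0 := by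
    have hd : DifferentiableAt ℝ (boxFunction τ π u₂ a) Q := by
      have : ContDiffOn ℝ 3 (fun Q => g Q a) W :=
        ContDiffOn.comp (g := Function.uncurry g) (f := fun Q => (Q, a)) hg
          (contDiffOn_id.prodMk contDiffOn_const) fun Q hQ => ⟨hQ, ha'⟩
      exact (this.contDiffAt (hW.mem_nhds hQW)).differentiableAt (by simp)
    intro h0
    have := hB.inner_gradient_boxFunction hX hQV hd
    rw [show gradient (boxFunction τ π u₂ a) Q = 0 from h0, inner_zero_left] at this
    exact zero_ne_one this
  obtain ⟨r, hr0, hrW⟩ := Metric.isOpen_iff.1 hW Q hQW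
  have hF : ContDiffWithinAt ℝ 1 (fun q : Amb n × ℝ => levelSetOp A (G₁ q.1 q.2) (G₂ q))
      (Metric.ball Q r ×ˢ Icc 0 T) (Q, a) := by
    refine ContDiffAt.comp_contDiffWithinAt (g := fun z : Amb n × _ => levelSetOp A z.1 z.2)
      (f := fun q : Amb n × ℝ => (G₁ q.1 q.2, G₂ q)) (Q, a) (contDiffAt_levelSetOp A hne _) ?_
    exact (((hG₁.of_le (by norm_num)) (Q, a) ⟨hQW, ha'⟩).prodMk (hG₂ (Q, a) ⟨hQW, ha'⟩)).mono
      (prod_mono hrW subset_rfl)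
  obtain ⟨L, N, hN, hL⟩ := hF.exists_lipschitzOnWith ((convex_ball Q r).prod (convex_Icc 0 T))
  obtain ⟨ε, hε, hεN⟩ := Metric.mem_nhdsWithin_iff.1 hN
  obtain ⟨K, hK, N', hN', hKN⟩ :=
    (Reaches.zero hU hX.contDiffOn_one hr.right_mem).exists_dist_le hU hX.smooth
  obtain ⟨ε', hε', hεN'⟩ := Metric.mem_nhds_iff.1 hN'
  refine hasGrowthBound_of_flowBox hn hu₀ hX hS h₁ h₂ hE₁ hE₂ ha heq hP hr
    (C := L * K) (by positivity) hB hconv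
    ⟨Metric.ball Q (min r (min ε ε')), Metric.ball_mem_nhds _ (by positivity),
      min (T - a) (min ε ε'), by have := sub_pos.2 ha.2; positivity, ?_⟩
  intro t ht Q₂ hQ₂ Q₁ hQ₁ M hM hr₂₁
  simp only [Metric.mem_ball, lt_min_iff] at hQ₁ hQ₂
  have htT : t ∈ Icc 0 T := by
    have := ht.2.trans_le (add_le_add_right (min_le_left (T - a) _) a)
    exact ⟨ha.1.trans ht.1.le, by linarith⟩
  have hta : dist t a < ε := by
    rw [Real.dist_eq, abs_of_pos (sub_pos.2 ht.1)]
    have := ht.2.trans_le (add_le_add_right ((min_le_right (T - a) _).trans (min_le_left _ _)) a)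
    linarith
  have hmem : ∀ Q', dist Q' Q < r → dist Q' Q < ε → (Q', t) ∈ N := fun Q' h1 h2 =>
    hεN ⟨by rw [Metric.mem_ball, Prod.dist_eq]; exact max_lt h2 hta, h1, htT⟩
  have hd1 := hL.dist_le_mul (Q₂, t) (hmem Q₂ hQ₂.1 hQ₂.2.1) (Q₁, t) (hmem Q₁ hQ₁.1 hQ₁.2.1)
  have hM' : M < ε' := hM.2.trans_le ((min_le_right _ _).trans (min_le_right _ _))
  have hd2 := hKN (Q₂, 0)
    (hεN' (by rw [Metric.mem_ball, Prod.dist_eq]; exact max_lt hQ₂.2.2 (by simpa using hε')))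
    (Q₂, M) (hεN' (by
      rw [Metric.mem_ball, Prod.dist_eq]
      exact max_lt hQ₂.2.2 (by simpa [abs_of_pos hM.1] using hM'))) Q₂ Q₁
    (Reaches.zero hU hX.contDiffOn_one hr₂₁.left_mem) hr₂₁
  have e1 : dist (Q₂, (0 : ℝ)) (Q₂, M) = M := by
    rw [Prod.dist_eq, dist_self, dist_comm, Real.dist_0_eq_abs, abs_of_pos hM.1,
      max_eq_right hM.1.le]
  have e2 : dist (Q₂, t) (Q₁, t) = dist Q₂ Q₁ := by
    rw [Prod.dist_eq, dist_self, max_eq_left dist_nonneg]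
  rw [e1] at hd2
  rw [e2, Real.dist_eq] at hd1
  refine (le_abs_self _).trans (hd1.trans ?_)
  rw [mul_assoc]
  exact mul_le_mul_of_nonneg_left hd2 L.2

end Comparison

/-! ### Rotationally symmetric graphs -/

section Radial

variable {n : ℕ}

open scoped InnerProductSpace

lemma hasFDerivAt_norm_of_ne_zero {F : Type*} [NormedAddCommGroup F] [InnerProductSpace ℝ F] {y : F}
    (hy : y ≠ 0) : HasFDerivAt (fun y : F => ‖y‖) (‖y‖⁻¹ • innerSL ℝ y) y := by
  have h1 : HasFDerivAt (fun y : F => ‖y‖ ^ 2) (2 • (innerSL ℝ y)) y :=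
    (hasStrictFDerivAt_norm_sq y).hasFDerivAt
  have hn : ‖y‖ ≠ 0 := norm_ne_zero_iff.2 hy
  have h2 := h1.sqrt (by positivity)
  simp only [Real.sqrt_sq (norm_nonneg _)] at h2
  convert! h2 using 1
  ext v
  simp
  field_simp

lemma hasFDerivAt_normalize {F : Type*} [NormedAddCommGroup F] [InnerProductSpace ℝ F] {θ : F}
    (hθ : ‖θ‖ = 1) {r : ℝ} (hr : 0 < r) :
    HasFDerivAt (fun y : F => ‖y‖⁻¹ • y)
      (r⁻¹ • (ContinuousLinearMap.id ℝ F - (innerSL ℝ θ).smulRight θ)) (r • θ) := by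
  have hn : ‖r • θ‖ = r := by rw [norm_smul, hθ, mul_one, Real.norm_eq_abs, abs_of_pos hr]
  have h0 : r • θ ≠ 0 := by
    rw [← norm_ne_zero_iff, hn]
    exact hr.ne'
  have h1 := ((hasDerivAt_inv (x := ‖r • θ‖) (by rw [hn]; exact hr.ne')).comp_hasFDerivAt _
    (hasFDerivAt_norm_of_ne_zero h0)).smul (hasFDerivAt_id (r • θ))
  convert! h1 using 1
  ext v
  simp [hn]
  match_scalars
  · field_simp
  · field_simp

/-- The function `k(x) - |y|`, which is positive in the domain `{|y| < k(x)}`. -/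
noncomputable def radialFunction (n : ℕ) (k : ℝ → ℝ) (Q : Amb n) : ℝ := k Q.fst - ‖Q.snd‖

lemma contDiff_fst_amb {m : WithTop ℕ∞} : ContDiff ℝ m fun Q : Amb n => Q.fst :=
  (ContinuousLinearMap.fst ℝ ℝ (EuclideanSpace ℝ (Fin n)) ∘L
    (WithLp.prodContinuousLinearEquiv 2 ℝ ℝ
      (EuclideanSpace ℝ (Fin n))).toContinuousLinearMap).contDiff

lemma contDiff_snd_amb {m : WithTop ℕ∞} : ContDiff ℝ m fun Q : Amb n => Q.snd :=
  (ContinuousLinearMap.snd ℝ ℝ (EuclideanSpace ℝ (Fin n)) ∘L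
    (WithLp.prodContinuousLinearEquiv 2 ℝ ℝ
      (EuclideanSpace ℝ (Fin n))).toContinuousLinearMap).contDiff

lemma hasFDerivAt_fst_amb (Q : Amb n) : HasFDerivAt (fun Q : Amb n => Q.fst)
    (ContinuousLinearMap.fst ℝ ℝ (EuclideanSpace ℝ (Fin n)) ∘L
    (WithLp.prodContinuousLinearEquiv 2 ℝ ℝ
      (EuclideanSpace ℝ (Fin n))).toContinuousLinearMap) Q :=
  (ContinuousLinearMap.fst ℝ ℝ (EuclideanSpace ℝ (Fin n)) ∘L
    (WithLp.prodContinuousLinearEquiv 2 ℝ ℝ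
      (EuclideanSpace ℝ (Fin n))).toContinuousLinearMap).hasFDerivAt

lemma hasFDerivAt_snd_amb (Q : Amb n) : HasFDerivAt (fun Q : Amb n => Q.snd)
    (ContinuousLinearMap.snd ℝ ℝ (EuclideanSpace ℝ (Fin n)) ∘L
    (WithLp.prodContinuousLinearEquiv 2 ℝ ℝ
      (EuclideanSpace ℝ (Fin n))).toContinuousLinearMap) Q :=
  (ContinuousLinearMap.snd ℝ ℝ (EuclideanSpace ℝ (Fin n)) ∘L
    (WithLp.prodContinuousLinearEquiv 2 ℝ ℝ
      (EuclideanSpace ℝ (Fin n))).toContinuousLinearMap).hasFDerivAt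

lemma contDiffAt_radialFunction {k : ℝ → ℝ} {Q : Amb n} {m : WithTop ℕ∞}
    (hk : ContDiffAt ℝ m k Q.fst) (hQ : Q.snd ≠ 0) : ContDiffAt ℝ m (radialFunction n k) Q :=
  (ContDiffAt.comp Q (f := fun Q : Amb n => Q.fst) hk contDiff_fst_amb.contDiffAt).sub
    (contDiff_snd_amb.contDiffAt.norm ℝ hQ)

lemma gradient_radialFunction {k : ℝ → ℝ} {Q : Amb n} (hk : DifferentiableAt ℝ k Q.fst)
    (hQ : Q.snd ≠ 0) :
    gradient (radialFunction n k) Q = pt (deriv k Q.fst) (-(‖Q.snd‖⁻¹ • Q.snd)) := by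
  have h1 := (hk.hasDerivAt.comp_hasFDerivAt Q (hasFDerivAt_fst_amb Q)).sub
    ((hasFDerivAt_norm_of_ne_zero hQ).comp Q (hasFDerivAt_snd_amb Q))
  refine ext_inner_right ℝ fun v => ?_
  rw [inner_gradient_left, show fderiv ℝ (radialFunction n k) Q = _ from h1.fderiv]
  simp [WithLp.prod_inner_apply, pt, inner_smul_left, sub_eq_add_neg, mul_comm]

lemma hasFDerivAt_gradient_radialFunction {k : ℝ → ℝ} {x r : ℝ} {θ : EuclideanSpace ℝ (Fin n)}
    (hk : ContDiffAt ℝ 2 k x) (hθ : ‖θ‖ = 1) (hr : 0 < r) :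
    ∃ H : Amb n →L[ℝ] Amb n, HasFDerivAt (gradient (radialFunction n k)) H (pt x (r • θ)) ∧
      ∀ v : Amb n, H v = pt (deriv (deriv k) x * v.fst) (-(r⁻¹ • (v.snd - ⟪θ, v.snd⟫_ℝ • θ))) := by
  have hne : (pt x (r • θ)).snd ≠ 0 := by
    rw [pt_snd, ← norm_ne_zero_iff, norm_smul, hθ, Real.norm_eq_abs, abs_of_pos hr, mul_one]
    exact hr.ne'
  have hk' : DifferentiableAt ℝ (deriv k) x := by
    have : ContDiffAt ℝ 1 (deriv k) x :=
      (hk.fderiv_right (m := 1) (by norm_num)).clm_apply contDiffAt_const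
    exact this.differentiableAt (by simp)
  have hev : gradient (radialFunction n k) =ᶠ[𝓝 (pt x (r • θ))] fun Q : Amb n =>
      (WithLp.prodContinuousLinearEquiv 2 ℝ ℝ (EuclideanSpace ℝ (Fin n))).symm
        (deriv k Q.fst, -(‖Q.snd‖⁻¹ • Q.snd)) := by
    have h1 : ContinuousAt (fun Q : Amb n => Q.fst) (pt x (r • θ)) := by fun_prop
    have h2 : ContinuousAt (fun Q : Amb n => Q.snd) (pt x (r • θ)) := by fun_prop
    filter_upwards [h1.eventually hk.eventually_differentiableAt, h2.eventually_ne hne]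
      with Q h3 h4
    exact gradient_radialFunction h3 h4
  have hd := (WithLp.prodContinuousLinearEquiv 2 ℝ ℝ
    (EuclideanSpace ℝ (Fin n))).symm.toContinuousLinearMap.hasFDerivAt.comp (pt x (r • θ))
    ((HasDerivAt.comp_hasFDerivAt (pt x (r • θ)) (h₂ := deriv k) hk'.hasDerivAt
      (hasFDerivAt_fst_amb (pt x (r • θ)))).prodMk
      ((hasFDerivAt_normalize hθ hr).comp (pt x (r • θ)) (hasFDerivAt_snd_amb (pt x (r • θ)))).neg)
  refine ⟨_, hd.congr_of_eventuallyEq hev, fun v => ?_⟩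
  refine Amb.ext ?_ ?_
  · simp
  · simp

/-- The level set operator of a rotationally symmetric graph at two radii over the same `x` differs only
in the rotational principal curvatures, which are of the form `const / r`. The bound does not involve
the slope of the profile `k`, so it holds uniformly however steep the hypersurface is. -/
lemma exists_levelSetOp_radialFunction_le (n : ℕ) : ∃ C, 0 ≤ C ∧ ∀ (A : ℝ) (k : ℝ → ℝ) (x r₁ r₂ : ℝ)
    (θ : EuclideanSpace ℝ (Fin n)), ContDiffAt ℝ 2 k x → ‖θ‖ = 1 → 0 < r₁ → r₁ ≤ r₂ →
    levelSetOp A (gradient (radialFunction n k) (pt x (r₂ • θ)))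
        (fderiv ℝ (gradient (radialFunction n k)) (pt x (r₂ • θ))) -
      levelSetOp A (gradient (radialFunction n k) (pt x (r₁ • θ)))
        (fderiv ℝ (gradient (radialFunction n k)) (pt x (r₁ • θ))) ≤
      C * ((r₂ - r₁) / (r₁ * r₂)) := by
  obtain ⟨C, hC, hCb⟩ := exists_tangentialTrace_le (Amb n)
  refine ⟨C * 2, by positivity, fun A k x r₁ r₂ θ hk hθ h0 h12 => ?_⟩
  have h2 : 0 < r₂ := h0.trans_le h12
  have hgrad : ∀ r : ℝ, 0 < r → gradient (radialFunction n k) (pt x (r • θ)) = pt (deriv k x) (-θ) := by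
    intro r hr
    have hn : ‖r • θ‖ = r := by rw [norm_smul, hθ, mul_one, Real.norm_eq_abs, abs_of_pos hr]
    rw [gradient_radialFunction (hk.differentiableAt (by simp))]
    · rw [pt_snd, pt_fst, hn, smul_smul, inv_mul_cancel₀ hr.ne', one_smul]
    · rw [pt_snd, ← norm_ne_zero_iff, hn]
      exact hr.ne'
  obtain ⟨H₁, hH₁, e₁⟩ := hasFDerivAt_gradient_radialFunction hk hθ h0
  obtain ⟨H₂, hH₂, e₂⟩ := hasFDerivAt_gradient_radialFunction hk hθ h2
  rw [hH₁.fderiv, hH₂.fderiv, hgrad _ h0, hgrad _ h2]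
  have hinv : r₁⁻¹ - r₂⁻¹ = (r₂ - r₁) / (r₁ * r₂) := by field_simp
  have hinv0 : 0 ≤ (r₂ - r₁) / (r₁ * r₂) := div_nonneg (by linarith) (by positivity)
  have hnorm : ‖H₂ - H₁‖ ≤ 2 * ((r₂ - r₁) / (r₁ * r₂)) := by
    refine ContinuousLinearMap.opNorm_le_bound _ (by positivity) fun v => ?_
    have e : (H₂ - H₁) v = pt 0 ((r₁⁻¹ - r₂⁻¹) • (v.snd - ⟪θ, v.snd⟫_ℝ • θ)) := by
      rw [sub_apply, e₁, e₂]
      refine Amb.ext ?_ ?_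
      · simp [pt]
      · simp only [WithLp.sub_snd, pt_snd, sub_smul]
        abel
    have hpt : ∀ y : EuclideanSpace ℝ (Fin n), ‖(pt 0 y : Amb n)‖ = ‖y‖ := fun y => by
      rw [← sq_eq_sq₀ (norm_nonneg _) (norm_nonneg _), norm_sq_pt]
      ring
    have hv : ‖v.snd‖ ≤ ‖v‖ := by
      rw [← sq_le_sq₀ (norm_nonneg _) (norm_nonneg _), ← pt_fst_snd v, norm_sq_pt, pt_snd]
      nlinarith [sq_nonneg v.fst]
    have h3 : ‖v.snd - ⟪θ, v.snd⟫_ℝ • θ‖ ≤ 2 * ‖v.snd‖ := by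
      refine (norm_sub_le _ _).trans ?_
      rw [norm_smul, hθ, mul_one]
      have := abs_real_inner_le_norm θ v.snd
      rw [hθ, one_mul] at this
      rw [Real.norm_eq_abs]
      linarith
    rw [e, hpt, norm_smul, hinv, Real.norm_eq_abs, abs_of_nonneg hinv0]
    nlinarith [norm_nonneg v]
  have h4 := (abs_le.1 (hCb (pt (deriv k x) (-θ)) (H₂ - H₁))).2
  rw [tangentialTrace_sub] at h4
  rw [levelSetOp, levelSetOp, add_sub_add_right_eq_sub]
  refine h4.trans ?_
  rw [mul_assoc]
  exact mul_le_mul_of_nonneg_left hnorm hC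

end Radial

/-! ### The region near the pipe -/

section Pipe

variable {n : ℕ} {b₀ : ℝ} {u₀ : ℝ → ℝ} {ε₀ ε₁ : ℝ} {X : Amb n → Amb n} {S : Set (Amb n)}
  {ρ c d δ A T : ℝ} {α : ℝ → ℝ} {Γ D Γ₁ Γ₂ D₁ D₂ : ℝ → Set (Amb n)} {u u₁ u₂ : Amb n → ℝ → ℝ}
  {t : ℝ}

open scoped InnerProductSpace

/-- Near the pipe the flow is explicit, uniformly up to the time at which it reaches the axis. -/
lemma IsReferenceHypersurface.eventually_radial (hX : IsTransverseField b₀ u₀ ε₀ ε₁ X)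
    (hS : IsReferenceHypersurface b₀ u₀ ε₀ ε₁ X S ρ c d δ) {P : Amb n} (hP : P ∈ pipe n d ρ) {s : ℝ}
    (hs : s ∈ Ioo (-δ) δ) :
    ∀ᶠ q in 𝓝 (P, s), ∀ Q, Reaches X (axisSegment n ε₀)ᶜ q.1 q.2 Q →
      Q ∈ Metric.ball (0 : Amb n) ε₀ ∧ 0 < ‖q.1.snd‖ ∧ q.2 < ‖q.1.snd‖ ∧
      Q = pt q.1.fst ((‖q.1.snd‖ - q.2) • (‖q.1.snd‖⁻¹ • q.1.snd)) := by
  have hPn : ‖P.snd‖ = ρ := hP.2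
  have hP0 : P.snd ≠ 0 := by
    rw [← norm_ne_zero_iff, hPn]
    exact hS.ρ_pos.ne'
  have hc1 : ContinuousAt (fun q : Amb n × ℝ => q.1.snd) (P, s) := by fun_prop
  have hPb : P ∈ Metric.ball (0 : Amb n) ε₀ := by
    have := hS.pipe_part P hP 0 ⟨neg_lt_zero.2 hS.δ_pos, hS.δ_pos⟩ hS.ρ_pos.le
    rwa [sub_zero, div_self hS.ρ_pos.ne', one_smul, pt_fst_snd] at this
  have hend : ∀ᶠ q in 𝓝 (P, s), q.2 < 0 →
      pt q.1.fst ((1 - q.2 / ‖q.1.snd‖) • q.1.snd) ∈ Metric.ball (0 : Amb n) ε₀ := by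
    rcases lt_or_ge 0 s with h | h
    · filter_upwards [continuous_snd.continuousAt.eventually (lt_mem_nhds h)] with q hq hq'
      exact absurd hq' hq.not_gt
    · have h1 := hS.pipe_part P hP s hs (h.trans hS.ρ_pos.le)
      have h2 : ContinuousAt (fun q : Amb n × ℝ =>
          pt q.1.fst ((1 - q.2 / ‖q.1.snd‖) • q.1.snd)) (P, s) := by
        have h3 : ContinuousAt (fun q : Amb n × ℝ =>
            (q.1.fst, (1 - q.2 / ‖q.1.snd‖) • q.1.snd)) (P, s) := by
          have h5 : ContinuousAt (fun q : Amb n × ℝ => 1 - q.2 / ‖q.1.snd‖) (P, s) :=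
            continuousAt_const.sub (continuousAt_snd.div hc1.norm (norm_ne_zero_iff.2 hP0))
          have h6 : ContinuousAt (fun q : Amb n × ℝ => q.1.fst) (P, s) := by fun_prop
          exact h6.prodMk (h5.smul hc1)
        exact (WithLp.prodContinuousLinearEquiv 2 ℝ ℝ
          (EuclideanSpace ℝ (Fin n))).symm.continuous.continuousAt.comp h3
      have h4 : 1 - s / ‖P.snd‖ = (ρ - s) / ρ := by
        rw [hPn, sub_div, div_self hS.ρ_pos.ne']
      rw [← h4] at h1
      filter_upwards [h2.eventually (Metric.isOpen_ball.mem_nhds h1)] with q hq _ using hq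
  filter_upwards [hc1.eventually_ne hP0, hend,
    continuous_fst.continuousAt.eventually (Metric.isOpen_ball.mem_nhds hPb)] with q h1 h2 h3 Q hQ
  obtain ⟨⟨x, y⟩, s'⟩ := q
  have hy : 0 < ‖y‖ := norm_pos_iff.2 h1
  obtain ⟨h4, h5⟩ := hX.radial_flow (x := x) (y := y) h1 h3 h2 hQ
  have h6 : (1 - s' / ‖y‖) • y = (‖y‖ - s') • (‖y‖⁻¹ • y) := by
    rw [smul_smul]
    congr 1
    field_simp
  refine ⟨?_, hy, h4, h5.trans (congrArg (pt x) h6)⟩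
  rcases lt_or_ge s' 0 with h | h
  · rw [h5]
    exact h2 h
  · have h7 : pt x y ∈ Metric.ball (0 : Amb n) ε₀ := h3
    rw [mem_ball_zero_pt hX.ε₀_pos] at h7
    rw [h5, mem_ball_zero_pt hX.ε₀_pos, norm_smul, Real.norm_eq_abs, abs_of_nonneg
      (sub_nonneg.2 ((div_le_one hy).2 h4.le))]
    have h8 : (1 - s' / ‖y‖) * ‖y‖ = ‖y‖ - s' := by field_simp
    rw [h8]
    nlinarith [show s' < ‖y‖ from h4]

namespace IsAdmissibleFamily

/-- Near the origin the hypersurface is the graph `|y| = k(x)` of its profile. -/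
lemma norm_snd_eq (hX : IsTransverseField b₀ u₀ ε₀ ε₁ X) (hn : 2 ≤ n)
    (h : IsAdmissibleFamily ε₀ X S ρ c d δ T α Γ D u) (ht : t ∈ Ioc 0 T) {k : ℝ → ℝ} {a₁ a₂ : ℝ}
    (hD : D t = {P | ‖P.snd‖ < k P.fst}) (hk : ContDiffOn ℝ ∞ k (Ioo a₁ a₂))
    (h₁ : pt a₁ 0 ∈ Metric.ball (pt (-b₀) 0 : Amb n) ε₁)
    (h₂ : pt a₂ 0 ∈ Metric.ball (pt b₀ 0 : Amb n) ε₁) (hI : ∀ P ∈ Γ t, P.fst ∈ Icc a₁ a₂)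
    {Q : Amb n} (hQ : Q ∈ Γ t) (hQ0 : Q ∈ Metric.ball (0 : Amb n) ε₀) :
    Q.fst ∈ Ioo a₁ a₂ ∧ ‖Q.snd‖ = k Q.fst := by
  have hx : pt Q.fst 0 ∈ Metric.ball (0 : Amb n) ε₀ := by
    rw [← pt_fst_snd Q, mem_ball_zero_pt hX.ε₀_pos] at hQ0
    rw [mem_ball_zero_pt hX.ε₀_pos, norm_zero]
    nlinarith [sq_nonneg ‖Q.snd‖]
  have hmem : Q.fst ∈ Ioo a₁ a₂ := by
    obtain ⟨hl, hr⟩ := hI Q hQ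
    refine ⟨lt_of_le_of_ne hl fun e => ?_, lt_of_le_of_ne hr fun e => ?_⟩
    · rw [← e] at hx
      exact Set.disjoint_left.1 (hX.disjoint_balls hn).2.1 hx h₁
    · rw [e] at hx
      exact Set.disjoint_left.1 (hX.disjoint_balls hn).1 hx h₂
  refine ⟨hmem, ?_⟩
  rw [← h.boundary t ht, (h.alphaDomain t ht).1.frontier_eq] at hQ
  refine le_antisymm ?_ (by simpa [hD] using hQ.2)
  by_contra! hlt
  have hkc : ContinuousAt (fun P : Amb n => ‖P.snd‖ - k P.fst) Q := by
    refine ContinuousAt.sub (by fun_prop) (ContinuousAt.comp (g := k) ?_ (by fun_prop))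
    exact hk.continuousOn.continuousAt (isOpen_Ioo.mem_nhds hmem)
  obtain ⟨P, hP, hP'⟩ := ((mem_closure_iff_frequently.1 hQ.1).and_eventually
    (hkc.eventually (lt_mem_nhds (sub_pos.2 hlt)))).exists
  rw [hD] at hP
  rw [mem_ofPred_eq] at hP
  linarith

/-- The neck is not thinner than `min α ρ`: a cylinder of smaller radius would meet the hypersurface
in the neck and in both caps. -/
lemma lt_norm_snd (hX : IsTransverseField b₀ u₀ ε₀ ε₁ X) (hn : 2 ≤ n)
    (hS : IsReferenceHypersurface b₀ u₀ ε₀ ε₁ X S ρ c d δ)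
    (h : IsAdmissibleFamily ε₀ X S ρ c d δ T α Γ D u) (ht : t ∈ Ioc 0 T)
    {Q : Amb n} (hQ : Q ∈ Γ t) (hQ0 : Q ∈ Metric.ball (0 : Amb n) ε₀) (h0 : 0 < ‖Q.snd‖)
    (hρ : ‖Q.snd‖ ≤ ρ) : α t < ‖Q.snd‖ := by
  by_contra! hle
  obtain ⟨-, k, -, -, -, hα⟩ := h.alphaDomain t ht
  have ht' : t ∈ Icc 0 T := ⟨ht.1.le, ht.2⟩
  obtain ⟨hr1, hr2, -⟩ := h.right_cap hn hX hS ht' hρ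
  obtain ⟨hl1, hl2, -⟩ := h.left_cap hn hX hS ht' hρ
  have hcard := (hα _ ⟨h0, hle⟩).1
  rw [h.boundary t ht] at hcard
  obtain ⟨x₁, x₂, -, e⟩ := Set.ncard_eq_two.1 hcard
  have hmem : ∀ x, pt x Q.snd ∈ Γ t → x = x₁ ∨ x = x₂ := fun x hx => by
    have : x ∈ {x : ℝ | ∃ y : EuclideanSpace ℝ (Fin n), ‖y‖ = ‖Q.snd‖ ∧ pt x y ∈ Γ t} :=
      ⟨_, rfl, hx⟩
    rw [e] at this
    simpa using this
  obtain ⟨d1, d2, d3⟩ := hX.disjoint_balls hn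
  have n1 : c - u (pt c Q.snd) t ≠ Q.fst := fun e => by
    rw [e, pt_fst_snd] at hr2
    exact Set.disjoint_left.1 d1 hQ0 hr2
  have n2 : -c + u (pt (-c) Q.snd) t ≠ Q.fst := fun e => by
    rw [e, pt_fst_snd] at hl2
    exact Set.disjoint_left.1 d2 hQ0 hl2
  have n3 : c - u (pt c Q.snd) t ≠ -c + u (pt (-c) Q.snd) t := fun e => by
    rw [e] at hr2
    exact Set.disjoint_left.1 d3 hr2 hl2
  have m1 := hmem _ hr1
  have m2 := hmem _ hl1
  have m3 := hmem Q.fst (by rwa [pt_fst_snd])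
  grind

end IsAdmissibleFamily

/-- Near the pipe the level set operators of the neck differ by the difference of the curvatures of
the cross sections, which the width of the neck controls. -/
lemma hasGrowthBound_of_mem_pipe (hn : 2 ≤ n) (hu₀ : IsInitialProfile n b₀ u₀)
    (hX : IsTransverseField b₀ u₀ ε₀ ε₁ X)
    (hS : IsReferenceHypersurface b₀ u₀ ε₀ ε₁ X S ρ c d δ) (hα : ∀ t ∈ Ioc 0 T, 0 < α t)
    (h₁ : IsAdmissibleFamily ε₀ X S ρ c d δ T α Γ₁ D₁ u₁)
    (h₂ : IsAdmissibleFamily ε₀ X S ρ c d δ T α Γ₂ D₂ u₂)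
    (hE₁ : EvolvesByForcedMCF A T Γ₁ D₁) (hE₂ : EvolvesByForcedMCF A T Γ₂ D₂)
    {a : ℝ} (ha : a ∈ Ico 0 T) {P : Amb n} (hP : P ∈ S) (hPf : P ∈ pipe n d ρ) :
    HasGrowthBound S α u₁ u₂ a P := by
  have ha' : a ∈ Icc 0 T := ⟨ha.1, ha.2.le⟩
  obtain ⟨C, hC, hop⟩ := exists_levelSetOp_radialFunction_le n
  have hρ := hS.ρ_pos
  have hd₁ := h₁.eventually_time ha hP
    (eventually_eventually_nhds.2 (hS.eventually_radial hX hPf (h₁.mem_Ioo ha' hP)))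
  have hd₂ := h₂.eventually_time ha hP
    (eventually_eventually_nhds.2 (hS.eventually_radial hX hPf (h₂.mem_Ioo ha' hP)))
  refine ⟨C * (1 + 1 / ρ ^ 2), by positivity, ?_⟩
  filter_upwards [hd₁, hd₂] with ⟨P', t⟩ k₁ k₂ hP' hat hmax hpos
  obtain ⟨ht, hc₁⟩ := k₁ hP' hat
  obtain ⟨-, hc₂⟩ := k₂ hP' hat
  simp only at ht hc₁ hc₂ hmax hpos hat hP' ⊢
  have ht' : t ∈ Ioc 0 T := ⟨ht.1, ht.2.le⟩
  have ht'' : t ∈ Icc 0 T := ⟨ht.1.le, ht.2.le⟩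
  obtain ⟨Q₁, hΓ₁, hr₁⟩ := h₁.exists_reaches hn hu₀ hX hS ht' hP'
  obtain ⟨Q₂, hΓ₂, hr₂⟩ := h₂.exists_reaches hn hu₀ hX hS ht' hP'
  obtain ⟨hb₁, hy, hu₁, e₁⟩ := hc₁.self_of_nhds Q₁ hr₁
  obtain ⟨hb₂, -, hu₂, e₂⟩ := hc₂.self_of_nhds Q₂ hr₂
  obtain ⟨k, a₁, a₂, hD, -, -, hk, hla, hra, -, hI, -⟩ := h₂.exists_profile hn hu₀ hX hS ht'
  have hgraph : ∀ Q ∈ Γ₂ t, Q ∈ Metric.ball (0 : Amb n) ε₀ → _ := fun Q hQ hQ0 =>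
    h₂.norm_snd_eq hX hn ht' hD hk hla hra hI hQ hQ0
  set x := P'.fst with hx
  set θ := ‖P'.snd‖⁻¹ • P'.snd with hθdef
  set r₁ := ‖P'.snd‖ - u₁ P' t with hr₁def
  set r₂ := ‖P'.snd‖ - u₂ P' t with hr₂def
  have hθ : ‖θ‖ = 1 := by
    rw [hθdef, norm_smul, norm_inv, norm_norm, inv_mul_cancel₀ hy.ne']
  have hr₁0 : 0 < r₁ := sub_pos.2 hu₁
  have hr₂0 : 0 < r₂ := sub_pos.2 hu₂
  have hnorm : ∀ r, 0 < r → ‖r • θ‖ = r := fun r hr => by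
    rw [norm_smul, hθ, mul_one, Real.norm_eq_abs, abs_of_pos hr]
  have hsmul : ∀ r : ℝ, 0 < r → r⁻¹ • r • θ = θ := fun r hr => by
    rw [smul_smul, inv_mul_cancel₀ hr.ne', one_smul]
  have hn₁ : ‖Q₁.snd‖ = r₁ := by rw [e₁]; exact hnorm _ hr₁0
  have hn₂ : ‖Q₂.snd‖ = r₂ := by rw [e₂]; exact hnorm _ hr₂0
  have hs₁ : Q₁.snd ≠ 0 := by rw [← norm_ne_zero_iff, hn₁]; exact hr₁0.ne'
  have hs₂ : Q₂.snd ≠ 0 := by rw [← norm_ne_zero_iff, hn₂]; exact hr₂0.ne'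
  have hxI : x ∈ Ioo a₁ a₂ := by
    have := (hgraph Q₂ hΓ₂ hb₂).1
    rwa [e₂] at this
  have hkx : ContDiffAt ℝ 2 k x :=
    (hk.contDiffAt (isOpen_Ioo.mem_nhds hxI)).of_le two_le_smooth
  have hM : r₂ - r₁ = u₁ P' t - u₂ P' t := by rw [hr₁def, hr₂def]; ring
  have key := deriv_sub_deriv_le_of_isMax hn hu₀ hX hS h₁ h₂ hE₁ hE₂ ht hP' hmax hr₁ hr₂
    (f := radialFunction n k)
    (contDiffAt_radialFunction (by rw [e₁]; exact hkx) hs₁)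
    (contDiffAt_radialFunction (by rw [e₂]; exact hkx) hs₂)
    (by
      filter_upwards [Metric.isOpen_ball.mem_nhds hb₂] with Q hQ hQΓ
      rw [radialFunction, (hgraph Q hQΓ hQ).2, sub_self])
    (by
      have hXQ : X Q₂ = pt 0 (-θ) := by
        have := hX.near_origin Q₂.fst Q₂.snd hs₂ (by rwa [pt_fst_snd])
        rw [pt_fst_snd, hn₂] at this
        rw [this, e₂, pt_snd, hsmul _ hr₂0]
      rw [gradient_radialFunction (by rw [e₂]; exact hkx.differentiableAt (by simp)) hs₂, hXQ, hn₂,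
        e₂, pt_snd, hsmul _ hr₂0]
      simp [pt, WithLp.prod_inner_apply, hθ])
    (by
      have hlim : Tendsto (fun P => (P, u₂ P t)) (𝓝[S] P') (𝓝 (P', u₂ P' t)) :=
        (tendsto_id.mono_left nhdsWithin_le_nhds).prodMk_nhds (h₂.continuousOn_slice ht'' P' hP')
      have hev := eventually_nhdsWithin_iff.1 (hlim.eventually hc₂)
      filter_upwards [hc₁, (continuous_fst.tendsto (P', u₁ P' t)).eventually hev]
        with p hp₁ hp₂ hpS Q hQ
      obtain ⟨R, hR, hrR⟩ := h₂.exists_reaches hn hu₀ hX hS ht' hpS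
      obtain ⟨-, hy, hs, e⟩ := hp₁ Q hQ
      obtain ⟨hRb, -, hs', e'⟩ := hp₂ hpS R hrR
      have hunit : ∀ r, 0 < r → ‖r • (‖p.1.snd‖⁻¹ • p.1.snd)‖ = r := fun r hr => by
        rw [norm_smul, norm_smul, norm_inv, norm_norm, inv_mul_cancel₀ hy.ne', mul_one,
          Real.norm_eq_abs, abs_of_pos hr]
      have hkR := (hgraph R hR hRb).2
      rw [e', pt_snd, pt_fst, hunit _ (sub_pos.2 hs')] at hkR
      rw [e, radialFunction, pt_snd, pt_fst, hunit _ (sub_pos.2 hs), ← hkR]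
      ring)
  rw [e₁, e₂] at key
  refine (key.trans (hop A k x r₁ r₂ θ hkx hθ hr₁0 (by linarith))).trans ?_
  have hwide : ∀ r, 0 < r → (r ≤ ρ → α t < r) → min (α t) ρ ≤ r := fun r _ h => by
    rcases le_or_gt r ρ with h' | h'
    · exact (min_le_left _ _).trans (h h').le
    · exact (min_le_right _ _).trans h'.le
  have w₁ := hwide r₁ hr₁0 fun h => by
    have := h₁.lt_norm_snd hX hn hS ht' hΓ₁ hb₁ (by rw [hn₁]; exact hr₁0) (by rw [hn₁]; exact h)
    rwa [hn₁] at this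
  have w₂ := hwide r₂ hr₂0 fun h => by
    have := h₂.lt_norm_snd hX hn hS ht' hΓ₂ hb₂ (by rw [hn₂]; exact hr₂0) (by rw [hn₂]; exact h)
    rwa [hn₂] at this
  have hα0 := hα t ht'
  have hμ : 0 < min (α t) ρ := lt_min hα0 hρ
  have hsq : min (α t) ρ ^ 2 ≤ r₁ * r₂ := by nlinarith
  have h1 : 1 / (r₁ * r₂) ≤ 1 / min (α t) ρ ^ 2 :=
    one_div_le_one_div_of_le (by positivity) hsq
  have h2 : 1 / min (α t) ρ ^ 2 ≤ (1 + 1 / ρ ^ 2) * (1 + 1 / α t ^ 2) := by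
    have hA : 0 < 1 / α t ^ 2 := by positivity
    have hR : 0 < 1 / ρ ^ 2 := by positivity
    rcases min_cases (α t) ρ with ⟨e, -⟩ | ⟨e, -⟩ <;> rw [e] <;> nlinarith
  rw [hM, div_eq_mul_one_div, mul_comm (u₁ P' t - u₂ P' t), ← mul_assoc,
    mul_assoc C (1 + 1 / ρ ^ 2)]
  exact mul_le_mul_of_nonneg_right (mul_le_mul_of_nonneg_left (h1.trans h2) hC) hpos.le

/-- The growth bound holds near every point of the reference hypersurface. -/
lemma hasGrowthBound (hn : 2 ≤ n) (hu₀ : IsInitialProfile n b₀ u₀)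
    (hX : IsTransverseField b₀ u₀ ε₀ ε₁ X)
    (hS : IsReferenceHypersurface b₀ u₀ ε₀ ε₁ X S ρ c d δ) (hα : ∀ t ∈ Ioc 0 T, 0 < α t)
    (h₁ : IsAdmissibleFamily ε₀ X S ρ c d δ T α Γ₁ D₁ u₁)
    (h₂ : IsAdmissibleFamily ε₀ X S ρ c d δ T α Γ₂ D₂ u₂)
    (hE₁ : EvolvesByForcedMCF A T Γ₁ D₁) (hE₂ : EvolvesByForcedMCF A T Γ₂ D₂)
    {a : ℝ} (ha : a ∈ Ico 0 T) (heq : ∀ P ∈ S, u₁ P a = u₂ P a) {P : Amb n} (hP : P ∈ S) :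
    HasGrowthBound S α u₁ u₂ a P := by
  have ha' : a ∈ Icc 0 T := ⟨ha.1, ha.2.le⟩
  by_cases hPf : P ∈ flatPart n c d ρ
  · rcases hPf with (hPf | hPf) | hPf
    · obtain ⟨hx, hy⟩ := hPf
      have e : P = pt c P.snd := Amb.ext hx rfl
      have hc := h₁.right_cap hn hX hS ha' hy
      rw [← e] at hc
      refine hasGrowthBound_of_const hn hu₀ hX hS h₁ h₂ hE₁ hE₂ ha heq hP hc.2.2 (e := pt (-1) 0) ?_
      filter_upwards [Metric.isOpen_ball.mem_nhds hc.2.1] with Q hQ using hX.near_right Q hQ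
    · obtain ⟨hx, hy⟩ := hPf
      have e : P = pt (-c) P.snd := Amb.ext hx rfl
      have hc := h₁.left_cap hn hX hS ha' hy
      rw [← e] at hc
      refine hasGrowthBound_of_const hn hu₀ hX hS h₁ h₂ hE₁ hE₂ ha heq hP hc.2.2 (e := pt 1 0) ?_
      filter_upwards [Metric.isOpen_ball.mem_nhds hc.2.1] with Q hQ using hX.near_left Q hQ
    · exact hasGrowthBound_of_mem_pipe hn hu₀ hX hS hα h₁ h₂ hE₁ hE₂ ha hP hPf
  · exact hasGrowthBound_of_notMem_flatPart hn hu₀ hX hS h₁ h₂ hE₁ hE₂ ha heq hP hPf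

end Pipe

/-! ### The maximum over a compact set -/

section MaxAbs

variable {Y : Type*} [TopologicalSpace Y] {S : Set Y} {w : Y → ℝ → ℝ} {s t : ℝ}

/-- The maximum of `|w(·, t)|` over `S`. -/
noncomputable def maxAbs (S : Set Y) (w : Y → ℝ → ℝ) (t : ℝ) : ℝ :=
  sSup ((fun P => |w P t|) '' S)

lemma exists_eq_maxAbs (hS : IsCompact S) (hne : S.Nonempty)
    (hw : ContinuousOn (fun P => w P t) S) :
    ∃ P ∈ S, maxAbs S w t = |w P t| ∧ ∀ P' ∈ S, |w P' t| ≤ |w P t| := by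
  obtain ⟨P, hP, hmax⟩ := hS.exists_isMaxOn hne hw.abs
  refine ⟨P, hP, IsGreatest.csSup_eq ⟨mem_image_of_mem _ hP, ?_⟩, fun P' hP' => hmax hP'⟩
  rintro - ⟨P', hP', rfl⟩
  exact hmax hP'

lemma maxAbs_le_add (hS : IsCompact S) (hne : S.Nonempty)
    (hs : ContinuousOn (fun P => w P s) S) (ht : ContinuousOn (fun P => w P t) S) {K : ℝ}
    (hK : ∀ P ∈ S, |w P s - w P t| ≤ K) : maxAbs S w s ≤ maxAbs S w t + K := by
  obtain ⟨P, hP, e, -⟩ := exists_eq_maxAbs hS hne hs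
  obtain ⟨P', -, e', hmax⟩ := exists_eq_maxAbs hS hne ht
  have h1 := abs_sub_abs_le_abs_sub (w P s) (w P t)
  have h2 := hK P hP
  have h3 := hmax P hP
  linarith

lemma abs_maxAbs_sub_le (hS : IsCompact S) (hne : S.Nonempty)
    (hs : ContinuousOn (fun P => w P s) S) (ht : ContinuousOn (fun P => w P t) S) {K : ℝ}
    (hK : ∀ P ∈ S, |w P s - w P t| ≤ K) : |maxAbs S w s - maxAbs S w t| ≤ K := by
  have h1 := maxAbs_le_add hS hne hs ht hK
  have h2 := maxAbs_le_add hS hne ht hs fun P hP => by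
    rw [abs_sub_comm]
    exact hK P hP
  exact abs_le.2 ⟨by linarith, by linarith⟩

lemma continuousOn_slice_of_uncurry {I : Set ℝ}
    (hw : ContinuousOn (Function.uncurry w) (S ×ˢ I)) (ht : t ∈ I) :
    ContinuousOn (fun P => w P t) S :=
  ContinuousOn.comp (g := Function.uncurry w) (f := fun P => (P, t)) hw
    (Continuous.prodMk_left t).continuousOn fun _ hP => ⟨hP, ht⟩

end MaxAbs

lemma continuousOn_maxAbs {Y : Type*} [PseudoMetricSpace Y] {S : Set Y} {w : Y → ℝ → ℝ} {I : Set ℝ}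
    (hS : IsCompact S) (hne : S.Nonempty) (hI : IsCompact I)
    (hw : ContinuousOn (Function.uncurry w) (S ×ˢ I)) : ContinuousOn (maxAbs S w) I := by
  have hu := Metric.uniformContinuousOn_iff_le.1
    ((hS.prod hI).uniformContinuousOn_of_continuous hw)
  refine Metric.continuousOn_iff'.2 fun t ht ε hε => ?_
  obtain ⟨η, hη, h⟩ := hu (ε / 2) (half_pos hε)
  filter_upwards [self_mem_nhdsWithin, mem_nhdsWithin_of_mem_nhds (Metric.closedBall_mem_nhds t hη)]
    with s hs hst
  refine lt_of_le_of_lt ?_ (half_lt_self hε)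
  refine abs_maxAbs_sub_le hS hne (continuousOn_slice_of_uncurry hw hs)
    (continuousOn_slice_of_uncurry hw ht) fun P hP => h (P, s) ⟨hP, hs⟩ (P, t) ⟨hP, ht⟩ ?_
  rw [Prod.dist_eq, dist_self]
  exact max_le hη.le hst

/-! ### A Gronwall inequality with an integrable rate -/

section Gronwall

open MeasureTheory

lemma abs_log_sub_log_le {m x y : ℝ} (hm : 0 < m) (hx : m ≤ x) (hy : m ≤ y) :
    |Real.log x - Real.log y| ≤ m⁻¹ * |x - y| := by
  have key : ∀ x y : ℝ, m ≤ x → m ≤ y → Real.log x - Real.log y ≤ m⁻¹ * |x - y| := by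
    intro x y hx hy
    have hx0 : 0 < x := hm.trans_le hx
    have hy0 : 0 < y := hm.trans_le hy
    rw [← Real.log_div hx0.ne' hy0.ne']
    refine (Real.log_le_sub_one_of_pos (div_pos hx0 hy0)).trans ?_
    have e : x / y - 1 = y⁻¹ * (x - y) := by field_simp
    rw [e]
    exact (mul_le_mul_of_nonneg_left (le_abs_self _) (inv_nonneg.2 hy0.le)).trans
      (mul_le_mul_of_nonneg_right (inv_anti₀ hm hy) (abs_nonneg _))
  refine abs_le.2 ⟨?_, key x y hx hy⟩
  have := key y x hy hx
  rw [abs_sub_comm] at this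
  linarith

/-- A positive function whose logarithm grows at an integrable rate does not start from zero. Only
the almost everywhere derivative enters, which suffices since the logarithm is locally Lipschitz. -/
lemma pos_of_deriv_le_mul {M L : ℝ → ℝ} {a b : ℝ} (hab : a < b) (hc : ContinuousOn M (Icc a b))
    (hpos : ∀ t ∈ Ioc a b, 0 < M t) (hlip : ∀ p ∈ Ioo a b, ∃ K, LipschitzOnWith K M (Icc p b))
    (hL : IntervalIntegrable L volume a b) (hL0 : ∀ t ∈ Ioc a b, 0 ≤ L t)
    (hM : ∀ t ∈ Ioo a b, DifferentiableAt ℝ M t → deriv M t ≤ L t * M t) : 0 < M a := by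
  have hb : 0 < M b := hpos b ⟨hab, le_rfl⟩
  set I := ∫ t in a..b, L t with hI
  have key : ∀ p ∈ Ioo a b, M b * Real.exp (-I) ≤ M p := by
    intro p hp
    have hsub : Icc p b ⊆ Ioc a b := fun t ht => ⟨hp.1.trans_le ht.1, ht.2⟩
    obtain ⟨t₀, ht₀, hmin⟩ := isCompact_Icc.exists_isMinOn (nonempty_Icc.2 hp.2.le)
      (hc.mono (hsub.trans Ioc_subset_Icc_self))
    have hm : 0 < M t₀ := hpos _ (hsub ht₀)
    obtain ⟨K, hK⟩ := hlip p hp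
    have hlog : LipschitzOnWith (Real.toNNReal ((M t₀)⁻¹ * K)) (fun t => Real.log (M t))
        (uIcc p b) := by
      rw [uIcc_of_le hp.2.le]
      refine LipschitzOnWith.of_dist_le_mul fun s hs t ht => ?_
      rw [Real.coe_toNNReal _ (by positivity), mul_assoc]
      refine (abs_log_sub_log_le hm (hmin hs) (hmin ht)).trans ?_
      exact mul_le_mul_of_nonneg_left (hK.dist_le_mul s hs t ht) (by positivity)
    have hac := hlog.absolutelyContinuousOnInterval
    have hLp : IntervalIntegrable L volume p b :=
      hL.mono_set (by
        rw [uIcc_of_le hp.2.le, uIcc_of_le hab.le]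
        exact Icc_subset_Icc_left hp.1.le)
    have hle : ∫ t in p..b, deriv (fun t => Real.log (M t)) t ≤ ∫ t in p..b, L t := by
      refine intervalIntegral.integral_mono_ae_restrict hp.2.le hac.intervalIntegrable_deriv hLp ?_
      rw [EventuallyLE, ae_restrict_iff' measurableSet_Icc]
      have hne : ∀ x : ℝ, ∀ᵐ t : ℝ, t ≠ x := fun x => by
        simp [ae_iff, measure_singleton]
      filter_upwards [hac.ae_differentiableAt, hne p, hne b] with t h1 h2 h3 ht
      have h4 := h1 (by rwa [uIcc_of_le hp.2.le])
      have ht' : t ∈ Ioo p b := ⟨lt_of_le_of_ne ht.1 h2.symm, lt_of_le_of_ne ht.2 h3⟩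
      have htM : 0 < M t := hpos t (hsub ht)
      have h5 : M =ᶠ[𝓝 t] fun t => Real.exp (Real.log (M t)) := by
        filter_upwards [Ioo_mem_nhds ht'.1 ht'.2] with s hs
        rw [Real.exp_log (hpos s (hsub (Ioo_subset_Icc_self hs)))]
      have h6 : DifferentiableAt ℝ M t := h4.exp.congr_of_eventuallyEq h5
      rw [deriv.log h6 htM.ne', div_le_iff₀ htM]
      exact hM t ⟨hp.1.trans ht'.1, ht'.2⟩ h6
    have hmono : ∫ t in p..b, L t ≤ I := by
      refine intervalIntegral.integral_mono_interval hp.1.le hp.2.le le_rfl ?_ hL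
      rw [EventuallyLE, ae_restrict_iff' measurableSet_Ioc]
      exact Eventually.of_forall fun t ht => hL0 t ht
    rw [hac.integral_deriv_eq_sub] at hle
    have hMp : 0 < M p := hpos p ⟨hp.1, hp.2.le⟩
    rw [← Real.log_le_log_iff (by positivity) hMp, Real.log_mul hb.ne' (Real.exp_pos _).ne',
      Real.log_exp]
    linarith
  have hlim : Tendsto M (𝓝[>] a) (𝓝 (M a)) :=
    (hc a ⟨le_rfl, hab.le⟩).mono_of_mem_nhdsWithin
      (mem_of_superset (Ioo_mem_nhdsGT hab) Ioo_subset_Icc_self)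
  have hge : M b * Real.exp (-I) ≤ M a := by
    refine ge_of_tendsto hlim ?_
    filter_upwards [Ioo_mem_nhdsGT hab] with p hp using key p hp
  exact lt_of_lt_of_le (by positivity) hge

end Gronwall

/-! ### Uniqueness -/

section Uniqueness

variable {n : ℕ} {b₀ : ℝ} {u₀ : ℝ → ℝ} {ε₀ ε₁ : ℝ} {X : Amb n → Amb n} {S : Set (Amb n)}
  {ρ c d δ A T : ℝ} {α : ℝ → ℝ} {Γ D Γ₁ Γ₂ D₁ D₂ : ℝ → Set (Amb n)} {u u₁ u₂ : Amb n → ℝ → ℝ}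
  {t : ℝ}

lemma IsAdmissibleFamily.exists_deriv_bound (hS : IsCompact S)
    (h : IsAdmissibleFamily ε₀ X S ρ c d δ T α Γ D u) {p q : ℝ} (hp : 0 < p) (hq : q < T) :
    ∃ K : ℝ, 0 ≤ K ∧ ∀ P ∈ S, ∀ t ∈ Icc p q, |deriv (u P) t| ≤ K := by
  suffices H : ∃ K : ℝ, 0 ≤ K ∧ ∀ z ∈ S ×ˢ Icc p q, z.1 ∈ S → z.2 ∈ Ioo 0 T →
      |deriv (u z.1) z.2| ≤ K by
    obtain ⟨K, hK, H⟩ := H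
    exact ⟨K, hK, fun P hP t ht =>
      H (P, t) ⟨hP, ht⟩ hP ⟨hp.trans_le ht.1, ht.2.trans_lt hq⟩⟩
  refine (hS.prod isCompact_Icc).induction_on (p := fun Z => ∃ K : ℝ, 0 ≤ K ∧ ∀ z ∈ Z, z.1 ∈ S →
    z.2 ∈ Ioo 0 T → |deriv (u z.1) z.2| ≤ K) ⟨0, le_rfl, by simp⟩ ?_ ?_ ?_
  · rintro Z Z' hZ ⟨K, hK, H⟩
    exact ⟨K, hK, fun z hz => H z (hZ hz)⟩
  · rintro Z Z' ⟨K, hK, H⟩ ⟨K', hK', H'⟩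
    refine ⟨max K K', hK.trans (le_max_left _ _), fun z hz h1 h2 => ?_⟩
    rcases hz with hz | hz
    · exact (H z hz h1 h2).trans (le_max_left _ _)
    · exact (H' z hz h1 h2).trans (le_max_right _ _)
  · rintro ⟨P, t⟩ ⟨hP, ht⟩
    have htT : t ∈ Ioo 0 T := ⟨hp.trans_le ht.1, ht.2.trans_lt hq⟩
    have hmem : (P, t) ∈ S ×ˢ Ioc 0 T := ⟨hP, Ioo_subset_Ioc_self htT⟩
    have hc : ContDiffWithinAt ℝ (0 + 1) (Function.uncurry u) (S ×ˢ Ioc 0 T) (P, t) :=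
      (h.smooth (P, t) hmem).of_le (by rw [zero_add]; exact_mod_cast le_top)
    obtain ⟨N, hN, -, -, f', hf', hcf⟩ :=
      (contDiffWithinAt_succ_iff_hasFDerivWithinAt' (by simp)).1 hc
    rw [insert_eq_of_mem hmem] at hN
    have hb := (hcf.continuousWithinAt.norm).eventually (gt_mem_nhds (lt_add_one ‖f' (P, t)‖))
    have hev := eventually_nhdsWithin_iff.1 (hb.and hN)
    refine ⟨_, mem_nhdsWithin_of_mem_nhds hev, (‖f' (P, t)‖ + 1) * ‖((0 : Amb n), (1 : ℝ))‖,
      by positivity, fun z hz hzS hzt => ?_⟩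
    obtain ⟨h1, h2⟩ := hz ⟨hzS, Ioo_subset_Ioc_self hzt⟩
    have h3 : HasDerivWithinAt (fun r => (z.1, r)) ((0 : Amb n), (1 : ℝ)) (Ioc 0 T) z.2 :=
      ((hasDerivAt_const z.2 z.1).prodMk (hasDerivAt_id z.2)).hasDerivWithinAt
    have hmaps : MapsTo (fun r => (z.1, r)) (Ioc 0 T) (S ×ˢ Ioc 0 T) := fun r hr => ⟨hzS, hr⟩
    have h4 := (hf' z h2).comp_hasDerivWithinAt z.2 h3 hmaps
    have h5 := h4.hasDerivAt (Ioc_mem_nhds hzt.1 hzt.2)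
    have h6 : deriv (u z.1) z.2 = f' z (0, 1) := h5.deriv
    rw [h6]
    exact ((f' z).le_opNorm _).trans (mul_le_mul_of_nonneg_right h1.le (norm_nonneg _))

lemma IsAdmissibleFamily.exists_time_lipschitz (hS : IsCompact S)
    (h : IsAdmissibleFamily ε₀ X S ρ c d δ T α Γ D u) {p q : ℝ} (hp : 0 < p) (hq : q < T) :
    ∃ K : ℝ, 0 ≤ K ∧ ∀ P ∈ S, ∀ s ∈ Icc p q, ∀ t ∈ Icc p q, |u P s - u P t| ≤ K * |s - t| := by
  obtain ⟨K, hK, H⟩ := h.exists_deriv_bound hS hp hq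
  refine ⟨K, hK, fun P hP s hs t ht => ?_⟩
  refine (convex_Icc p q).norm_image_sub_le_of_norm_deriv_le (f := u P) (fun r hr => ?_)
    (fun r hr => H P hP r hr) ht hs
  exact (h.contDiffAt_time ⟨hp.trans_le hr.1, hr.2.trans_lt hq⟩ hP).differentiableAt (by simp)

/-- Local growth bounds at the points of a compact set, with one constant and one time interval. -/
lemma exists_uniform_growth_bound (hS : IsCompact S) {a : ℝ}
    (h : ∀ P ∈ S, HasGrowthBound S α u₁ u₂ a P) :
    ∃ C, 0 ≤ C ∧ ∃ η, 0 < η ∧ ∀ P ∈ S, ∀ t ∈ Ioo a (a + η),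
      (∀ P' ∈ S, u₁ P' t - u₂ P' t ≤ u₁ P t - u₂ P t) → 0 < u₁ P t - u₂ P t →
      deriv (u₁ P) t - deriv (u₂ P) t ≤ C * (1 + 1 / α t ^ 2) * (u₁ P t - u₂ P t) := by
  suffices H : ∃ C, 0 ≤ C ∧ ∃ η, 0 < η ∧ ∀ P ∈ S, P ∈ S → ∀ t ∈ Ioo a (a + η),
      (∀ P' ∈ S, u₁ P' t - u₂ P' t ≤ u₁ P t - u₂ P t) → 0 < u₁ P t - u₂ P t →
      deriv (u₁ P) t - deriv (u₂ P) t ≤ C * (1 + 1 / α t ^ 2) * (u₁ P t - u₂ P t) by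
    obtain ⟨C, hC, η, hη, H⟩ := H
    exact ⟨C, hC, η, hη, fun P hP => H P hP hP⟩
  refine hS.induction_on (p := fun Z => ∃ C, 0 ≤ C ∧ ∃ η, 0 < η ∧ ∀ P ∈ Z, P ∈ S →
      ∀ t ∈ Ioo a (a + η), (∀ P' ∈ S, u₁ P' t - u₂ P' t ≤ u₁ P t - u₂ P t) →
      0 < u₁ P t - u₂ P t →
      deriv (u₁ P) t - deriv (u₂ P) t ≤ C * (1 + 1 / α t ^ 2) * (u₁ P t - u₂ P t))
    ⟨0, le_rfl, 1, one_pos, by simp⟩ ?_ ?_ ?_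
  · rintro Z Z' hZ ⟨C, hC, η, hη, H⟩
    exact ⟨C, hC, η, hη, fun P hP => H P (hZ hP)⟩
  · rintro Z Z' ⟨C, hC, η, hη, H⟩ ⟨C', hC', η', hη', H'⟩
    refine ⟨max C C', hC.trans (le_max_left _ _), min η η', lt_min hη hη',
      fun P hP hPS t ht hmax hpos => ?_⟩
    have hα : 0 ≤ 1 + 1 / α t ^ 2 := by positivity
    rcases hP with hP | hP
    · refine (H P hP hPS t ⟨ht.1, ht.2.trans_le (by gcongr; exact min_le_left _ _)⟩ hmax hpos).trans ?_
      gcongr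
      exact le_max_left _ _
    · refine (H' P hP hPS t ⟨ht.1, ht.2.trans_le (by gcongr; exact min_le_right _ _)⟩ hmax
        hpos).trans ?_
      gcongr
      exact le_max_right _ _
  · intro P hP
    obtain ⟨C, hC, H⟩ := h P hP
    obtain ⟨η, hη, hηH⟩ := Metric.eventually_nhds_iff_ball.1 H
    refine ⟨Metric.ball P η, mem_nhdsWithin_of_mem_nhds (Metric.ball_mem_nhds P hη), C, hC, η, hη,
      fun P' hP' hPS t ht hmax hpos => hηH (P', t) ?_ hPS ht.1 hmax hpos⟩
    rw [Metric.mem_ball, Prod.dist_eq]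
    refine max_lt hP' ?_
    rw [Real.dist_eq, abs_of_pos (sub_pos.2 ht.1)]
    linarith [ht.2]

/-- The maximum of `|u₁ - u₂|` vanishes at the last time `a` at which the families agree, and grows
afterwards at a rate that is integrable up to `a`; so it cannot become positive. -/
lemma eqOn_of_hasGrowthBound (hn : 2 ≤ n) (hu₀ : IsInitialProfile n b₀ u₀)
    (hX : IsTransverseField b₀ u₀ ε₀ ε₁ X)
    (hS : IsReferenceHypersurface b₀ u₀ ε₀ ε₁ X S ρ c d δ) (hα : ∀ t ∈ Ioc 0 T, 0 < α t)
    (h₁ : IsAdmissibleFamily ε₀ X S ρ c d δ T α Γ₁ D₁ u₁)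
    (h₂ : IsAdmissibleFamily ε₀ X S ρ c d δ T α Γ₂ D₂ u₂)
    (hE₁ : EvolvesByForcedMCF A T Γ₁ D₁) (hE₂ : EvolvesByForcedMCF A T Γ₂ D₂)
    (hint : MeasureTheory.IntegrableOn (fun t => 1 / α t ^ 2) (Ioc 0 T) MeasureTheory.volume)
    (h0 : ∀ P ∈ S, u₁ P 0 = u₂ P 0) : ∀ t ∈ Ico 0 T, ∀ P ∈ S, u₁ P t = u₂ P t := by
  intro t₁ ht₁
  let w : Amb n → ℝ → ℝ := fun P t => u₁ P t - u₂ P t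
  have hwc : ContinuousOn (Function.uncurry w) (S ×ˢ Icc 0 T) :=
    h₁.continuousOn.sub h₂.continuousOn
  have hne := hS.connected.nonempty
  have hcs : ∀ t ∈ Icc 0 T, ContinuousOn (fun P => w P t) S := fun t ht =>
    continuousOn_slice_of_uncurry hwc ht
  set M := maxAbs S w with hMdef
  have hMc : ContinuousOn M (Icc 0 T) := continuousOn_maxAbs hS.compact hne isCompact_Icc hwc
  have hM0 : ∀ t ∈ Icc 0 T, 0 ≤ M t := fun t ht => by
    obtain ⟨P, -, e, -⟩ := exists_eq_maxAbs hS.compact hne (hcs t ht)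
    rw [hMdef, e]
    exact abs_nonneg _
  have hzero : ∀ t ∈ Icc 0 T, M t = 0 → ∀ P ∈ S, u₁ P t = u₂ P t := fun t ht hMt P hP => by
    obtain ⟨P', -, e, hmax⟩ := exists_eq_maxAbs hS.compact hne (hcs t ht)
    have := hmax P hP
    rw [← e, ← hMdef, hMt] at this
    exact sub_eq_zero.1 (abs_nonpos_iff.1 this)
  by_cases hM1 : M t₁ = 0
  · exact hzero t₁ ⟨ht₁.1, ht₁.2.le⟩ hM1
  exfalso
  -- the last time before `t₁` at which the two families agree
  have hsub : Icc 0 t₁ ⊆ Icc 0 T := Icc_subset_Icc_right ht₁.2.le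
  have hZ : IsCompact (Icc 0 t₁ ∩ M ⁻¹' {0}) :=
    isCompact_Icc.of_isClosed_subset
      ((hMc.mono hsub).preimage_isClosed_of_isClosed isClosed_Icc isClosed_singleton)
      inter_subset_left
  have hZne : (Icc 0 t₁ ∩ M ⁻¹' {0}).Nonempty := by
    refine ⟨0, ⟨le_rfl, ht₁.1⟩, ?_⟩
    obtain ⟨P, hP, e, -⟩ := exists_eq_maxAbs hS.compact hne (hcs 0 ⟨le_rfl, ht₁.1.trans ht₁.2.le⟩)
    rw [mem_preimage, mem_singleton_iff, hMdef, e]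
    simp [w, h0 P hP]
  obtain ⟨a, ⟨⟨ha0, hat⟩, haM⟩, hlast⟩ := hZ.exists_isGreatest hZne
  rw [mem_preimage, mem_singleton_iff] at haM
  have hat₁ : a < t₁ := lt_of_le_of_ne hat fun e => hM1 (e ▸ haM)
  have haT : a ∈ Ico 0 T := ⟨ha0, hat₁.trans ht₁.2⟩
  have heq := hzero a ⟨ha0, haT.2.le⟩ haM
  have hMpos : ∀ t ∈ Ioc a t₁, 0 < M t := fun t ht => by
    have ht0 : t ∈ Icc 0 t₁ := ⟨ha0.trans ht.1.le, ht.2⟩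
    refine lt_of_le_of_ne (hM0 t (hsub ht0)) fun e => ?_
    exact ht.1.not_ge (hlast ⟨ht0, e.symm⟩)
  obtain ⟨C, hC, η, hη, hg⟩ := exists_uniform_growth_bound hS.compact fun P hP =>
    hasGrowthBound hn hu₀ hX hS hα h₁ h₂ hE₁ hE₂ haT heq hP
  obtain ⟨C', hC', η', hη', hg'⟩ := exists_uniform_growth_bound hS.compact fun P hP =>
    hasGrowthBound hn hu₀ hX hS hα h₂ h₁ hE₂ hE₁ haT (fun P hP => (heq P hP).symm) hP
  set b := min t₁ (a + min η η') with hb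
  have hab : a < b := lt_min hat₁ (lt_add_of_pos_right a (lt_min hη hη'))
  have hbt : b ≤ t₁ := min_le_left _ _
  have hbη : b ≤ a + η := (min_le_right _ _).trans (by gcongr; exact min_le_left _ _)
  have hbη' : b ≤ a + η' := (min_le_right _ _).trans (by gcongr; exact min_le_right _ _)
  have hbT : b < T := hbt.trans_lt ht₁.2
  refine (pos_of_deriv_le_mul (M := M) (L := fun t => max C C' * (1 + 1 / α t ^ 2)) hab
    (hMc.mono (Icc_subset_Icc ha0 hbT.le)) (fun t ht => hMpos t ⟨ht.1, ht.2.trans hbt⟩) ?_ ?_ ?_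
    ?_).ne' haM
  · intro p hp
    have hp0 : 0 < p := ha0.trans_lt hp.1
    obtain ⟨K₁, hK₁, H₁⟩ := h₁.exists_time_lipschitz hS.compact hp0 hbT
    obtain ⟨K₂, hK₂, H₂⟩ := h₂.exists_time_lipschitz hS.compact hp0 hbT
    refine ⟨Real.toNNReal (K₁ + K₂), LipschitzOnWith.of_dist_le_mul fun s hs t ht => ?_⟩
    have hmem : ∀ s ∈ Icc p b, s ∈ Icc 0 T := fun s hs => ⟨hp0.le.trans hs.1, hs.2.trans hbT.le⟩
    rw [Real.coe_toNNReal _ (by positivity)]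
    refine abs_maxAbs_sub_le hS.compact hne (hcs s (hmem s hs)) (hcs t (hmem t ht)) fun P hP => ?_
    have e : w P s - w P t = (u₁ P s - u₁ P t) - (u₂ P s - u₂ P t) := by
      simp only [w]
      ring
    rw [e, add_mul, Real.dist_eq]
    exact (abs_sub _ _).trans (add_le_add (H₁ P hP s hs t ht) (H₂ P hP s hs t ht))
  · rw [intervalIntegrable_iff_integrableOn_Ioc_of_le hab.le]
    refine MeasureTheory.Integrable.const_mul ?_ _
    refine MeasureTheory.Integrable.add ?_ (hint.mono_set (Ioc_subset_Ioc ha0 hbT.le))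
    exact MeasureTheory.integrable_const _
  · intro t _
    have : 0 ≤ max C C' := hC.trans (le_max_left _ _)
    positivity
  · intro t ht hMd
    have htT : t ∈ Ioo 0 T := ⟨ha0.trans_lt ht.1, ht.2.trans hbT⟩
    have htI : t ∈ Icc 0 T := Ioo_subset_Icc_self htT
    obtain ⟨P, hP, e, hmax⟩ := exists_eq_maxAbs hS.compact hne (hcs t htI)
    have hMt : 0 < M t := hMpos t ⟨ht.1, ht.2.le.trans hbt⟩
    rw [← hMdef] at e
    have hwd : HasDerivAt (w P) (deriv (u₁ P) t - deriv (u₂ P) t) t :=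
      ((h₁.contDiffAt_time htT hP).differentiableAt (by simp)).hasDerivAt.sub
        ((h₂.contDiffAt_time htT hP).differentiableAt (by simp)).hasDerivAt
    -- a signed branch of `|w(P, ·)|` touches the maximum from below at `t`
    have htouch : ∀ (f : ℝ → ℝ) (f' : ℝ), HasDerivAt f f' t → f t = M t →
        (∀ s, f s ≤ |w P s|) → deriv M t = f' := by
      intro f f' hf hft hfle
      have hmin : IsLocalMin (fun s => M s - f s) t := by
        filter_upwards [Icc_mem_nhds htT.1 htT.2] with s hs
        obtain ⟨P', -, e', hmax'⟩ := exists_eq_maxAbs hS.compact hne (hcs s hs)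
        have h1 := hmax' P hP
        rw [← e', ← hMdef] at h1
        rw [hft, sub_self, sub_nonneg]
        exact (hfle s).trans h1
      exact sub_eq_zero.1 (hmin.hasDerivAt_eq_zero (hMd.hasDerivAt.sub hf))
    have hα0 : 0 ≤ 1 + 1 / α t ^ 2 := by positivity
    rcases abs_cases (w P t) with ⟨hs, hs0⟩ | ⟨hs, hs0⟩
    · rw [htouch (w P) _ hwd (by rw [e, hs]) fun s => le_abs_self _, e, hs]
      refine (hg P hP t ⟨ht.1, ht.2.trans_le hbη⟩ (fun P' hP' => ?_) ?_).trans ?_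
      · have := (le_abs_self _).trans (hmax P' hP')
        rwa [hs] at this
      · rw [e, hs] at hMt
        exact hMt
      · exact mul_le_mul_of_nonneg_right
          (mul_le_mul_of_nonneg_right (le_max_left _ _) hα0) hs0
    · rw [htouch (fun s => -w P s) _ hwd.neg (by rw [e, hs]) fun s => neg_le_abs _, e, hs]
      have hneg : -w P t = u₂ P t - u₁ P t := neg_sub _ _
      rw [hneg, neg_sub]
      refine (hg' P hP t ⟨ht.1, ht.2.trans_le hbη'⟩ (fun P' hP' => ?_) ?_).trans ?_
      · have := (neg_le_abs _).trans (hmax P' hP')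
        rw [hs, hneg] at this
        rwa [← neg_sub (u₁ P' t)]
      · rw [e, hs, hneg] at hMt
        exact hMt
      · refine mul_le_mul_of_nonneg_right
          (mul_le_mul_of_nonneg_right (le_max_right _ _) hα0) ?_
        rw [← hneg]
        exact neg_nonneg.2 hs0.le

end Uniqueness

theorem mainTheorem6 (n : ℕ) (hn : 2 ≤ n) (A : ℝ) (hA : 0 < A)
    (b₀ : ℝ) (u₀ : ℝ → ℝ) (hu₀ : IsInitialProfile n b₀ u₀)
    (ε₀ ε₁ : ℝ) (X : Amb n → Amb n) (hX : IsTransverseField b₀ u₀ ε₀ ε₁ X)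
    (S : Set (Amb n)) (ρ c d δ : ℝ)
    (hS : IsReferenceHypersurface b₀ u₀ ε₀ ε₁ X S ρ c d δ)
    (T : ℝ) (hT : 0 < T) (α : ℝ → ℝ) (hα : ∀ t ∈ Set.Ioc 0 T, 0 < α t)
    (Γ₁ Γ₂ D₁ D₂ : ℝ → Set (Amb n)) (u₁ u₂ : Amb n → ℝ → ℝ)
    (h₁ : IsAdmissibleFamily ε₀ X S ρ c d δ T α Γ₁ D₁ u₁)
    (h₂ : IsAdmissibleFamily ε₀ X S ρ c d δ T α Γ₂ D₂ u₂)
    (hflow₁ : EvolvesByForcedMCF A T Γ₁ D₁) (hflow₂ : EvolvesByForcedMCF A T Γ₂ D₂)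
    (hinit : Γ₁ 0 = Γ₂ 0)
    (hint : MeasureTheory.IntegrableOn (fun t => 1 / α t ^ 2) (Set.Ioc 0 T) MeasureTheory.volume) :
    ∀ t ∈ Set.Ioc 0 T, Γ₁ t = Γ₂ t := by
  have h0T : (0 : ℝ) ∈ Icc 0 T := ⟨le_rfl, hT.le⟩
  have h0 : ∀ P ∈ S, u₁ P 0 = u₂ P 0 := fun P hP => by
    obtain ⟨hu, Q, hQ, hf⟩ := (h₁.graph 0 h0T).1 P hP
    exact (h₂.graph 0 h0T).2.1 P hP _ hu Q (hinit ▸ hQ) hf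
  have hlt := eqOn_of_hasGrowthBound hn hu₀ hX hS hα h₁ h₂ hflow₁ hflow₂ hint h0
  have hle : ∀ t ∈ Icc 0 T, ∀ P ∈ S, u₁ P t = u₂ P t := by
    intro t ht P hP
    have hcont : ∀ {u : Amb n → ℝ → ℝ}, ContinuousOn (Function.uncurry u) (S ×ˢ Icc 0 T) →
        ContinuousOn (u P) (Icc 0 T) := fun {u} hu =>
      ContinuousOn.comp (g := Function.uncurry u) (f := fun t => (P, t)) hu
        (Continuous.prodMk_right P).continuousOn fun _ ht => ⟨hP, ht⟩
    have hcl : Icc 0 T ⊆ closure (Ico 0 T) := by rw [closure_Ico hT.ne]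
    exact Set.EqOn.of_subset_closure (fun t ht => hlt t ht P hP) (hcont h₁.continuousOn)
      (hcont h₂.continuousOn) Ico_subset_Icc_self hcl ht
  have key : ∀ {Γ Γ' D D' : ℝ → Set (Amb n)} {u u' : Amb n → ℝ → ℝ},
      IsAdmissibleFamily ε₀ X S ρ c d δ T α Γ D u → IsAdmissibleFamily ε₀ X S ρ c d δ T α Γ' D' u' →
      (∀ t ∈ Icc 0 T, ∀ P ∈ S, u P t = u' P t) → ∀ t ∈ Ioc 0 T, Γ t ⊆ Γ' t := by
    intro Γ Γ' D D' u u' h h' he t ht Q hQ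
    have ht' : t ∈ Icc 0 T := ⟨ht.1.le, ht.2⟩
    obtain ⟨P, hP, hr⟩ := h.exists_reaches_to hn hu₀ hX hS ht hQ
    rw [he t ht' P hP] at hr
    exact h'.mem_of_reaches hX ht' hP hr
  intro t ht
  exact (key h₁ h₂ hle t ht).antisymm (key h₂ h₁ (fun t ht P hP => (hle t ht P hP).symm) t ht)
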